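/- Let $K$ be a non-Archimedean local field with residue field of cardinality $q$, normalized absolute value $|\cdot|$, ring of integers $O$, and Haar measure $dx$ with $\int_O dx=1$. On $K^n$ put $\|x\|=\max_j|x_j|$ and use the product measure $d^nx$; $L_p$ means $L_p(K^n)$ and $*$ is convolution over $K^n$. Fix an additive character $\chi$ of $K$ of rank zero (trivial on $O$, and $\chi(x_0)\neq1$ for some $|x_0|=q$), and define on $K^n$ the Fourier transform $\widetilde f(\xi)=\int\chi(x\cdot\xi)f(x)\,d^nx$ with inverse $g\mapsto\int\chi(-x\cdot\xi)g(\xi)\,d^n\xi$, and similarly on $K$. Let $\Phi(K^n)$ be the space of locally constant compactly supported $\varphi:K^n\to\mathbb C$ with $\int\varphi\,d^nx=0$. For $\alpha>0$ let $D^{\alpha}$ and $D^{\alpha,n}$ be the pseudo-differential operators on $\Phi(K)$ and $\Phi(K^n)$ with symbols $|\xi|^\alpha$ and $\|\xi\|^\alpha$. Consider the equation $$D_t^\alpha F-D_x^{\alpha,n}F=0,\qquad t\in K,\ x\in K^n, \tag{W}$$ for functions $F:K\times K^n\to\mathbb C$ such that $F(\cdot,x)\in\Phi(K)$ depends only on $|t|$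 for each $x$, and $F(t,\cdot)\in\Phi(K^n)$ for each $t$. Put $$A(x)=\frac{1-q^{-n+1}}{1-q^{-1}}\|x\|^{-1},\qquad B_t(x)=|t|^{-n}\,\widetilde b(t^{-1}x)\ (t\ne0),\qquad \widetilde b(\zeta)=\begin{cases}\frac{q-q^n}{q-1},&\|\zeta\|\le q^{-1},\\ \frac{q}{q-1},&\|\zeta\|=1,\\ 0,&\|\zeta\|>1.\end{cases}$$ **(1)** Let $n\ge2$. For every $\alpha>0$ and $\varphi\in\Phi(K^n)$ the modified Cauchy problem consisting of (W) and $(D_t^{n-1}F)(0,x)=\varphi(x)$ has exactly one solution $F_2$ in this class, and $$F_2(t,\cdot)=A*B_t*\varphi\quad(t\neq0),\qquad F_2(0,\cdot)=A*\varphi ,$$ the convolutions being absolutely convergent, with $A*B_t*\varphi=A*(B_t*\varphi)$. There is a constant $C$, independent of $\alpha,\varphi,\varkappa,t$, such that $\|F_2(t,\cdot)\|_{L_\varkappa}\le C\|A*\varphi\|_{L_\varkappa}$ for all $\alpha>0$, $\varphi\in\Phi(K^n)$, $1<\varkappa<\infty$ and $t\in K$. For every $1<\varkappa<\frac n{n-1}$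 there is a constant $C'$, independent of $\alpha,\varphi,t$, such that for all $\alpha>0$, $\varphi\in\Phi(K^n)$ and $t\in K$ $$\|F_2(t,\cdot)\|_{L_\lambda}\le C'\|\varphi\|_{L_\varkappa},\qquad \lambda=\frac{n\varkappa}{n-\varkappa(n-1)} .$$ **(2)** Let $n\ge1$. For every $\alpha>0$ and $\varphi\in\Phi(K^n)$ the Cauchy problem consisting of (W) and $F(0,x)=\varphi(x)$ has exactly one solution $F_1$ in this class, and $F_1(t,\cdot)=B_t*\varphi$ for $t\ne0$ (absolutely convergent). There is a constant $C$, independent of $\alpha,\varphi,\varkappa,t$, such that $\|F_1(t,\cdot)\|_{L_\varkappa}\le C\|\varphi\|_{L_\varkappa}$ for all $\alpha>0$, $\varphi\in\Phi(K^n)$, $1<\varkappa<\infty$ and $t\in K$. -/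

import Mathlib

open MeasureTheory
open scoped NNReal ENNReal

namespace NAWave

noncomputable section

section Field

variable (K : Type*) [NontriviallyNormedField K] [IsUltrametricDist K]

open scoped NormedField Valued in
/-- The cardinality `q` of the residue field `O / P`, where `O` is the closed and `P` the open
unit ball of `K`. -/
def residueCard : ℕ := Nat.card 𝓀[K]

/-- The absolute value of `K` is normalized: a prime element `β` (that is, `P = βO`) has
absolute value `q⁻¹`. -/
def IsNormalizedAbs : Prop :=
  ∃ β : K, {x : K | ‖x‖ < 1} = {x : K | ∃ y : K, ‖y‖ ≤ 1 ∧ x = β * y} ∧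
    ‖β‖ = (residueCard K : ℝ)⁻¹

end Field

variable {K : Type*} [NontriviallyNormedField K]

/-- A rank zero additive character: trivial on `O`, but not on all elements of absolute
value `q`. (Triviality on the open subgroup `O` already makes it continuous.) -/
structure IsRankZero [IsUltrametricDist K] (χ : AddChar K Circle) : Prop where
  trivial_on_integers : ∀ x : K, ‖x‖ ≤ 1 → χ x = 1
  nontrivial_on_sphere : ∃ x : K, ‖x‖ = residueCard K ∧ χ x ≠ 1

section Measure

variable (K) [LocallyCompactSpace K] [MeasurableSpace K] [BorelSpace K]

/-- The closed unit ball `O` as a compact set with non-empty interior. -/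
def unitBall : TopologicalSpace.PositiveCompacts K where
  carrier := Metric.closedBall 0 1
  isCompact' :=
    haveI : ProperSpace K := ProperSpace.of_locallyCompactSpace K
    isCompact_closedBall 0 1
  interior_nonempty' :=
    ⟨0, Metric.ball_subset_interior_closedBall (Metric.mem_ball_self one_pos)⟩

/-- The Haar measure of the additive group of `K` for which `O` has measure `1`. -/
def haar : Measure K := Measure.addHaarMeasure (unitBall K)

/-- The product Haar measure `dⁿx` on `Kⁿ`. The norm on `Fin n → K` is `max |x_j|`. -/
def haarPi (n : ℕ) : Measure (Fin n → K) := Measure.pi fun _ => haar K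

end Measure

variable [LocallyCompactSpace K] [MeasurableSpace K] [BorelSpace K]

/-! Test functions. -/

/-- The Lizorkin space `Φ(K)`: locally constant functions with compact support and
integral zero. -/
structure IsLizorkinLine (f : K → ℂ) : Prop where
  isLocallyConstant : IsLocallyConstant f
  hasCompactSupport : HasCompactSupport f
  integral_eq_zero : ∫ x, f x ∂(haar K) = 0

/-- The Lizorkin space `Φ(Kⁿ)`: locally constant functions with compact support and
integral zero. -/
structure IsLizorkin {n : ℕ} (f : (Fin n → K) → ℂ) : Prop where
  isLocallyConstant : IsLocallyConstant f
  hasCompactSupport : HasCompactSupport f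
  integral_eq_zero : ∫ x, f x ∂(haarPi K n) = 0

/-! The Fourier transform and the pseudo-differential operators. -/

/-- The Fourier transform on `K`. -/
def fourierLine (χ : AddChar K Circle) (f : K → ℂ) (ξ : K) : ℂ :=
  ∫ x, (χ (x * ξ) : ℂ) * f x ∂(haar K)

/-- The inverse Fourier transform on `K`. -/
def fourierLineInv (χ : AddChar K Circle) (g : K → ℂ) (x : K) : ℂ :=
  ∫ ξ, (χ (-(x * ξ)) : ℂ) * g ξ ∂(haar K)

/-- The fractional differentiation operator `D^α` on functions of one variable, with symbol
`|ξ|^α`. -/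
def fracDerivLine (χ : AddChar K Circle) (α : ℝ) (f : K → ℂ) : K → ℂ :=
  fourierLineInv χ fun ξ => ((‖ξ‖ ^ α : ℝ) : ℂ) * fourierLine χ f ξ

/-- The Fourier transform on `Kⁿ`. -/
def fourier {n : ℕ} (χ : AddChar K Circle) (f : (Fin n → K) → ℂ) (ξ : Fin n → K) : ℂ :=
  ∫ x, (χ (∑ j, x j * ξ j) : ℂ) * f x ∂(haarPi K n)

/-- The inverse Fourier transform on `Kⁿ`. -/
def fourierInv {n : ℕ} (χ : AddChar K Circle) (g : (Fin n → K) → ℂ) (x : Fin n → K) : ℂ :=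
  ∫ ξ, (χ (-∑ j, x j * ξ j) : ℂ) * g ξ ∂(haarPi K n)

/-- The operator `D^{α,n}` on functions of `n` variables, with symbol `‖ξ‖^α`. -/
def fracDeriv {n : ℕ} (χ : AddChar K Circle) (α : ℝ) (f : (Fin n → K) → ℂ) :
    (Fin n → K) → ℂ :=
  fourierInv χ fun ξ => ((‖ξ‖ ^ α : ℝ) : ℂ) * fourier χ f ξ

/-! The Cauchy problems. -/

/-- `F(t, x)` is a solution of the wave equation `D_t^α F - D_x^{α,n} F = 0` which, for each `x`,
belongs to `Φ(K)` and is radial in `t` and, for each `t`, belongs to `Φ(Kⁿ)` in `x`. -/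
structure IsWaveSolution {n : ℕ} (χ : AddChar K Circle) (α : ℝ)
    (F : K → (Fin n → K) → ℂ) : Prop where
  lizorkin_time : ∀ x, IsLizorkinLine fun t => F t x
  radial_time : ∀ x t t', ‖t‖ = ‖t'‖ → F t x = F t' x
  lizorkin_space : ∀ t, IsLizorkin (F t)
  equation : ∀ t x, fracDerivLine χ α (fun s => F s x) t - fracDeriv χ α (F t) x = 0

/-- The Cauchy problem: the wave equation with `F(0, x) = φ(x)`. -/
structure IsCauchySolution {n : ℕ} (χ : AddChar K Circle) (α : ℝ) (φ : (Fin n → K) → ℂ)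
    (F : K → (Fin n → K) → ℂ) : Prop extends IsWaveSolution χ α F where
  initial : ∀ x, F 0 x = φ x

/-- The modified Cauchy problem: the wave equation with `(D_t^{n-1} F)(0, x) = φ(x)`. It is used
for `n ≥ 2` only. -/
structure IsModifiedCauchySolution {n : ℕ} (χ : AddChar K Circle) (α : ℝ)
    (φ : (Fin n → K) → ℂ) (F : K → (Fin n → K) → ℂ) : Prop extends IsWaveSolution χ α F where
  initial : ∀ x, fracDerivLine χ ((n : ℝ) - 1) (fun s => F s x) 0 = φ x

/-! The kernels and the convolution. -/

/-- The kernel `A(x) = (1 - q^{-n+1}) / (1 - q^{-1}) · ‖x‖⁻¹`. -/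
def kernelA [IsUltrametricDist K] {n : ℕ} (x : Fin n → K) : ℂ :=
  (((1 - (residueCard K : ℝ) ^ (-(n : ℤ) + 1)) / (1 - (residueCard K : ℝ)⁻¹) * ‖x‖⁻¹ : ℝ) : ℂ)

/-- The function `b̃`. -/
def bTilde [IsUltrametricDist K] {n : ℕ} (ζ : Fin n → K) : ℂ :=
  if ‖ζ‖ ≤ (residueCard K : ℝ)⁻¹ then
    ((residueCard K : ℂ) - (residueCard K : ℂ) ^ n) / ((residueCard K : ℂ) - 1)
  else if ‖ζ‖ = 1 then (residueCard K : ℂ) / ((residueCard K : ℂ) - 1)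
  else 0

/-- The kernel `B_t(x) = |t|^{-n} b̃(t⁻¹ x)`, for `t ≠ 0`. -/
def kernelB [IsUltrametricDist K] {n : ℕ} (t : K) (x : Fin n → K) : ℂ :=
  ((‖t‖ ^ n)⁻¹ : ℝ) * bTilde (t⁻¹ • x)

/-- Convolution on `Kⁿ`: `(f * g)(x) = ∫ f(y) g(x - y) dⁿy`. -/
def conv {n : ℕ} (f g : (Fin n → K) → ℂ) : (Fin n → K) → ℂ :=
  convolution f g (ContinuousLinearMap.mul ℂ ℂ) (haarPi K n)

/-- The integral defining `(f * g)(x)` converges absolutely for every `x`. -/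
def ConvExists {n : ℕ} (f g : (Fin n → K) → ℂ) : Prop :=
  ConvolutionExists f g (ContinuousLinearMap.mul ℂ ℂ) (haarPi K n)

/-- The norm of `L_p(Kⁿ)` for a real exponent `p`. -/
def normL {n : ℕ} (p : ℝ) (f : (Fin n → K) → ℂ) : ℝ≥0∞ :=
  eLpNorm f (ENNReal.ofReal p) (haarPi K n)

end

end NAWave

open NAWave

/-! Everything reduces to averages over balls. Let `E_m` average over balls of radius `q⁻ᵐ`. These
balls are nested partitions, so the `E_m` behave like conditional expectations: `E_i E_j =
E_min(i,j)`. Since the Fourier transform of a ball indicator is a multiple of the indicator of the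
dual ball, `E_m` is also the cut-off to frequencies `‖ξ‖ ≤ qᵐ`, and `P_j = E_j - E_{j-1}` isolates
the frequencies of absolute value `qʲ`. A function in the Lizorkin space is a finite sum of its
parts `P_j φ`, and `D^α` multiplies `P_j φ` by `q^{jα}` (`fracDeriv_eq_multiplier`).

Existence. On the line there is a radial function `w_j` of the single frequency `qʲ` with `w_j(0) =
1`. Hence `∑ w_j(t) q^{-jβ} P_j φ` solves the equation with `(D_t^β F)(0) = φ`; here `β = 0` gives
the Cauchy problem and `β = n - 1` the modified one. For `|t| = qᵏ` it equals `q/(q-1) E_{-k} F(0) -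
1/(q-1) E_{1-k} F(0)`, which is convolution of `F(0)` with `B_t`. Convolution with `A` multiplies
`P_j` by `q^{-j(n-1)}` (`conv_kernelA`), so `F(0) = A * φ` in the modified problem.

Uniqueness. No joint regularity in `(t, x)` is assumed. Let `S_m(x)` and `T_m(x)` be the averages
over `|t| ≤ q⁻ᵐ` of `F(·, x)` and `D_t^α F(·, x)`. Radiality expresses `F(t, ·)` and, through the
equation, `D_x^α F(t, ·)` by two consecutive `S_m`, respectively `T_m`; moreover `T_m - T_{m-1} =
q^{mα}(S_m - S_{m-1})`. These relations force `S_m - S_{m-1}` to have only the spatial frequency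
`qᵐ` (`timeAvg_increment`). The time averages of `D_t^β F` then form a martingale in `x`.
Subtracting `E_m φ` gives a martingale that vanishes eventually at each point, and completeness of
`Kⁿ` makes it zero (`martingale_eq_zero`). So `φ` determines all increments, hence `F`.

Estimates. The `E_m` contract `L_p`, which bounds `F(t)` by `F(0)`. The `L_ϰ → L_λ` bound at time
zero is a Hardy–Littlewood–Sobolev inequality, obtained by Hedberg's argument: each `P_j φ` is
controlled both by a maximal function and by `q^{jn/ϰ} ‖φ‖_ϰ`, and Doob's inequality controls the
maximal function. -/

namespace NAWave

/-! ### Value group, residue classes and ultrametric norms. -/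

section Norms

variable {K : Type*} [NontriviallyNormedField K] [IsUltrametricDist K]

local notation "qK" => (residueCard K : ℝ)

-- Residue classes are the open unit balls inside `O`, so a section of the residue map supplies one
-- centre for each. A nonzero `Nat.card` excludes an infinite residue field.
open scoped NormedField Valued in
theorem exists_residue_representatives (h0 : residueCard K ≠ 0) :
    ∃ r : Fin (residueCard K) → K, (∀ i, ‖r i‖ ≤ 1) ∧
      (∀ i j, i ≠ j → ¬ ‖r i - r j‖ < 1) ∧ ∀ x : K, ‖x‖ ≤ 1 → ∃ i, ‖x - r i‖ < 1 := by
  have hle : ∀ x : K, x ∈ 𝒪[K] ↔ ‖x‖ ≤ 1 := fun x => by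
    rw [Valuation.mem_integer_iff]
    rfl
  have hres : ∀ x y : 𝒪[K], IsLocalRing.residue 𝒪[K] x = IsLocalRing.residue 𝒪[K] y ↔
      ‖(x : K) - y‖ < 1 := fun x y => by
    rw [← sub_eq_zero, ← map_sub, IsLocalRing.residue_eq_zero_iff, IsLocalRing.mem_maximalIdeal,
      mem_nonunits_iff, (Valuation.integer.integers _).isUnit_iff_valuation_eq_one]
    have h1 : ‖((x - y : 𝒪[K]) : K)‖ ≤ 1 := (hle _).1 (x - y).2
    have : (Valued.v (algebraMap 𝒪[K] K (x - y)) = 1) ↔ ‖((x - y : 𝒪[K]) : K)‖ = 1 := by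
      rw [← NNReal.coe_inj]; rfl
    rw [this]
    constructor
    · intro h; exact lt_of_le_of_ne h1 h
    · intro h; exact ne_of_lt h
  have : Finite 𝓀[K] := Nat.finite_of_card_ne_zero h0
  let e : 𝓀[K] ≃ Fin (residueCard K) := Finite.equivFin 𝓀[K]
  choose s hs using (IsLocalRing.residue_surjective (R := 𝒪[K]))
  refine ⟨fun i => (s (e.symm i) : K), fun i => (hle _).1 (s (e.symm i)).2, ?_, ?_⟩
  · intro i j hij h
    rw [← hres, hs, hs] at h
    exact hij (e.symm.injective h)
  · intro x hx
    refine ⟨e (IsLocalRing.residue 𝒪[K] ⟨x, (hle x).2 hx⟩), ?_⟩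
    have := (hres ⟨x, (hle x).2 hx⟩
      (s (IsLocalRing.residue 𝒪[K] ⟨x, (hle x).2 hx⟩))).1 (hs _).symm
    simpa using this

/-- If `β` were zero, no element would satisfy `0 < ‖x‖ < 1`, contrary to nontriviality of the norm.
-/
theorem exists_uniformizer (hK : IsNormalizedAbs K) :
    ∃ β : K, β ≠ 0 ∧ ‖β‖ < 1 ∧ ‖β‖ = qK⁻¹ ∧ ∀ x : K, ‖x‖ < 1 → ‖x‖ ≤ ‖β‖ := by
  obtain ⟨β, hβ, hn⟩ := hK
  have hle : ∀ x : K, ‖x‖ < 1 → ‖x‖ ≤ ‖β‖ := by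
    intro x hx
    have : x ∈ {x : K | ∃ y : K, ‖y‖ ≤ 1 ∧ x = β * y} := hβ ▸ hx
    obtain ⟨y, hy, rfl⟩ := this
    rw [norm_mul]
    exact mul_le_of_le_one_right (norm_nonneg _) hy
  have hlt : ‖β‖ < 1 := by
    have : β ∈ {x : K | ‖x‖ < 1} := by
      rw [hβ]; exact ⟨1, by simp, by simp⟩
    exact this
  refine ⟨β, ?_, hlt, hn, hle⟩
  rintro rfl
  obtain ⟨x, hx0, hx⟩ := NormedField.exists_norm_lt K one_pos
  have := hle x hx
  rw [norm_zero] at this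
  exact absurd hx0 (not_lt.2 this)

theorem one_lt_residueCard (hK : IsNormalizedAbs K) : 1 < qK := by
  obtain ⟨β, h0, h1, hn, -⟩ := exists_uniformizer hK
  rw [hn] at h1
  have hpos : 0 < qK⁻¹ := hn ▸ norm_pos_iff.2 h0
  rw [inv_pos] at hpos
  exact (inv_lt_one₀ hpos).1 h1

theorem residueCard_pos (hK : IsNormalizedAbs K) : 0 < qK :=
  one_pos.trans (one_lt_residueCard hK)

theorem residueCard_zpow_pos (hK : IsNormalizedAbs K) (m : ℤ) : 0 < qK ^ m :=
  zpow_pos (residueCard_pos hK) m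

theorem exists_norm_eq_zpow (hK : IsNormalizedAbs K) (m : ℤ) : ∃ t : K, t ≠ 0 ∧ ‖t‖ = qK ^ m := by
  obtain ⟨β, h0, h1, hn, -⟩ := exists_uniformizer hK
  exact ⟨β ^ (-m), zpow_ne_zero _ h0, by rw [norm_zpow, hn, inv_zpow, zpow_neg, inv_inv]⟩

/-- Dividing `x` by an element of the next larger norm `q^{m+1}` leaves a norm in `(q⁻¹, 1]`, and
the prime element excludes everything there below `1`. -/
theorem norm_eq_zpow (hK : IsNormalizedAbs K) {x : K} (hx : x ≠ 0) : ∃ m : ℤ, ‖x‖ = qK ^ m := by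
  obtain ⟨β, h0, h1, hn, hβ⟩ := exists_uniformizer hK
  obtain ⟨m, hm1, hm2⟩ := exists_mem_Ioc_zpow (norm_pos_iff.2 hx) (one_lt_residueCard hK)
  refine ⟨m + 1, le_antisymm hm2 ?_⟩
  obtain ⟨t, ht0, ht⟩ := exists_norm_eq_zpow hK (m + 1)
  by_contra hlt
  rw [not_le] at hlt
  have h3 : ‖x * t⁻¹‖ < 1 := by
    rw [norm_mul, norm_inv, ← div_eq_mul_inv, div_lt_one (norm_pos_iff.2 ht0), ht]; exact hlt
  have h4 := hβ _ h3
  rw [norm_mul, norm_inv, hn, ht, zpow_add_one₀ (residueCard_pos hK).ne'] at h4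
  have hp := residueCard_zpow_pos hK m
  have hq := residueCard_pos hK
  rw [← div_eq_mul_inv, div_le_iff₀ (by positivity)] at h4
  have : qK⁻¹ * (qK ^ m * qK) = qK ^ m := by field_simp
  rw [this] at h4
  exact absurd hm1 (not_lt.2 h4)

theorem pi_norm_eq_zpow (hK : IsNormalizedAbs K) {n : ℕ} {x : Fin n → K} (hx : x ≠ 0) :
    ∃ (m : ℤ) (j : Fin n), ‖x j‖ = ‖x‖ ∧ ‖x‖ = qK ^ m := by
  obtain ⟨i, hi⟩ : ∃ i, x i ≠ 0 := by
    by_contra h; push Not at h; exact hx (funext h)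
  have : Nonempty (Fin n) := ⟨i⟩
  obtain ⟨j, hj⟩ := Finite.exists_max fun j => ‖x j‖
  have hjx : ‖x‖ = ‖x j‖ :=
    le_antisymm ((pi_norm_le_iff_of_nonneg (norm_nonneg _)).2 hj) (norm_le_pi_norm x j)
  have : x j ≠ 0 := by
    intro h0
    have := hj i
    rw [h0, norm_zero] at this
    exact hi (norm_le_zero_iff.1 this)
  obtain ⟨m, hm⟩ := norm_eq_zpow hK this
  exact ⟨m, j, hjx.symm, hjx.trans hm⟩

theorem norm_lt_zpow_iff (hK : IsNormalizedAbs K) {n : ℕ} (x : Fin n → K) (m : ℤ) :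
    ‖x‖ < qK ^ m ↔ ‖x‖ ≤ qK ^ (m - 1) := by
  have hq := one_lt_residueCard hK
  constructor
  · intro h
    rcases eq_or_ne x 0 with rfl | hx
    · simpa using (residueCard_zpow_pos hK _).le
    · obtain ⟨k, -, -, hk⟩ := pi_norm_eq_zpow hK hx
      rw [hk] at h ⊢
      rw [zpow_lt_zpow_iff_right₀ hq] at h
      exact zpow_le_zpow_right₀ hq.le (by omega)
  · intro h
    exact h.trans_lt (zpow_lt_zpow_right₀ hq (by omega))

theorem norm_add_le_of_le {n : ℕ} {x y : Fin n → K} {r : ℝ} (hx : ‖x‖ ≤ r) (hy : ‖y‖ ≤ r) :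
    ‖x + y‖ ≤ r := (IsUltrametricDist.norm_add_le_max x y).trans (max_le hx hy)

theorem norm_sub_le_of_le {n : ℕ} {x y : Fin n → K} {r : ℝ} (hx : ‖x‖ ≤ r) (hy : ‖y‖ ≤ r) :
    ‖x - y‖ ≤ r := by
  rw [sub_eq_add_neg]; exact norm_add_le_of_le hx (by rwa [norm_neg])

end Norms

/-! ### Haar measure of balls. -/

section Haar

variable {K : Type*} [NontriviallyNormedField K]
  [LocallyCompactSpace K] [MeasurableSpace K] [BorelSpace K]

instance : (haar K).IsAddHaarMeasure := by unfold haar; infer_instance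

theorem haar_closedBall_one : haar K (Metric.closedBall 0 1) = 1 :=
  Measure.addHaarMeasure_self (K₀ := unitBall K)

instance [ProperSpace K] (n : ℕ) : (haarPi K n).IsAddHaarMeasure := by
  unfold haarPi; infer_instance

variable [IsUltrametricDist K]

local notation "qK" => (residueCard K : ℝ)

/-- Scaled residue representatives split the larger ball into `q` disjoint translates of the smaller
one. -/
theorem haar_closedBall_zpow_add_one (hK : IsNormalizedAbs K) (m : ℤ) :
    haar K (Metric.closedBall 0 (qK ^ (m + 1))) =
      residueCard K * haar K (Metric.closedBall 0 (qK ^ m)) := by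
  have hq := one_lt_residueCard hK
  obtain ⟨r, hr1, hr2, hr3⟩ := exists_residue_representatives (K := K) (by
    intro h; rw [h] at hq; norm_num at hq)
  obtain ⟨t, ht0, ht⟩ := exists_norm_eq_zpow hK (m + 1)
  obtain ⟨β, -, h1, hn, hβ⟩ := exists_uniformizer hK
  have hlt : ∀ x : K, ‖x‖ < 1 ↔ ‖t * x‖ ≤ qK ^ m := by
    intro x
    have hp := residueCard_zpow_pos hK (m + 1)
    have : qK ^ m = qK ^ (m + 1) * qK⁻¹ := by
      rw [zpow_add_one₀ (by positivity)]; field_simp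
    rw [norm_mul, ht, this, mul_le_mul_iff_right₀ hp, ← hn]
    exact ⟨hβ x, fun h => h.trans_lt h1⟩
  have hunion : Metric.closedBall (0 : K) (qK ^ (m + 1)) =
      ⋃ i, Metric.closedBall (t * r i) (qK ^ m) := by
    ext x
    simp only [Metric.mem_closedBall, Set.mem_iUnion, dist_eq_norm, sub_zero]
    constructor
    · intro hx
      have : ‖t⁻¹ * x‖ ≤ 1 := by
        rw [norm_mul, norm_inv, ht, inv_mul_le_one₀ (residueCard_zpow_pos hK _)]; exact hx
      obtain ⟨i, hi⟩ := hr3 _ this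
      refine ⟨i, ?_⟩
      rw [hlt, mul_sub, mul_inv_cancel_left₀ ht0] at hi
      exact hi
    · rintro ⟨i, hi⟩
      have h2 : ‖t * r i‖ ≤ qK ^ (m + 1) := by
        rw [norm_mul, ht]; exact mul_le_of_le_one_right (residueCard_zpow_pos hK _).le (hr1 i)
      have h3 : ‖x - t * r i‖ ≤ qK ^ (m + 1) :=
        hi.trans (zpow_le_zpow_right₀ hq.le (by omega))
      have := IsUltrametricDist.norm_add_le_max (x - t * r i) (t * r i)
      rw [sub_add_cancel] at this
      exact this.trans (max_le h3 h2)
  have hdisj : Pairwise (Function.onFun Disjoint fun i => Metric.closedBall (t * r i) (qK ^ m)) := by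
    intro i j hij
    rcases IsUltrametricDist.closedBall_eq_or_disjoint (t * r i) (t * r j) (qK ^ m) with h | h
    · exfalso
      have : t * r i ∈ Metric.closedBall (t * r j) (qK ^ m) :=
        h ▸ Metric.mem_closedBall_self (residueCard_zpow_pos hK _).le
      rw [Metric.mem_closedBall, dist_eq_norm, ← mul_sub, ← hlt] at this
      exact hr2 i j hij this
    · exact h
  rw [hunion, measure_iUnion hdisj fun i => Metric.isClosed_closedBall.measurableSet, tsum_fintype]
  have : ∀ i, haar K (Metric.closedBall (t * r i) (qK ^ m)) =
      haar K (Metric.closedBall 0 (qK ^ m)) := fun i =>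
    Measure.addHaar_closedBall_center _ _ _
  simp [this]

theorem haar_closedBall_zpow (hK : IsNormalizedAbs K) (m : ℤ) :
    haar K (Metric.closedBall 0 (qK ^ m)) = ENNReal.ofReal (qK ^ m) := by
  have hq := residueCard_pos hK
  have hc : (residueCard K : ℝ≥0∞) = ENNReal.ofReal qK := by simp
  have key : ∀ m : ℤ, haar K (Metric.closedBall 0 (qK ^ m)) = ENNReal.ofReal (qK ^ m) ↔
      haar K (Metric.closedBall 0 (qK ^ (m + 1))) = ENNReal.ofReal (qK ^ (m + 1)) := by
    intro m
    rw [haar_closedBall_zpow_add_one hK, zpow_add_one₀ hq.ne', mul_comm (qK ^ m),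
      ENNReal.ofReal_mul hq.le, hc, ENNReal.mul_right_inj (by simpa using hq.ne') (by simp)]
  induction m using Int.induction_on with
  | zero => simpa using haar_closedBall_one
  | succ i ih => exact (key _).1 ih
  | pred i ih => rw [key, sub_add_cancel]; exact ih

variable [ProperSpace K]

theorem haarPi_closedBall_zpow (hK : IsNormalizedAbs K) {n : ℕ} (x : Fin n → K) (m : ℤ) :
    haarPi K n (Metric.closedBall x (qK ^ m)) = ENNReal.ofReal (qK ^ (m * n)) := by
  rw [Measure.addHaar_closedBall_center, closedBall_pi _ (residueCard_zpow_pos hK m).le, haarPi,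
    Measure.pi_pi]
  simp [haar_closedBall_zpow hK, zpow_mul, ENNReal.ofReal_pow (residueCard_zpow_pos hK m).le]

theorem haarPi_real_closedBall_zpow (hK : IsNormalizedAbs K) {n : ℕ} (x : Fin n → K) (m : ℤ) :
    (haarPi K n).real (Metric.closedBall x (qK ^ m)) = qK ^ (m * n) := by
  rw [Measure.real, haarPi_closedBall_zpow hK, ENNReal.toReal_ofReal (residueCard_zpow_pos hK _).le]

end Haar

end NAWave

namespace NAWave

set_option linter.unusedSectionVars false

/-! ### Averages over balls as conditional expectations. -/

section Averages

variable {K : Type*} [NontriviallyNormedField K] [IsUltrametricDist K]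
  {n : ℕ} {W : Type*} [NormedAddCommGroup W]

local notation "qK" => (residueCard K : ℝ)

/-- Functions that are constant on the balls of radius `q⁻ᵐ`. -/
def IsLevel (m : ℤ) {X : Type*} (f : (Fin n → K) → X) : Prop :=
  ∀ x y, ‖x - y‖ ≤ qK ^ (-m) → f x = f y

/-- Locally constant functions with compact support. -/
structure IsTest (f : (Fin n → K) → W) : Prop where
  isLocallyConstant : IsLocallyConstant f
  hasCompactSupport : HasCompactSupport f

theorem IsLevel.mono (hK : IsNormalizedAbs K) {X : Type*} {f : (Fin n → K) → X} {m m' : ℤ}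
    (h : IsLevel m f) (hm : m ≤ m') : IsLevel m' f := fun x y hxy =>
  h x y (hxy.trans (zpow_le_zpow_right₀ (one_lt_residueCard hK).le (by omega)))

theorem IsLevel.isLocallyConstant (hK : IsNormalizedAbs K) {X : Type*} {f : (Fin n → K) → X}
    {m : ℤ} (h : IsLevel m f) : IsLocallyConstant f := by
  rw [IsLocallyConstant.iff_eventually_eq]
  intro x
  filter_upwards [Metric.closedBall_mem_nhds x (residueCard_zpow_pos hK (-m))] with y hy
  exact h y x (by rwa [Metric.mem_closedBall, dist_eq_norm] at hy)

theorem IsLevel.continuous (hK : IsNormalizedAbs K) {X : Type*} [TopologicalSpace X]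
    {f : (Fin n → K) → X} {m : ℤ} (h : IsLevel m f) : Continuous f :=
  (h.isLocallyConstant hK).continuous

theorem IsLevel.comp {X Y : Type*} {f : (Fin n → K) → X} {m : ℤ} (h : IsLevel m f) (u : X → Y) :
    IsLevel m fun x => u (f x) := fun x y hxy => congrArg u (h x y hxy)

theorem IsLevel.comp₂ {X Y Z : Type*} {f : (Fin n → K) → X} {g : (Fin n → K) → Y} {m : ℤ}
    (hf : IsLevel m f) (hg : IsLevel m g) (u : X → Y → Z) : IsLevel m fun x => u (f x) (g x) :=
  fun x y hxy => congrArg₂ u (hf x y hxy) (hg x y hxy)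

theorem IsTest.continuous {f : (Fin n → K) → W} (h : IsTest f) : Continuous f :=
  h.isLocallyConstant.continuous

theorem IsTest.zero : IsTest (fun _ : Fin n → K => (0 : W)) :=
  ⟨IsLocallyConstant.const 0, HasCompactSupport.zero⟩

theorem IsTest.comp {W' : Type*} [NormedAddCommGroup W'] {f : (Fin n → K) → W} (h : IsTest f)
    (u : W → W') (hu : u 0 = 0) : IsTest fun x => u (f x) :=
  ⟨h.isLocallyConstant.comp u, h.hasCompactSupport.comp_left hu⟩

theorem IsTest.comp₂ {W' W'' : Type*} [NormedAddCommGroup W'] [NormedAddCommGroup W'']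
    {f : (Fin n → K) → W} {g : (Fin n → K) → W'} (hf : IsTest f) (hg : IsTest g)
    (u : W → W' → W'') (hu : u 0 0 = 0) : IsTest fun x => u (f x) (g x) :=
  ⟨hf.isLocallyConstant.comp₂ hg.isLocallyConstant u,
    hf.hasCompactSupport.comp₂_left hg.hasCompactSupport hu⟩

theorem IsTest.sum {ι : Type*} (s : Finset ι) {f : ι → (Fin n → K) → W}
    (h : ∀ i ∈ s, IsTest (f i)) : IsTest fun x => ∑ i ∈ s, f i x := by
  classical
  induction s using Finset.induction_on with
  | empty => simpa using IsTest.zero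
  | insert a s ha ih =>
    simp_rw [Finset.sum_insert ha]
    exact (h a (Finset.mem_insert_self a s)).comp₂
      (ih fun i hi => h i (Finset.mem_insert_of_mem hi)) (· + ·) (add_zero 0)

theorem tendsto_residueCard_zpow_atTop (hK : IsNormalizedAbs K) (r : ℝ) : ∃ J : ℕ, r < qK ^ (J : ℤ) := by
  obtain ⟨J, hJ⟩ := pow_unbounded_of_one_lt r (one_lt_residueCard hK)
  exact ⟨J, by exact_mod_cast hJ⟩

/-- A test function is constant on small balls and vanishes outside of a large ball. -/
theorem IsTest.exists_level (hK : IsNormalizedAbs K) {f : (Fin n → K) → W} (h : IsTest f) :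
    ∃ J : ℕ, ∀ j : ℤ, J ≤ j → IsLevel j f ∧ ∀ x, qK ^ j < ‖x‖ → f x = 0 := by
  obtain ⟨δ, hδ, hδf⟩ := lebesgue_number_lemma_of_metric (s := tsupport f)
    (c := fun w : W => f ⁻¹' {w}) h.hasCompactSupport (fun w => h.isLocallyConstant.isOpen_fiber w)
    (fun x _ => Set.mem_iUnion.2 ⟨f x, rfl⟩)
  obtain ⟨R, hR⟩ := h.hasCompactSupport.isBounded.subset_closedBall (0 : Fin n → K)
  obtain ⟨J₁, hJ₁⟩ := tendsto_residueCard_zpow_atTop hK δ⁻¹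
  obtain ⟨J₂, hJ₂⟩ := tendsto_residueCard_zpow_atTop hK R
  have hq := (one_lt_residueCard hK).le
  have key : ∀ x y, ‖x - y‖ < δ → x ∈ tsupport f → f x = f y := by
    intro x y hxy hx
    obtain ⟨w, hw⟩ := hδf x hx
    have h1 : f x = w := hw (Metric.mem_ball_self hδ)
    have h2 : f y = w := hw (by rwa [Metric.mem_ball, dist_comm, dist_eq_norm])
    rw [h1, h2]
  refine ⟨max J₁ J₂, fun j hj => ⟨?_, ?_⟩⟩
  · intro x y hxy
    have hlt : ‖x - y‖ < δ := by
      refine hxy.trans_lt ?_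
      rw [zpow_neg]
      refine inv_lt_of_inv_lt₀ hδ (hJ₁.trans_le (zpow_le_zpow_right₀ hq ?_))
      push_cast at hj; omega
    by_cases hx : x ∈ tsupport f
    · exact key x y hlt hx
    · by_cases hy : y ∈ tsupport f
      · exact (key y x (by rwa [norm_sub_rev]) hy).symm
      · rw [image_eq_zero_of_notMem_tsupport hx, image_eq_zero_of_notMem_tsupport hy]
  · intro x hx
    apply image_eq_zero_of_notMem_tsupport
    intro hmem
    have h1 := hR hmem
    rw [mem_closedBall_zero_iff] at h1
    have h2 : qK ^ (J₂ : ℤ) ≤ qK ^ j := zpow_le_zpow_right₀ hq (by push_cast at hj; omega)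
    linarith

section Measure

variable [NormedSpace ℝ W] [LocallyCompactSpace K] [MeasurableSpace K] [BorelSpace K]

/-- The average of `f` over the ball of radius `q⁻ᵐ` around `x`. -/
noncomputable def ballAvg (m : ℤ) (f : (Fin n → K) → W) (x : Fin n → K) : W :=
  (qK ^ (m * n) : ℝ) • ∫ y in Metric.closedBall x (qK ^ (-m)), f y ∂(haarPi K n)

theorem isLevel_ballAvg (m : ℤ) (f : (Fin n → K) → W) : IsLevel m (ballAvg m f) := by
  intro x y hxy
  have : Metric.closedBall x (qK ^ (-m)) = Metric.closedBall y (qK ^ (-m)) :=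
    (IsUltrametricDist.closedBall_eq_of_mem (by rwa [Metric.mem_closedBall, dist_eq_norm])).symm
  rw [ballAvg, ballAvg, this]

variable [ProperSpace K]

theorem ballAvg_congr {m : ℤ} {f g : (Fin n → K) → W} {x : Fin n → K}
    (h : ∀ y, ‖y - x‖ ≤ qK ^ (-m) → f y = g y) : ballAvg m f x = ballAvg m g x := by
  rw [ballAvg, ballAvg, setIntegral_congr_fun Metric.isClosed_closedBall.measurableSet]
  intro y hy
  exact h y (by rwa [Metric.mem_closedBall, dist_eq_norm] at hy)

theorem ballAvg_smul {𝕜 : Type*} [NontriviallyNormedField 𝕜] [NormedSpace 𝕜 W]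
    [SMulCommClass ℝ 𝕜 W] (m : ℤ) (c : 𝕜) (f : (Fin n → K) → W) (x : Fin n → K) :
    ballAvg m (fun y => c • f y) x = c • ballAvg m f x := by
  rw [ballAvg, ballAvg, integral_smul, smul_comm]

theorem IsTest.integrable {f : (Fin n → K) → W} (h : IsTest f) : Integrable f (haarPi K n) :=
  h.continuous.integrable_of_hasCompactSupport h.hasCompactSupport

theorem integrableOn_closedBall {f : (Fin n → K) → W} (h : Continuous f) (x : Fin n → K) (r : ℝ) :
    IntegrableOn f (Metric.closedBall x r) (haarPi K n) :=
  h.continuousOn.integrableOn_compact (isCompact_closedBall x r)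

theorem ballAvg_sub (m : ℤ) {f g : (Fin n → K) → W} (hf : Continuous f) (hg : Continuous g)
    (x : Fin n → K) : ballAvg m (fun y => f y - g y) x = ballAvg m f x - ballAvg m g x := by
  rw [ballAvg, integral_sub (integrableOn_closedBall hf _ _) (integrableOn_closedBall hg _ _),
    smul_sub]
  rfl

theorem ballAvg_sum {ι : Type*} (m : ℤ) (s : Finset ι) {f : ι → (Fin n → K) → W}
    (hf : ∀ i ∈ s, Continuous (f i)) (x : Fin n → K) :
    ballAvg m (fun y => ∑ i ∈ s, f i y) x = ∑ i ∈ s, ballAvg m (f i) x := by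
  rw [ballAvg, integral_finsetSum _ fun i hi => integrableOn_closedBall (hf i hi) _ _,
    Finset.smul_sum]
  rfl

variable [CompleteSpace W]

theorem ballAvg_const (hK : IsNormalizedAbs K) (m : ℤ) (c : W) (x : Fin n → K) :
    ballAvg m (fun _ => c) x = c := by
  rw [ballAvg, setIntegral_const, haarPi_real_closedBall_zpow hK, smul_smul,
    ← zpow_add₀ (residueCard_pos hK).ne']
  simp

theorem IsLevel.ballAvg_eq (hK : IsNormalizedAbs K) {m : ℤ} {f : (Fin n → K) → W}
    (h : IsLevel m f) : ballAvg m f = f := by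
  ext x
  rw [ballAvg_congr (g := fun _ => f x) fun y hy => h y x hy, ballAvg_const hK]

/-- A ball at least as large as the one carrying `f` either contains it, and sees the integral of
`f`, or misses it. -/
theorem ballAvg_eq_zero_of_support (hK : IsNormalizedAbs K) {f : (Fin n → K) → W} {m j : ℤ}
    (hf : ∀ x, qK ^ (-m) < ‖x‖ → f x = 0) (h0 : ∫ x, f x ∂(haarPi K n) = 0) (hj : j ≤ m) :
    ballAvg j f = 0 := by
  have hq : qK ^ (-m) ≤ qK ^ (-j) := zpow_le_zpow_right₀ (one_lt_residueCard hK).le (by omega)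
  ext x
  by_cases hx : ‖x‖ ≤ qK ^ (-j)
  · rw [ballAvg, setIntegral_eq_integral_of_forall_compl_eq_zero, h0, smul_zero, Pi.zero_apply]
    intro y hy
    apply hf
    rw [Metric.mem_closedBall, dist_eq_norm] at hy
    by_contra hle
    exact hy (norm_sub_le_of_le ((not_lt.1 hle).trans hq) hx)
  · rw [ballAvg_congr (g := fun _ => (0 : W)), ballAvg_const hK, Pi.zero_apply]
    intro y hy
    apply hf
    by_contra hle
    apply hx
    have := norm_sub_le_of_le ((not_lt.1 hle).trans hq) hy
    rwa [sub_sub_cancel] at this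

theorem ballAvg_support (hK : IsNormalizedAbs K) {f : (Fin n → K) → W} {m j : ℤ}
    (hf : ∀ x, qK ^ m < ‖x‖ → f x = 0) (hj : -m ≤ j) (x : Fin n → K) (hx : qK ^ m < ‖x‖) :
    ballAvg j f x = 0 := by
  have hq : qK ^ (-j) ≤ qK ^ m := zpow_le_zpow_right₀ (one_lt_residueCard hK).le (by omega)
  rw [ballAvg_congr (g := fun _ => (0 : W)), ballAvg_const hK]
  intro y hy
  apply hf
  by_contra hle
  have := norm_sub_le_of_le (not_lt.1 hle) (hy.trans hq)
  rw [sub_sub_cancel] at this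
  exact absurd hx (not_lt.2 this)

theorem IsLevel.isTest (hK : IsNormalizedAbs K) {f : (Fin n → K) → W} {m : ℤ} (h : IsLevel m f)
    {r : ℝ} (hr : ∀ x, r < ‖x‖ → f x = 0) : IsTest f :=
  ⟨h.isLocallyConstant hK, HasCompactSupport.intro (isCompact_closedBall 0 r) fun x hx =>
    hr x (by simpa using hx)⟩

protected theorem IsTest.ballAvg (hK : IsNormalizedAbs K) {f : (Fin n → K) → W} (h : IsTest f) (m : ℤ) :
    IsTest (ballAvg m f) := by
  obtain ⟨J, hJ⟩ := h.exists_level hK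
  refine (isLevel_ballAvg m f).isTest hK (r := qK ^ (max (J : ℤ) (-m))) fun x hx => ?_
  exact ballAvg_support hK (hJ _ (le_max_left _ _)).2 (by omega) x hx

theorem isLevel_ballIndicator {W' : Type*} (hK : IsNormalizedAbs K) {m j : ℤ} (hm : m ≤ j)
    (y : Fin n → K) (a b : W') : IsLevel j fun x => if ‖x - y‖ ≤ qK ^ (-m) then a else b := by
  intro x x' hx
  have hq : qK ^ (-j) ≤ qK ^ (-m) := zpow_le_zpow_right₀ (one_lt_residueCard hK).le (by omega)
  have : ‖x - y‖ ≤ qK ^ (-m) ↔ ‖x' - y‖ ≤ qK ^ (-m) := by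
    constructor
    · intro h
      have := norm_sub_le_of_le h (hx.trans hq)
      have e : x - y - (x - x') = x' - y := by abel
      rwa [e] at this
    · intro h
      have := norm_add_le_of_le h (hx.trans hq)
      have e : x' - y + (x - x') = x - y := by abel
      rwa [e] at this
  simp only [this]

theorem integral_ballIndicator_smul (m : ℤ) (f : (Fin n → K) → W) (x : Fin n → K) :
    ∫ y, (if ‖y - x‖ ≤ qK ^ (-m) then (1 : ℝ) else 0) • f y ∂(haarPi K n) =
      ∫ y in Metric.closedBall x (qK ^ (-m)), f y ∂(haarPi K n) := by
  rw [← integral_indicator Metric.isClosed_closedBall.measurableSet]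
  congr 1
  ext y
  by_cases h : ‖y - x‖ ≤ qK ^ (-m)
  · rw [Set.indicator_of_mem (by rwa [Metric.mem_closedBall, dist_eq_norm]), if_pos h, one_smul]
  · rw [Set.indicator_of_notMem (by rwa [Metric.mem_closedBall, dist_eq_norm]), if_neg h, zero_smul]

/-- Averaging is self-adjoint, tested against functions it leaves invariant. -/
theorem integral_smul_ballAvg (hK : IsNormalizedAbs K) {m : ℤ} {g : (Fin n → K) → ℝ}
    (hg : IsLevel m g) {f : (Fin n → K) → W} (hf : IsTest f) :
    ∫ x, g x • ballAvg m f x ∂(haarPi K n) = ∫ x, g x • f x ∂(haarPi K n) := by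
  obtain ⟨J, hJ⟩ := hf.exists_level hK
  set R := max (J : ℤ) (-m) with hR
  have hsupp := (hJ R (le_max_left _ _)).2
  have hmR : qK ^ (-m) ≤ qK ^ R :=
    zpow_le_zpow_right₀ (one_lt_residueCard hK).le (le_max_right _ _)
  -- The indicator of `‖y - x‖ ≤ q⁻ᵐ` is symmetric in `x` and `y`. After exchanging the integrals,
  -- the inner one averages `g`, which is unchanged by averaging.
  let F : (Fin n → K) → (Fin n → K) → W := fun x y =>
    g x • (if ‖y - x‖ ≤ qK ^ (-m) then (1 : ℝ) else 0) • f y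
  have hFc : Continuous (Function.uncurry F) := by
    have h1 : Continuous fun p : (Fin n → K) × (Fin n → K) =>
        if ‖p.2 - p.1‖ ≤ qK ^ (-m) then (1 : ℝ) else 0 := by
      have := ((isLevel_ballIndicator hK (le_refl m) (0 : Fin n → K) (1 : ℝ) 0).continuous hK).comp
        ((continuous_snd.sub continuous_fst) :
          Continuous fun p : (Fin n → K) × (Fin n → K) => p.2 - p.1)
      simpa [Function.comp_def] using this
    exact ((hg.continuous hK).comp continuous_fst).smul
      (h1.smul (hf.continuous.comp continuous_snd))
  have hFs : HasCompactSupport (Function.uncurry F) := by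
    refine HasCompactSupport.intro ((isCompact_closedBall (0 : Fin n → K) (qK ^ R)).prod
      (isCompact_closedBall (0 : Fin n → K) (qK ^ R))) fun p hp => ?_
    obtain ⟨x, y⟩ := p
    simp only [Function.uncurry, F]
    by_cases hy : ‖y‖ ≤ qK ^ R
    · by_cases hxy : ‖y - x‖ ≤ qK ^ (-m)
      · exfalso
        apply hp
        refine ⟨?_, by simpa using hy⟩
        have := norm_sub_le_of_le hy (hxy.trans hmR)
        rw [sub_sub_cancel] at this
        simpa using this
      · rw [if_neg hxy, zero_smul, smul_zero]
    · rw [hsupp y (not_le.1 hy), smul_zero, smul_zero]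
  have hL : ∀ x, g x • ballAvg m f x = qK ^ (m * n) • ∫ y, F x y ∂(haarPi K n) := by
    intro x
    simp only [F]
    rw [integral_smul, integral_ballIndicator_smul, smul_comm]
    rfl
  have hR' : ∀ y, (qK ^ (m * n) • ∫ x, F x y ∂(haarPi K n)) = g y • f y := by
    intro y
    have h1 : ∀ x, F x y = ((if ‖x - y‖ ≤ qK ^ (-m) then (1 : ℝ) else 0) • g x) • f y := by
      intro x
      simp only [F]
      rw [smul_smul, norm_sub_rev, smul_eq_mul, mul_comm]
    simp_rw [h1]
    rw [integral_smul_const, integral_ballIndicator_smul, smul_smul]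
    congr 1
    exact congrFun (hg.ballAvg_eq hK) y
  calc ∫ x, g x • ballAvg m f x ∂(haarPi K n)
      = qK ^ (m * n) • ∫ x, ∫ y, F x y ∂(haarPi K n) ∂(haarPi K n) := by
        rw [← integral_smul]; exact integral_congr_ae (.of_forall hL)
    _ = qK ^ (m * n) • ∫ y, ∫ x, F x y ∂(haarPi K n) ∂(haarPi K n) := by
        rw [integral_integral_swap_of_hasCompactSupport hFc hFs]
    _ = _ := by
        rw [← integral_smul]; exact integral_congr_ae (.of_forall hR')

theorem integral_ballAvg (hK : IsNormalizedAbs K) (m : ℤ) {f : (Fin n → K) → W} (hf : IsTest f) :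
    ∫ x, ballAvg m f x ∂(haarPi K n) = ∫ x, f x ∂(haarPi K n) := by
  simpa using integral_smul_ballAvg hK (m := m) (g := fun _ => 1) (fun _ _ _ => rfl) hf

/-- The tower property. For `i ≤ j` it is self-adjointness tested against the indicator of a ball of
radius `q⁻ⁱ`, which is constant on the smaller balls. -/
theorem ballAvg_ballAvg (hK : IsNormalizedAbs K) (i j : ℤ) {f : (Fin n → K) → W} (hf : IsTest f) :
    ballAvg i (ballAvg j f) = ballAvg (min i j) f := by
  rcases le_total i j with h | h
  · ext x
    rw [min_eq_left h, ballAvg, ballAvg, ← integral_ballIndicator_smul,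
      ← integral_ballIndicator_smul, integral_smul_ballAvg hK (isLevel_ballIndicator hK h x 1 0) hf]
  · rw [min_eq_right h]
    exact ((isLevel_ballAvg j f).mono hK h).ballAvg_eq hK

end Measure

end Averages

end NAWave

namespace NAWave

set_option linter.unusedSectionVars false

/-! ### Frequency decomposition and multipliers by ball averages. -/

section Multipliers

variable {K : Type*} [NontriviallyNormedField K] [IsUltrametricDist K]
  [LocallyCompactSpace K] [MeasurableSpace K] [BorelSpace K] [ProperSpace K] {n : ℕ}

local notation "qK" => (residueCard K : ℝ)

theorem IsLizorkin.isTest {f : (Fin n → K) → ℂ} (h : IsLizorkin f) : IsTest f :=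
  ⟨h.isLocallyConstant, h.hasCompactSupport⟩

theorem IsTest.isLizorkin {f : (Fin n → K) → ℂ} (h : IsTest f)
    (h0 : ∫ x, f x ∂(haarPi K n) = 0) : IsLizorkin f :=
  ⟨h.isLocallyConstant, h.hasCompactSupport, h0⟩

theorem IsLizorkin.sum_mul {ι : Type*} (s : Finset ι) (c : ι → ℂ) {f : ι → (Fin n → K) → ℂ}
    (h : ∀ i ∈ s, IsLizorkin (f i)) : IsLizorkin fun x => ∑ i ∈ s, c i * f i x := by
  have ht : ∀ i ∈ s, IsTest fun x => c i * f i x := fun i hi =>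
    (h i hi).isTest.comp (c i * ·) (mul_zero _)
  refine (IsTest.sum s ht).isLizorkin ?_
  rw [integral_finsetSum _ fun i hi => (ht i hi).integrable]
  refine Finset.sum_eq_zero fun i hi => ?_
  rw [integral_const_mul, (h i hi).integral_eq_zero, mul_zero]

theorem IsLizorkin.const_mul {f : (Fin n → K) → ℂ} (h : IsLizorkin f) (c : ℂ) :
    IsLizorkin fun x => c * f x := by
  simpa using IsLizorkin.sum_mul {()} (fun _ => c) (f := fun _ => f) fun _ _ => h

theorem IsLizorkin.add {f g : (Fin n → K) → ℂ} (hf : IsLizorkin f) (hg : IsLizorkin g) :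
    IsLizorkin fun x => f x + g x := by
  refine (hf.isTest.comp₂ hg.isTest (· + ·) (add_zero 0)).isLizorkin ?_
  rw [integral_add hf.isTest.integrable hg.isTest.integrable, hf.integral_eq_zero,
    hg.integral_eq_zero, add_zero]

theorem IsLizorkin.sub {f g : (Fin n → K) → ℂ} (hf : IsLizorkin f) (hg : IsLizorkin g) :
    IsLizorkin fun x => f x - g x := by
  simpa [sub_eq_add_neg] using hf.add (hg.const_mul (-1))

protected theorem IsLizorkin.ballAvg (hK : IsNormalizedAbs K) {f : (Fin n → K) → ℂ} (h : IsLizorkin f)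
    (m : ℤ) : IsLizorkin (ballAvg m f) :=
  (h.isTest.ballAvg hK m).isLizorkin ((integral_ballAvg hK m h.isTest).trans h.integral_eq_zero)

/-- All frequencies of `f` have absolute values in `(q⁻ᴶ, qᴶ]`. -/
def HasBand (J : ℕ) (f : (Fin n → K) → ℂ) : Prop :=
  (∀ j : ℤ, J ≤ j → ballAvg j f = f) ∧ ∀ j : ℤ, j ≤ -J → ballAvg j f = 0

/-- Local constancy removes the high frequencies; compact support together with zero integral
removes the low ones. -/
theorem IsLizorkin.hasBand (hK : IsNormalizedAbs K) {f : (Fin n → K) → ℂ} (h : IsLizorkin f)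
    {J : ℕ} (hJ : ∀ j : ℤ, J ≤ j → IsLevel j f ∧ ∀ x, qK ^ j < ‖x‖ → f x = 0) : HasBand J f := by
  refine ⟨fun j hj => (hJ j hj).1.ballAvg_eq hK, fun j hj => ?_⟩
  refine ballAvg_eq_zero_of_support hK (m := -J) ?_ h.integral_eq_zero hj
  rw [neg_neg]
  exact (hJ J le_rfl).2

theorem IsLizorkin.exists_hasBand (hK : IsNormalizedAbs K) {f : (Fin n → K) → ℂ}
    (h : IsLizorkin f) : ∃ J : ℕ, HasBand J f := by
  obtain ⟨J, hJ⟩ := h.isTest.exists_level hK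
  exact ⟨J, h.hasBand hK hJ⟩

/-- The part of `f` with frequencies of absolute value `qʲ`. -/
noncomputable def bandPass (j : ℤ) (f : (Fin n → K) → ℂ) (x : Fin n → K) : ℂ :=
  ballAvg j f x - ballAvg (j - 1) f x

theorem bandPass_sum_mul {ι : Type*} (j : ℤ) (s : Finset ι) (c : ι → ℂ)
    {f : ι → (Fin n → K) → ℂ} (hf : ∀ i ∈ s, Continuous (f i)) (x : Fin n → K) :
    bandPass j (fun y => ∑ i ∈ s, c i * f i y) x = ∑ i ∈ s, c i * bandPass j (f i) x := by
  have h : ∀ i ∈ s, Continuous fun y => c i * f i y := fun i hi => (hf i hi).const_mul _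
  have h2 : ∀ (j : ℤ) (i : ι), ballAvg j (fun y => c i * f i y) x = c i * ballAvg j (f i) x :=
    fun j i => ballAvg_smul j (c i) (f i) x
  rw [bandPass, ballAvg_sum _ _ h, ballAvg_sum _ _ h, ← Finset.sum_sub_distrib]
  simp only [bandPass, h2, mul_sub]

theorem bandPass_const_mul (j : ℤ) (c : ℂ) (f : (Fin n → K) → ℂ) (x : Fin n → K) :
    bandPass j (fun y => c * f y) x = c * bandPass j f x := by
  have h2 : ∀ (j : ℤ), ballAvg j (fun y => c * f y) x = c * ballAvg j f x :=
    fun j => ballAvg_smul j c f x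
  rw [bandPass, bandPass, h2, h2, mul_sub]

theorem bandPass_sub (j : ℤ) {f g : (Fin n → K) → ℂ} (hf : Continuous f) (hg : Continuous g)
    (x : Fin n → K) : bandPass j (fun y => f y - g y) x = bandPass j f x - bandPass j g x := by
  simp only [bandPass, ballAvg_sub _ hf hg]; ring

theorem isLevel_bandPass (hK : IsNormalizedAbs K) (j : ℤ) (f : (Fin n → K) → ℂ) :
    IsLevel j (bandPass j f) :=
  (isLevel_ballAvg j f).comp₂ ((isLevel_ballAvg (j - 1) f).mono hK (by omega)) (· - ·)

protected theorem IsLizorkin.bandPass (hK : IsNormalizedAbs K) {f : (Fin n → K) → ℂ} (h : IsLizorkin f)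
    (j : ℤ) : IsLizorkin (bandPass j f) :=
  (h.ballAvg hK j).sub (h.ballAvg hK (j - 1))

theorem ballAvg_bandPass (hK : IsNormalizedAbs K) (i j : ℤ) {f : (Fin n → K) → ℂ}
    (hf : IsTest f) : ballAvg i (bandPass j f) = if j ≤ i then bandPass j f else 0 := by
  have e : ballAvg i (bandPass j f) = fun x => ballAvg (min i j) f x - ballAvg (min i (j - 1)) f x := by
    ext x
    have := ballAvg_sub i (hf.ballAvg hK j).continuous (hf.ballAvg hK (j - 1)).continuous x
    rw [← ballAvg_ballAvg hK i j hf, ← ballAvg_ballAvg hK i (j - 1) hf, ← this]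
    rfl
  rw [e]
  split_ifs with h
  · rw [min_eq_right h, min_eq_right (by omega)]; rfl
  · rw [min_eq_left (by omega), min_eq_left (by omega)]
    ext x; simp

/-- The frequency parts are mutually orthogonal projections, by the tower property. -/
theorem bandPass_bandPass (hK : IsNormalizedAbs K) (i j : ℤ) {f : (Fin n → K) → ℂ}
    (hf : IsTest f) : bandPass i (bandPass j f) = if i = j then bandPass j f else 0 := by
  ext x
  rw [bandPass, ballAvg_bandPass hK i j hf, ballAvg_bandPass hK (i - 1) j hf]
  split_ifs <;> first | omega | simp

theorem sum_Ioc_sub_pred {A : Type*} [AddCommGroup A] (g : ℤ → A) {a b : ℤ} (hab : a ≤ b) :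
    ∑ j ∈ Finset.Ioc a b, (g j - g (j - 1)) = g b - g a := by
  induction b, hab using Int.leInduction with
  | base => simp
  | succ b hb ih =>
    have : Finset.Ioc a (b + 1) = insert (b + 1) (Finset.Ioc a b) := by
      ext x; simp only [Finset.mem_Ioc, Finset.mem_insert]; omega
    rw [this, Finset.sum_insert (by simp), ih, add_sub_cancel_right]
    abel

/-- The operator that multiplies the part of frequency `qʲ` by `a j`. -/
noncomputable def multiplier (a : ℤ → ℂ) (f : (Fin n → K) → ℂ) (x : Fin n → K) : ℂ :=
  ∑ᶠ j : ℤ, a j * bandPass j f x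

theorem HasBand.bandPass_eq_zero {J : ℕ} {f : (Fin n → K) → ℂ} (h : HasBand J f) {j : ℤ}
    (hj : j ∉ Finset.Ioc (-(J : ℤ)) J) : bandPass j f = 0 := by
  ext x
  rw [Finset.mem_Ioc, not_and_or] at hj
  rcases hj with hj | hj
  · rw [bandPass, h.2 j (by omega), h.2 (j - 1) (by omega)]; simp
  · rw [bandPass, h.1 j (by omega), h.1 (j - 1) (by omega)]; simp

theorem HasBand.multiplier_eq {J : ℕ} {f : (Fin n → K) → ℂ} (h : HasBand J f) (a : ℤ → ℂ)
    (x : Fin n → K) :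
    multiplier a f x = ∑ j ∈ Finset.Ioc (-(J : ℤ)) J, a j * bandPass j f x := by
  refine finsum_eq_sum_of_support_subset _ fun j hj => ?_
  by_contra hmem
  apply hj
  simp only
  rw [h.bandPass_eq_zero hmem, Pi.zero_apply, mul_zero]

/-- The sum of the frequency parts telescopes to a high average, which is `f`, minus a low one,
which is zero. -/
theorem multiplier_one (hK : IsNormalizedAbs K) {f : (Fin n → K) → ℂ} (hf : IsLizorkin f) :
    multiplier (fun _ => 1) f = f := by
  obtain ⟨J, hJ⟩ := hf.exists_hasBand hK
  ext x
  simp only [hJ.multiplier_eq, one_mul, bandPass]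
  rw [sum_Ioc_sub_pred (fun j => ballAvg j f x) (by omega), hJ.1 J le_rfl, hJ.2 _ le_rfl]
  simp

/-- A function in the Lizorkin space is determined by its frequency parts. -/
theorem IsLizorkin.ext_bandPass (hK : IsNormalizedAbs K) {f g : (Fin n → K) → ℂ}
    (hf : IsLizorkin f) (hg : IsLizorkin g) (h : ∀ i x, bandPass i f x = bandPass i g x) :
    f = g := by
  rw [← multiplier_one hK hf, ← multiplier_one hK hg]
  ext x
  simp only [multiplier, h]

protected theorem IsLizorkin.multiplier (hK : IsNormalizedAbs K) {f : (Fin n → K) → ℂ} (hf : IsLizorkin f)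
    (a : ℤ → ℂ) : IsLizorkin (multiplier a f) := by
  obtain ⟨J, hJ⟩ := hf.exists_hasBand hK
  rw [funext (hJ.multiplier_eq a)]
  exact IsLizorkin.sum_mul _ _ fun j _ => hf.bandPass hK j

/-- Multipliers are diagonal in the frequency parts. With `IsLizorkin.ext_bandPass` this turns
identities between operators into identities between their symbols. -/
theorem bandPass_multiplier (hK : IsNormalizedAbs K) {f : (Fin n → K) → ℂ} (hf : IsLizorkin f)
    (a : ℤ → ℂ) (i : ℤ) (x : Fin n → K) :
    bandPass i (multiplier a f) x = a i * bandPass i f x := by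
  obtain ⟨J, hJ⟩ := hf.exists_hasBand hK
  rw [funext (hJ.multiplier_eq a),
    bandPass_sum_mul _ _ _ fun j _ => (hf.bandPass hK j).isTest.continuous]
  simp only [bandPass_bandPass hK i _ hf.isTest]
  by_cases hi : i ∈ Finset.Ioc (-(J : ℤ)) J
  · rw [Finset.sum_eq_single_of_mem i hi]
    · simp
    · intro j _ hj; rw [if_neg (Ne.symm hj)]; simp
  · rw [hJ.bandPass_eq_zero hi, Finset.sum_eq_zero]
    · simp
    · intro j hj; rw [if_neg (by rintro rfl; exact hi hj)]; simp

theorem multiplier_multiplier (hK : IsNormalizedAbs K) {f : (Fin n → K) → ℂ} (hf : IsLizorkin f)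
    (a b : ℤ → ℂ) : multiplier a (multiplier b f) = multiplier (fun j => a j * b j) f := by
  ext x
  rw [multiplier, multiplier]
  simp only [bandPass_multiplier hK hf, mul_assoc]

theorem ballAvg_eq_multiplier (hK : IsNormalizedAbs K) {f : (Fin n → K) → ℂ} (hf : IsLizorkin f)
    (m : ℤ) : ballAvg m f = multiplier (fun j => if j ≤ m then 1 else 0) f := by
  refine (hf.ballAvg hK m).ext_bandPass hK (hf.multiplier hK _) fun i x => ?_
  rw [bandPass_multiplier hK hf, bandPass, ballAvg_ballAvg hK _ _ hf.isTest,
    ballAvg_ballAvg hK _ _ hf.isTest]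
  split_ifs with h
  · rw [min_eq_left h, min_eq_left (by omega), one_mul, bandPass]
  · rw [min_eq_right (by omega), min_eq_right (by omega)]; ring

theorem multiplier_sum_mul (hK : IsNormalizedAbs K) {ι : Type*} (s : Finset ι) (c : ι → ℂ)
    {f : ι → (Fin n → K) → ℂ} (hf : ∀ i ∈ s, IsLizorkin (f i)) (a : ℤ → ℂ) :
    multiplier a (fun y => ∑ i ∈ s, c i * f i y) = fun x => ∑ i ∈ s, c i * multiplier a (f i) x := by
  refine ((IsLizorkin.sum_mul s c hf).multiplier hK a).ext_bandPass hK
    (IsLizorkin.sum_mul s c fun i hi => (hf i hi).multiplier hK a) fun i x => ?_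
  rw [bandPass_multiplier hK (IsLizorkin.sum_mul s c hf),
    bandPass_sum_mul _ _ _ fun i hi => (hf i hi).isTest.continuous,
    bandPass_sum_mul _ _ _ fun i hi => ((hf i hi).multiplier hK a).isTest.continuous,
    Finset.mul_sum]
  refine Finset.sum_congr rfl fun k hk => ?_
  rw [bandPass_multiplier hK (hf k hk)]
  ring

end Multipliers

end NAWave

namespace NAWave

set_option linter.unusedSectionVars false

/-! ### The symbol `‖ξ‖^α` in terms of averages. -/

section Fourier

variable {K : Type*} [NontriviallyNormedField K] [IsUltrametricDist K]
  [LocallyCompactSpace K] [MeasurableSpace K] [BorelSpace K] [ProperSpace K] {n : ℕ}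
  {χ : AddChar K Circle}

local notation "qK" => (residueCard K : ℝ)

theorem norm_sum_mul_le (x y : Fin n → K) : ‖∑ j, x j * y j‖ ≤ ‖x‖ * ‖y‖ := by
  refine IsUltrametricDist.norm_sum_le_of_forall_le_of_nonneg (by positivity) fun j _ => ?_
  rw [norm_mul]
  exact mul_le_mul (norm_le_pi_norm x j) (norm_le_pi_norm y j) (norm_nonneg _) (norm_nonneg _)

theorem IsRankZero.apply_sum_mul (hχ : IsRankZero χ) {x y : Fin n → K} (h : ‖x‖ * ‖y‖ ≤ 1) :
    χ (∑ j, x j * y j) = 1 :=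
  hχ.trivial_on_integers _ ((norm_sum_mul_le x y).trans h)

theorem IsRankZero.continuous (hχ : IsRankZero χ) : Continuous fun x => (χ x : ℂ) := by
  refine IsLocallyConstant.continuous ?_
  rw [IsLocallyConstant.iff_eventually_eq]
  intro x
  filter_upwards [Metric.closedBall_mem_nhds x one_pos] with y hy
  rw [Metric.mem_closedBall, dist_eq_norm] at hy
  have := hχ.trivial_on_integers _ hy
  rw [AddChar.map_sub_eq_div, div_eq_one] at this
  rw [this]

theorem sum_mul_add (x y h : Fin n → K) :
    ∑ j, x j * (y + h) j = ∑ j, x j * y j + ∑ j, x j * h j := by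
  simp [mul_add, Finset.sum_add_distrib]

theorem sum_add_mul (x y h : Fin n → K) :
    ∑ j, (x + h) j * y j = ∑ j, x j * y j + ∑ j, h j * y j := by
  simp [add_mul, Finset.sum_add_distrib]

/-- In a coordinate where `|x_i| = ‖x‖`, the entry `x₀ / x_i` of `h` makes the pairing equal to
`x₀`. Its size `q / ‖x‖` is at most `q⁻ᵐ` because `‖x‖ ≥ q^{m+1}`. -/
theorem IsRankZero.exists_ne_one (hK : IsNormalizedAbs K) (hχ : IsRankZero χ) {x : Fin n → K}
    {m : ℤ} (hx : qK ^ m < ‖x‖) : ∃ h : Fin n → K, ‖h‖ ≤ qK ^ (-m) ∧ χ (∑ j, x j * h j) ≠ 1 := by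
  have hp := residueCard_zpow_pos hK m
  have hx0 : x ≠ 0 := norm_pos_iff.1 (hp.trans hx)
  obtain ⟨k, i, hi, hk⟩ := pi_norm_eq_zpow hK hx0
  obtain ⟨x₀, hx₀, hne⟩ := hχ.nontrivial_on_sphere
  have hxi : x i ≠ 0 := by rw [← norm_pos_iff, hi]; exact hp.trans hx
  refine ⟨Pi.single i (x₀ / x i), ?_, ?_⟩
  · rw [Pi.norm_single, norm_div, hx₀, hi, div_le_iff₀ (hp.trans hx), hk]
    rw [hk, zpow_lt_zpow_iff_right₀ (one_lt_residueCard hK)] at hx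
    rw [← zpow_add₀ (residueCard_pos hK).ne']
    calc qK = qK ^ (1 : ℤ) := (zpow_one _).symm
      _ ≤ _ := zpow_le_zpow_right₀ (one_lt_residueCard hK).le (by omega)
  · rw [Finset.sum_eq_single i]
    · rwa [Pi.single_eq_same, mul_div_cancel₀ _ hxi]
    · intro j _ hj; rw [Pi.single_eq_of_ne hj, mul_zero]
    · intro h; exact absurd (Finset.mem_univ i) h

theorem eq_zero_of_eq_mul {I : ℂ} {z : Circle} (hz : z ≠ 1) (h : I = z * I) : I = 0 := by
  have h1 : ((z : ℂ) - 1) * I = 0 := by rw [sub_mul, ← h]; ring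
  rcases mul_eq_zero.1 h1 with h2 | h2
  · exact absurd (Circle.coe_eq_one.1 (sub_eq_zero.1 h2)) hz
  · exact h2

theorem integral_char_ball (hK : IsNormalizedAbs K) (hχ : IsRankZero χ) (m : ℤ) (x : Fin n → K) :
    ∫ ξ, (if ‖ξ‖ ≤ qK ^ m then (1 : ℝ) else 0) • (χ (∑ j, x j * ξ j) : ℂ) ∂(haarPi K n) =
      if ‖x‖ ≤ qK ^ (-m) then ((qK ^ (m * n) : ℝ) : ℂ) else 0 := by
  split_ifs with hx
  · have h := integral_ballIndicator_smul (-m) (fun ξ => (χ (∑ j, x j * ξ j) : ℂ)) (0 : Fin n → K)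
    simp only [sub_zero, neg_neg] at h
    rw [h, setIntegral_congr_fun (g := fun _ => (1 : ℂ)) Metric.isClosed_closedBall.measurableSet]
    · rw [setIntegral_const, haarPi_real_closedBall_zpow hK]; simp
    · intro ξ hξ
      rw [mem_closedBall_zero_iff] at hξ
      simp only
      rw [hχ.apply_sum_mul, Circle.coe_one]
      calc ‖x‖ * ‖ξ‖ ≤ qK ^ (-m) * qK ^ m :=
            mul_le_mul hx hξ (norm_nonneg _) (residueCard_zpow_pos hK _).le
        _ = 1 := by rw [← zpow_add₀ (residueCard_pos hK).ne']; simp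
  -- Translation by `h` preserves the ball and multiplies the integral by a character value other
  -- than `1`.
  · obtain ⟨h, hh, hne⟩ := hχ.exists_ne_one hK (not_le.1 hx)
    rw [neg_neg] at hh
    refine eq_zero_of_eq_mul hne ?_
    conv_lhs => rw [← integral_add_right_eq_self _ h]
    rw [← integral_const_mul]
    congr 1
    ext ξ
    have hiff : ‖ξ + h‖ ≤ qK ^ m ↔ ‖ξ‖ ≤ qK ^ m :=
      ⟨fun H => by simpa using norm_sub_le_of_le H hh, fun H => norm_add_le_of_le H hh⟩
    rw [sum_mul_add, AddChar.map_add_eq_mul, Circle.coe_mul]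
    simp only [hiff, Complex.real_smul]
    ring

theorem continuous_sum_mul_right (x : Fin n → K) :
    Continuous fun ξ : Fin n → K => ∑ j, x j * ξ j := by fun_prop

theorem continuous_ballIndicator (hK : IsNormalizedAbs K) (m : ℤ) :
    Continuous fun ξ : Fin n → K => if ‖ξ‖ ≤ qK ^ m then (1 : ℝ) else 0 := by
  simpa using (isLevel_ballIndicator hK (le_refl (-m)) (0 : Fin n → K) (1 : ℝ) 0).continuous hK

/-- After Fubini the inner integral is the transform of a ball indicator, that is, a multiple of the
indicator of the dual ball around `x`. -/
theorem fourierInv_ballIndicator_smul_fourier (hK : IsNormalizedAbs K) (hχ : IsRankZero χ) (m : ℤ)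
    {f : (Fin n → K) → ℂ} (hf : IsTest f) :
    fourierInv χ (fun ξ => (if ‖ξ‖ ≤ qK ^ m then (1 : ℝ) else 0) • fourier χ f ξ) =
      ballAvg m f := by
  ext x
  let F : (Fin n → K) → (Fin n → K) → ℂ := fun ξ y =>
    (χ (-∑ j, x j * ξ j) : ℂ) * ((if ‖ξ‖ ≤ qK ^ m then (1 : ℝ) else 0) •
      ((χ (∑ j, y j * ξ j) : ℂ) * f y))
  have hFc : Continuous (Function.uncurry F) := by
    refine Continuous.mul (hχ.continuous.comp ?_)
      (((continuous_ballIndicator hK m).comp continuous_fst).smul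
        (Continuous.mul (hχ.continuous.comp ?_) (hf.continuous.comp continuous_snd)))
    · exact ((continuous_sum_mul_right x).comp continuous_fst).neg
    · fun_prop
  have hFs : HasCompactSupport (Function.uncurry F) := by
    refine HasCompactSupport.intro ((isCompact_closedBall (0 : Fin n → K) (qK ^ m)).prod
      hf.hasCompactSupport) fun p hp => ?_
    obtain ⟨ξ, y⟩ := p
    simp only [Function.uncurry, F]
    by_cases hy : y ∈ tsupport f
    · have : ¬ ‖ξ‖ ≤ qK ^ m := fun h => hp ⟨by simpa using h, hy⟩
      rw [if_neg this, zero_smul, mul_zero]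
    · rw [image_eq_zero_of_notMem_tsupport hy, mul_zero, smul_zero, mul_zero]
  have h1 : ∀ ξ, (χ (-∑ j, x j * ξ j) : ℂ) *
      ((if ‖ξ‖ ≤ qK ^ m then (1 : ℝ) else 0) • fourier χ f ξ) = ∫ y, F ξ y ∂(haarPi K n) := by
    intro ξ
    rw [integral_const_mul, integral_smul, fourier]
  have h2 : ∀ y, ∫ ξ, F ξ y ∂(haarPi K n) =
      (qK ^ (m * n) : ℝ) • ((if ‖y - x‖ ≤ qK ^ (-m) then (1 : ℝ) else 0) • f y) := by
    intro y
    have h3 : ∀ ξ, F ξ y = ((if ‖ξ‖ ≤ qK ^ m then (1 : ℝ) else 0) •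
        (χ (∑ j, (y - x) j * ξ j) : ℂ)) * f y := by
      intro ξ
      have : ∑ j, (y - x) j * ξ j = -∑ j, x j * ξ j + ∑ j, y j * ξ j := by
        simp only [Pi.sub_apply, sub_mul, Finset.sum_sub_distrib]; ring
      simp only [F]
      rw [this, AddChar.map_add_eq_mul, Circle.coe_mul]
      simp only [Complex.real_smul]
      ring
    simp_rw [h3]
    rw [integral_mul_const, integral_char_ball hK hχ]
    split_ifs <;> simp
  rw [fourierInv, integral_congr_ae (.of_forall h1),
    integral_integral_swap_of_hasCompactSupport hFc hFs, integral_congr_ae (.of_forall h2),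
    integral_smul, integral_ballIndicator_smul]
  rfl

theorem isLevel_fourier (hK : IsNormalizedAbs K) (hχ : IsRankZero χ) {f : (Fin n → K) → ℂ} {J : ℤ}
    (hf : ∀ x, qK ^ J < ‖x‖ → f x = 0) : IsLevel J (fourier χ f) := by
  intro ξ η h
  rw [fourier, fourier]
  congr 1
  ext x
  by_cases hx : qK ^ J < ‖x‖
  · rw [hf x hx]; simp
  · have h1 : χ (∑ j, x j * (ξ - η) j) = 1 := hχ.apply_sum_mul <| by
      calc ‖x‖ * ‖ξ - η‖ ≤ qK ^ J * qK ^ (-J) :=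
            mul_le_mul (not_lt.1 hx) h (norm_nonneg _) (residueCard_zpow_pos hK _).le
        _ = 1 := by rw [← zpow_add₀ (residueCard_pos hK).ne']; simp
    have h2 : ∑ j, x j * ξ j = ∑ j, x j * η j + ∑ j, x j * (ξ - η) j := by
      rw [← sum_mul_add, add_sub_cancel]
    rw [h2, AddChar.map_add_eq_mul, h1, mul_one]

/-- So near zero the transform keeps its value at the origin, which is the integral of `f`. -/
theorem fourier_eq_zero_of_le (hK : IsNormalizedAbs K) (hχ : IsRankZero χ) {f : (Fin n → K) → ℂ}
    (h0 : ∫ x, f x ∂(haarPi K n) = 0) {J : ℤ}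
    (hf : ∀ x, qK ^ J < ‖x‖ → f x = 0) {ξ : Fin n → K} (hξ : ‖ξ‖ ≤ qK ^ (-J)) :
    fourier χ f ξ = 0 := by
  rw [isLevel_fourier hK hχ hf ξ 0 (by simpa using hξ), fourier]
  simpa using h0

/-- A small translation leaves `f` unchanged but multiplies its transform at `ξ` by a nontrivial
character value. -/
theorem fourier_eq_zero_of_lt (hK : IsNormalizedAbs K) (hχ : IsRankZero χ) {f : (Fin n → K) → ℂ}
    {J : ℤ} (hf : IsLevel J f) {ξ : Fin n → K} (hξ : qK ^ J < ‖ξ‖) : fourier χ f ξ = 0 := by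
  obtain ⟨h, hh, hne⟩ := hχ.exists_ne_one hK hξ
  refine eq_zero_of_eq_mul hne ?_
  rw [fourier]
  conv_lhs => rw [← integral_add_right_eq_self _ h]
  rw [← integral_const_mul]
  congr 1
  ext x
  rw [sum_add_mul, AddChar.map_add_eq_mul, Circle.coe_mul, hf (x + h) x (by simpa using hh)]
  have : ∑ j, h j * ξ j = ∑ j, ξ j * h j := by simp only [mul_comm]
  rw [this]
  ring

theorem integrable_char_mul (hχ : IsRankZero χ) {g : (Fin n → K) → ℂ} (hg : IsTest g)
    (x : Fin n → K) :
    Integrable (fun ξ => (χ (-∑ j, x j * ξ j) : ℂ) * g ξ) (haarPi K n) :=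
  ((hχ.continuous.comp (continuous_sum_mul_right x).neg).mul
    hg.continuous).integrable_of_hasCompactSupport hg.hasCompactSupport.mul_left

theorem isTest_ballIndicator_smul (hK : IsNormalizedAbs K) (m : ℤ) {g : (Fin n → K) → ℂ}
    (hg : IsTest g) : IsTest fun ξ => (if ‖ξ‖ ≤ qK ^ m then (1 : ℝ) else 0) • g ξ := by
  refine ⟨IsLocallyConstant.comp₂ ?_ hg.isLocallyConstant (fun (a : ℝ) (z : ℂ) => a • z),
    hg.hasCompactSupport.mono fun ξ hξ => right_ne_zero_of_smul hξ⟩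
  simpa using
    (isLevel_ballIndicator hK (le_refl (-m)) (0 : Fin n → K) (1 : ℝ) 0).isLocallyConstant hK

/-- The operator with symbol `‖ξ‖^α` in terms of averages. -/
theorem fracDeriv_eq_multiplier (hK : IsNormalizedAbs K) (hχ : IsRankZero χ) (α : ℝ)
    {f : (Fin n → K) → ℂ} (hf : IsLizorkin f) :
    fracDeriv χ α f = multiplier (fun j => (((qK ^ j) ^ α : ℝ) : ℂ)) f := by
  obtain ⟨J, hJ⟩ := hf.isTest.exists_level hK
  have hlev := (hJ J le_rfl).1
  have hsupp := (hJ J le_rfl).2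
  have hFt : IsTest (fourier χ f) :=
    (isLevel_fourier hK hχ hsupp).isTest hK fun ξ => fourier_eq_zero_of_lt hK hχ hlev
  ext x
  rw [(hf.hasBand hK hJ).multiplier_eq]
  -- Where the transform is nonzero, `‖ξ‖ = qᵏ` with `k` in the summation range. For `j ≠ k` the two
  -- cut-offs agree, so only the term `j = k` survives.
  have hsymb : ∀ ξ : Fin n → K, ((‖ξ‖ ^ α : ℝ) : ℂ) * fourier χ f ξ =
      ∑ j ∈ Finset.Ioc (-(J : ℤ)) J, (((qK ^ j) ^ α : ℝ) : ℂ) *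
        ((if ‖ξ‖ ≤ qK ^ j then (1 : ℝ) else 0) • fourier χ f ξ -
          (if ‖ξ‖ ≤ qK ^ (j - 1) then (1 : ℝ) else 0) • fourier χ f ξ) := by
    intro ξ
    by_cases hz : fourier χ f ξ = 0
    · simp [hz]
    have h1 : ‖ξ‖ ≤ qK ^ (J : ℤ) := by
      by_contra h; exact hz (fourier_eq_zero_of_lt hK hχ hlev (not_le.1 h))
    have h2 : qK ^ (-(J : ℤ)) < ‖ξ‖ := by
      by_contra h; exact hz (fourier_eq_zero_of_le hK hχ hf.integral_eq_zero hsupp (not_lt.1 h))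
    have hq := one_lt_residueCard hK
    obtain ⟨k, -, -, hk⟩ := pi_norm_eq_zpow hK (norm_pos_iff.1 ((residueCard_zpow_pos hK _).trans h2))
    rw [hk] at h1 h2
    rw [zpow_le_zpow_iff_right₀ hq] at h1
    rw [zpow_lt_zpow_iff_right₀ hq] at h2
    rw [Finset.sum_eq_single_of_mem k (Finset.mem_Ioc.2 ⟨h2, h1⟩), hk, if_pos le_rfl, if_neg]
    · simp
    · rw [zpow_le_zpow_iff_right₀ hq]; omega
    · intro j _ hj
      rw [hk]
      simp only [zpow_le_zpow_iff_right₀ hq]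
      have : k ≤ j ↔ k ≤ j - 1 := by omega
      simp only [this, sub_self, mul_zero]
  have hint : ∀ j : ℤ, Integrable (fun ξ => (χ (-∑ j, x j * ξ j) : ℂ) *
      ((if ‖ξ‖ ≤ qK ^ j then (1 : ℝ) else 0) • fourier χ f ξ)) (haarPi K n) := fun j =>
    integrable_char_mul hχ (isTest_ballIndicator_smul hK j hFt) x
  have hInv : ∀ j : ℤ, ∫ ξ, (χ (-∑ j, x j * ξ j) : ℂ) *
      ((if ‖ξ‖ ≤ qK ^ j then (1 : ℝ) else 0) • fourier χ f ξ) ∂(haarPi K n) = ballAvg j f x :=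
    fun j => congrFun (fourierInv_ballIndicator_smul_fourier hK hχ j hf.isTest) x
  have hterm : ∀ ξ, (χ (-∑ j, x j * ξ j) : ℂ) * (((‖ξ‖ ^ α : ℝ) : ℂ) * fourier χ f ξ) =
      ∑ j ∈ Finset.Ioc (-(J : ℤ)) J, (((qK ^ j) ^ α : ℝ) : ℂ) *
        ((χ (-∑ j, x j * ξ j) : ℂ) * ((if ‖ξ‖ ≤ qK ^ j then (1 : ℝ) else 0) • fourier χ f ξ) -
          (χ (-∑ j, x j * ξ j) : ℂ) *
            ((if ‖ξ‖ ≤ qK ^ (j - 1) then (1 : ℝ) else 0) • fourier χ f ξ)) := by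
    intro ξ
    rw [hsymb, Finset.mul_sum]
    refine Finset.sum_congr rfl fun j _ => ?_
    ring
  have hint' : ∀ j : ℤ, Integrable (fun ξ => (((qK ^ j) ^ α : ℝ) : ℂ) *
      ((χ (-∑ j, x j * ξ j) : ℂ) * ((if ‖ξ‖ ≤ qK ^ j then (1 : ℝ) else 0) • fourier χ f ξ) -
        (χ (-∑ j, x j * ξ j) : ℂ) *
          ((if ‖ξ‖ ≤ qK ^ (j - 1) then (1 : ℝ) else 0) • fourier χ f ξ))) (haarPi K n) :=
    fun j => ((hint j).sub (hint (j - 1))).const_mul _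
  rw [fracDeriv, fourierInv, integral_congr_ae (.of_forall hterm),
    integral_finsetSum _ fun j _ => hint' j]
  refine Finset.sum_congr rfl fun j _ => ?_
  rw [integral_const_mul, integral_sub (hint j) (hint (j - 1)), hInv, hInv, bandPass]

end Fourier

/-! ### The time variable as the case of dimension one. -/

section Line

variable {K : Type*} [NontriviallyNormedField K]
  [LocallyCompactSpace K] [MeasurableSpace K] [BorelSpace K] {χ : AddChar K Circle}

/-- A function on `K` as a function on `K¹`. -/
def lineLift {X : Type*} (f : K → X) (x : Fin 1 → K) : X := f (x 0)

variable [ProperSpace K]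

theorem integral_lineLift {W : Type*} [NormedAddCommGroup W] [NormedSpace ℝ W] (f : K → W) :
    ∫ x : Fin 1 → K, f (x 0) ∂(haarPi K 1) = ∫ x, f x ∂(haar K) :=
  (measurePreserving_funUnique (haar K) (Fin 1)).integral_comp' f

/-- This lets averages and frequency parts on `K¹` serve for functions of time. -/
theorem fracDerivLine_eq (χ : AddChar K Circle) (α : ℝ) (f : K → ℂ) (t : K) :
    fracDerivLine χ α f t = fracDeriv χ α (lineLift f) fun _ => t := by
  have h1 : ∀ ξ : Fin 1 → K, fourier χ (lineLift f) ξ = fourierLine χ f (ξ 0) := by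
    intro ξ
    rw [fourierLine, ← integral_lineLift, fourier]
    simp [lineLift]
  rw [fracDerivLine, fracDeriv, fourierLineInv, fourierInv, ← integral_lineLift]
  congr 1
  ext ξ
  have h2 : ‖ξ‖ = ‖ξ 0‖ := by
    have : ξ = fun _ => ξ 0 := by ext i; rw [Subsingleton.elim i 0]
    conv_lhs => rw [this]
    exact pi_norm_const _
  simp [h1, h2]

theorem IsLizorkinLine.lineLift {f : K → ℂ} (h : IsLizorkinLine f) : IsLizorkin (lineLift f) where
  isLocallyConstant := h.isLocallyConstant.comp_continuous (continuous_apply 0)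
  hasCompactSupport := h.hasCompactSupport.comp_homeomorph (Homeomorph.funUnique (Fin 1) K)
  integral_eq_zero := (integral_lineLift f).trans h.integral_eq_zero

theorem IsLizorkin.isLizorkinLine {f : K → ℂ} (h : IsLizorkin (NAWave.lineLift f)) :
    IsLizorkinLine f where
  isLocallyConstant := h.isLocallyConstant.comp_continuous
    (continuous_pi fun _ : Fin 1 => continuous_id)
  hasCompactSupport := h.hasCompactSupport.comp_homeomorph (Homeomorph.funUnique (Fin 1) K).symm
  integral_eq_zero := (integral_lineLift f).symm.trans h.integral_eq_zero

end Line

end NAWave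

namespace NAWave

set_option linter.unusedSectionVars false

/-! ### Convolution with the kernels `B_t` and `A`. -/

section Kernels

variable {K : Type*} [NontriviallyNormedField K] [IsUltrametricDist K]
  [LocallyCompactSpace K] [MeasurableSpace K] [BorelSpace K] [ProperSpace K] {n : ℕ}

local notation "qK" => (residueCard K : ℝ)

theorem integral_ballIndicator_smul_sub (hK : IsNormalizedAbs K) (m : ℤ) (f : (Fin n → K) → ℂ)
    (x : Fin n → K) :
    ∫ y, (if ‖y‖ ≤ qK ^ (-m) then (1 : ℝ) else 0) • f (x - y) ∂(haarPi K n) =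
      (qK ^ (-(m * n)) : ℝ) • ballAvg m f x := by
  rw [ballAvg, smul_smul, ← zpow_add₀ (residueCard_pos hK).ne', neg_add_cancel, zpow_zero, one_smul,
    ← integral_ballIndicator_smul, ← integral_sub_left_eq_self _ _ x]
  simp only [sub_sub_cancel, norm_sub_rev _ x]

theorem integrable_smul_sub {h : (Fin n → K) → ℝ} (hh : Continuous h) {f : (Fin n → K) → ℂ}
    (hf : IsTest f) (x : Fin n → K) :
    Integrable (fun y => h y • f (x - y)) (haarPi K n) := by
  have h1 : HasCompactSupport fun y => f (x - y) :=
    hf.hasCompactSupport.comp_homeomorph (Homeomorph.subLeft x)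
  have h2 : Continuous fun y => h y • f (x - y) :=
    hh.smul (hf.continuous.comp (continuous_const.sub continuous_id))
  exact h2.integrable_of_hasCompactSupport
    (h1.mono fun y (hy : h y • f (x - y) ≠ 0) => right_ne_zero_of_smul hy)

theorem norm_eq_zpow_iff (hK : IsNormalizedAbs K) (x : Fin n → K) (m : ℤ) :
    ‖x‖ = qK ^ m ↔ ‖x‖ ≤ qK ^ m ∧ ¬ ‖x‖ ≤ qK ^ (m - 1) := by
  rw [← norm_lt_zpow_iff hK, not_lt]
  exact ⟨fun h => ⟨h.le, h.ge⟩, fun h => le_antisymm h.1 h.2⟩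

/-- Extending the outer value `q/(q-1)` of `b̃` to the whole unit ball and subtracting `qⁿ/(q-1)` on
the ball of radius `q⁻¹` gives `b̃`. The radii are written as `q^(-m)` to match the averages of
index `m = -k` and `m = 1 - k`. -/
theorem kernelB_eq (hK : IsNormalizedAbs K) {t : K} {k : ℤ} (ht : ‖t‖ = qK ^ k)
    (y : Fin n → K) :
    kernelB t y = ((qK / (qK - 1) * qK ^ (-k * n) *
        (if ‖y‖ ≤ qK ^ (-(-k)) then (1 : ℝ) else 0) -
      (qK - 1)⁻¹ * qK ^ ((1 - k) * n) * (if ‖y‖ ≤ qK ^ (-(1 - k)) then (1 : ℝ) else 0) : ℝ) : ℂ) := by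
  have hq := one_lt_residueCard hK
  have hp := residueCard_zpow_pos hK k
  have hq1 : qK - 1 ≠ 0 := by linarith
  have hnorm : ‖t⁻¹ • y‖ = (qK ^ k)⁻¹ * ‖y‖ := by rw [norm_smul, norm_inv, ht]
  have h1 : ‖t⁻¹ • y‖ ≤ qK⁻¹ ↔ ‖y‖ ≤ qK ^ (k - 1) := by
    rw [hnorm, inv_mul_le_iff₀ hp, zpow_sub_one₀ (by linarith)]
  have h2 : ‖t⁻¹ • y‖ = 1 ↔ ‖y‖ = qK ^ k := by
    rw [hnorm, inv_mul_eq_iff_eq_mul₀ hp.ne', mul_one]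
  have e1 : qK ^ ((1 - k) * n) = qK ^ n * ((qK ^ k) ^ n)⁻¹ := by
    rw [sub_mul, one_mul, zpow_sub₀ (by linarith), zpow_natCast, zpow_mul, zpow_natCast]
    ring
  have e2 : qK ^ (-k * n) = ((qK ^ k) ^ n)⁻¹ := by
    rw [neg_mul, zpow_neg, zpow_mul, zpow_natCast]
  rw [kernelB, bTilde, ht, neg_sub, neg_neg, e1, e2]
  simp only [h1, h2, norm_eq_zpow_iff hK]
  have hc : ((residueCard K : ℂ) - 1) ≠ 0 := by
    have := Complex.ofReal_ne_zero.2 hq1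
    push_cast at this; exact this
  have hmono : ‖y‖ ≤ qK ^ (k - 1) → ‖y‖ ≤ qK ^ k := fun h =>
    h.trans (zpow_le_zpow_right₀ hq.le (by omega))
  by_cases ha : ‖y‖ ≤ qK ^ (k - 1)
  · simp only [ha, hmono ha, if_true]
    push_cast
    field_simp
  · by_cases hb : ‖y‖ ≤ qK ^ k
    · simp [ha, hb]
      ring
    · simp [ha, hb]

theorem convExists_kernelB (hK : IsNormalizedAbs K) {t : K} (ht : t ≠ 0) {f : (Fin n → K) → ℂ}
    (hf : IsTest f) : ConvExists (kernelB t) f := by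
  obtain ⟨k, hk⟩ := norm_eq_zpow hK ht
  intro x
  have hc : Continuous fun y : Fin n → K => qK / (qK - 1) * qK ^ (-k * n) *
        (if ‖y‖ ≤ qK ^ (-(-k)) then (1 : ℝ) else 0) -
      (qK - 1)⁻¹ * qK ^ ((1 - k) * n) * (if ‖y‖ ≤ qK ^ (-(1 - k)) then (1 : ℝ) else 0) :=
    ((continuous_ballIndicator hK _).const_mul _).sub ((continuous_ballIndicator hK _).const_mul _)
  have := integrable_smul_sub hc hf x
  simpa only [ConvolutionExistsAt, ContinuousLinearMap.mul_apply', kernelB_eq hK hk,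
    Complex.real_smul] using this

theorem conv_kernelB (hK : IsNormalizedAbs K) {t : K} {k : ℤ} (ht : ‖t‖ = qK ^ k)
    {f : (Fin n → K) → ℂ} (hf : IsTest f) (x : Fin n → K) :
    conv (kernelB t) f x =
      (qK / (qK - 1) : ℝ) • ballAvg (-k) f x - ((qK - 1)⁻¹ : ℝ) • ballAvg (1 - k) f x := by
  have hp : ∀ m : ℤ, qK ^ m * qK ^ (-m) = 1 := fun m => by
    rw [← zpow_add₀ (residueCard_pos hK).ne']; simp
  have h1 : ∀ y : Fin n → K, kernelB t y * f (x - y) =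
      (qK / (qK - 1) * qK ^ (-k * n)) • ((if ‖y‖ ≤ qK ^ (-(-k)) then (1 : ℝ) else 0) • f (x - y)) -
      ((qK - 1)⁻¹ * qK ^ ((1 - k) * n)) •
        ((if ‖y‖ ≤ qK ^ (-(1 - k)) then (1 : ℝ) else 0) • f (x - y)) := by
    intro y
    rw [kernelB_eq hK ht, smul_smul, smul_smul, ← sub_smul, Complex.real_smul]
  simp only [conv, convolution, ContinuousLinearMap.mul_apply', h1]
  have hi : ∀ (c : ℝ) (m : ℤ), Integrable (fun y : Fin n → K =>
      c • ((if ‖y‖ ≤ qK ^ m then (1 : ℝ) else 0) • f (x - y))) (haarPi K n) := fun c m =>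
    (integrable_smul_sub (continuous_ballIndicator hK m) hf x).smul c
  rw [integral_sub (hi _ _) (hi _ _), integral_smul,
    integral_smul, integral_ballIndicator_smul_sub hK, integral_ballIndicator_smul_sub hK,
    smul_smul, smul_smul, mul_assoc, mul_assoc, hp, hp, mul_one, mul_one]

theorem norm_eq_of_sub_le (m : ℤ) {x y : Fin n → K}
    (hxy : ‖x - y‖ ≤ qK ^ m) (hx : ¬ ‖x‖ ≤ qK ^ m) : ‖x‖ = ‖y‖ := by
  have h := hxy.trans_lt (not_le.1 hx)
  have h2 := IsUltrametricDist.norm_add_le_max (x - y) y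
  have h3 := IsUltrametricDist.norm_add_le_max x (-(x - y))
  rw [sub_add_cancel] at h2
  rw [← sub_eq_add_neg, sub_sub_cancel, norm_neg, max_eq_left h.le] at h3
  refine le_antisymm ?_ h3
  rcases le_max_iff.1 h2 with h4 | h4
  · exact absurd h (not_lt.2 h4)
  · exact h4

theorem measureReal_sphere (hK : IsNormalizedAbs K) (m : ℤ) :
    (haarPi K n).real {y : Fin n → K | ‖y‖ = qK ^ m} = qK ^ (m * n) - qK ^ ((m - 1) * n) := by
  have h : {y : Fin n → K | ‖y‖ = qK ^ m} =
      Metric.closedBall 0 (qK ^ m) \ Metric.closedBall 0 (qK ^ (m - 1)) := by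
    ext y; simp [norm_eq_zpow_iff hK]
  rw [h, measureReal_sdiff (Metric.closedBall_subset_closedBall
    (zpow_le_zpow_right₀ (one_lt_residueCard hK).le (by omega)))
    Metric.isClosed_closedBall.measurableSet
    ((isCompact_closedBall _ _).measure_lt_top.ne),
    haarPi_real_closedBall_zpow hK, haarPi_real_closedBall_zpow hK]

theorem measurableSet_sphere (r : ℝ) : MeasurableSet {y : Fin n → K | ‖y‖ = r} :=
  (isClosed_eq continuous_norm continuous_const).measurableSet

theorem iUnion_sphere (hK : IsNormalizedAbs K) (m : ℤ) :
    (⋃ i : ℕ, {y : Fin n → K | ‖y‖ = qK ^ (m - i)}) = Metric.closedBall 0 (qK ^ m) \ {0} := by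
  have hq := one_lt_residueCard hK
  ext y
  simp only [Set.mem_iUnion, Set.mem_ofPred_eq, Set.mem_sdiff, mem_closedBall_zero_iff,
    Set.mem_singleton_iff]
  constructor
  · rintro ⟨i, hi⟩
    refine ⟨hi.trans_le (zpow_le_zpow_right₀ hq.le (by omega)), ?_⟩
    rintro rfl
    rw [norm_zero] at hi
    exact (residueCard_zpow_pos hK _).ne hi
  · rintro ⟨h1, h2⟩
    obtain ⟨k, -, -, hk⟩ := pi_norm_eq_zpow hK h2
    rw [hk, zpow_le_zpow_iff_right₀ hq] at h1
    refine ⟨(m - k).toNat, ?_⟩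
    rw [hk, Int.toNat_of_nonneg (by omega), sub_sub_cancel]

/-- The integral of `‖y‖⁻¹` over a ball. -/
theorem norm_inv_ball (hK : IsNormalizedAbs K) (hn : 2 ≤ n) (m : ℤ) :
    IntegrableOn (fun y : Fin n → K => ‖y‖⁻¹) (Metric.closedBall 0 (qK ^ m)) (haarPi K n) ∧
    ∫ y in Metric.closedBall (0 : Fin n → K) (qK ^ m), ‖y‖⁻¹ ∂(haarPi K n) =
      qK ^ (m * n) * (qK ^ m)⁻¹ * (1 - (qK ^ n)⁻¹) * (1 - qK * (qK ^ n)⁻¹)⁻¹ := by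
  have hq := one_lt_residueCard hK
  have hq0 := residueCard_pos hK
  set f : (Fin n → K) → ℝ := fun y => ‖y‖⁻¹ with hf
  let s : ℕ → Set (Fin n → K) := fun i => {y | ‖y‖ = qK ^ (m - i)}
  have hs : ∀ i, MeasurableSet (s i) := fun i => measurableSet_sphere _
  have hfin : ∀ i, haarPi K n (s i) < ∞ := fun i =>
    (measure_mono fun y (hy : ‖y‖ = _) => by simpa using hy.le).trans_lt
      (isCompact_closedBall (0 : Fin n → K) (qK ^ (m - (i : ℤ)))).measure_lt_top
  have hconst : ∀ i : ℕ, Set.EqOn f (fun _ => (qK ^ (m - (i : ℤ)))⁻¹) (s i) := fun i y hy => by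
    simp only [hf]; rw [show ‖y‖ = _ from hy]
  have hi : ∀ i, IntegrableOn f (s i) (haarPi K n) := fun i =>
    (integrableOn_congr_fun (hconst i) (hs i)).2 (integrableOn_const (hfin i).ne)
  have hval : ∀ i : ℕ, ∫ y in s i, f y ∂(haarPi K n) =
      qK ^ (m * n) * (qK ^ m)⁻¹ * (1 - (qK ^ n)⁻¹) * (qK * (qK ^ n)⁻¹) ^ i := fun i => by
    rw [setIntegral_congr_fun (hs i) (hconst i), setIntegral_const, measureReal_sphere hK]
    have e1 : qK ^ ((m - i) * n) = qK ^ (m * n) * ((qK ^ n)⁻¹) ^ i := by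
      rw [sub_mul, zpow_sub₀ hq0.ne', mul_comm (i : ℤ), zpow_mul _ (n : ℤ), zpow_natCast,
        zpow_natCast, inv_pow]
      rfl
    have e2 : qK ^ ((m - i - 1) * n) = qK ^ (m * n) * ((qK ^ n)⁻¹) ^ i * (qK ^ n)⁻¹ := by
      rw [sub_mul, one_mul, zpow_sub₀ hq0.ne', e1, zpow_natCast]
      rfl
    have e3 : (qK ^ (m - (i : ℤ)))⁻¹ = (qK ^ m)⁻¹ * qK ^ i := by
      rw [zpow_sub₀ hq0.ne', zpow_natCast, inv_div, div_eq_mul_inv, mul_comm]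
    rw [e1, e2, e3, smul_eq_mul, mul_pow]
    ring
  -- The spheres contribute a geometric series of ratio `q^{1-n}`; this is where `n ≥ 2` enters.
  have hr : qK * (qK ^ n)⁻¹ < 1 := by
    rw [← div_eq_mul_inv, div_lt_one (by positivity)]
    exact lt_self_pow₀ hq (by omega)
  have hsum : HasSum (fun i => ∫ y in s i, f y ∂(haarPi K n))
      (qK ^ (m * n) * (qK ^ m)⁻¹ * (1 - (qK ^ n)⁻¹) * (1 - qK * (qK ^ n)⁻¹)⁻¹) := by
    simp_rw [hval]
    exact (hasSum_geometric_of_lt_one (by positivity) hr).mul_left _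
  have hnorm : ∀ y, ‖f y‖ = f y := fun y => by
    rw [Real.norm_eq_abs, abs_of_nonneg]; simp only [hf]; positivity
  have hInt : IntegrableOn f (⋃ i, s i) (haarPi K n) := by
    refine integrableOn_iUnion_of_summable_integral_norm hi ?_
    simp_rw [hnorm]
    exact hsum.summable
  have hdisj : Pairwise (Function.onFun Disjoint s) := by
    intro i j hij
    rw [Function.onFun, Set.disjoint_left]
    intro y h1 h2
    have : qK ^ (m - (i : ℤ)) = qK ^ (m - (j : ℤ)) :=
      (show ‖y‖ = _ from h1).symm.trans h2
    have := zpow_right_injective₀ hq0 hq.ne' this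
    omega
  have hU : (⋃ i, s i) = Metric.closedBall 0 (qK ^ m) \ {0} := iUnion_sphere hK m
  have hsub : Metric.closedBall (0 : Fin n → K) (qK ^ m) \ {0} ⊆ Metric.closedBall 0 (qK ^ m) :=
    Set.sdiff_subset
  -- The spheres miss only the origin, where the integrand is zero because `0⁻¹ = 0`.
  have hz : ∀ y ∈ Metric.closedBall (0 : Fin n → K) (qK ^ m) \
      (Metric.closedBall 0 (qK ^ m) \ {0}), f y = 0 := by
    intro y hy
    have : y = 0 := by
      by_contra h; exact hy.2 ⟨hy.1, h⟩
    simp [hf, this]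
  constructor
  · rw [hU] at hInt
    exact hInt.of_forall_sdiff_eq_zero Metric.isClosed_closedBall.measurableSet hz
  · have := setIntegral_eq_of_subset_of_forall_sdiff_eq_zero (μ := haarPi K n)
      Metric.isClosed_closedBall.measurableSet hsub hz
    rw [← hU] at this
    rw [this]
    exact (hasSum_integral_iUnion hs hdisj hInt).unique hsum

/-- Three zones. For `‖y‖ ≤ q^{-j}` the factor `g (x - y)` is the constant `g x`. On the sphere `‖y‖
= q^{1-j}` the kernel is constant, and the integral of `g` there is a difference of two averages,
the larger of which vanishes. Farther out the kernel is constant on balls of radius `q^{1-j}`, over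
which `g` averages to zero. -/
theorem norm_inv_smul_of_level (hK : IsNormalizedAbs K) (hn : 2 ≤ n) (j : ℤ)
    {g : (Fin n → K) → ℂ} (hg : IsTest g) (hl : IsLevel j g) (h0 : ballAvg (j - 1) g = 0)
    (x : Fin n → K) :
    Integrable (fun y => ‖y‖⁻¹ • g (x - y)) (haarPi K n) ∧
    ∫ y, ‖y‖⁻¹ • g (x - y) ∂(haarPi K n) =
      (qK ^ (-j * n) * (qK ^ (-j))⁻¹ * (1 - (qK ^ n)⁻¹) * (1 - qK * (qK ^ n)⁻¹)⁻¹ -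
        qK ^ (j - 1) * qK ^ (-(j * n))) • g x := by
  obtain ⟨hI1, hI2⟩ := norm_inv_ball hK hn (-j)
  set c := qK ^ (-j * n) * (qK ^ (-j))⁻¹ * (1 - (qK ^ n)⁻¹) * (1 - qK * (qK ^ n)⁻¹)⁻¹ with hc
  let B : Set (Fin n → K) := Metric.closedBall 0 (qK ^ (-j))
  have hB : MeasurableSet B := Metric.isClosed_closedBall.measurableSet
  let h : (Fin n → K) → ℝ := fun y => if ‖y‖ ≤ qK ^ (-(j - 1)) then 0 else ‖y‖⁻¹
  have hh : IsLevel (j - 1) h := by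
    intro y z hyz
    have hiff : ‖y‖ ≤ qK ^ (-(j - 1)) ↔ ‖z‖ ≤ qK ^ (-(j - 1)) := by
      constructor
      · intro H; simpa using norm_sub_le_of_le H hyz
      · intro H; simpa using norm_add_le_of_le hyz H
    by_cases hy : ‖y‖ ≤ qK ^ (-(j - 1))
    · simp only [h, if_pos hy, if_pos (hiff.1 hy)]
    · simp only [h, if_neg hy, if_neg (fun H => hy (hiff.2 H)), norm_eq_of_sub_le _ hyz hy]
  have hh' : IsLevel (j - 1) fun y => h (x - y) := by
    intro y z hyz
    apply hh
    rw [sub_sub_sub_cancel_left, norm_sub_rev]; exact hyz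
  have hdec : ∀ y, ‖y‖⁻¹ • g (x - y) =
      (B.indicator (fun y => ‖y‖⁻¹) y • g x +
        (qK ^ (j - 1)) • (((if ‖y‖ ≤ qK ^ (-(j - 1)) then (1 : ℝ) else 0) • g (x - y)) -
          ((if ‖y‖ ≤ qK ^ (-j) then (1 : ℝ) else 0) • g (x - y)))) + h y • g (x - y) := by
    intro y
    by_cases h1 : ‖y‖ ≤ qK ^ (-j)
    · have h2 : ‖y‖ ≤ qK ^ (-(j - 1)) :=
        h1.trans (zpow_le_zpow_right₀ (one_lt_residueCard hK).le (by omega))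
      have h3 : g (x - y) = g x := hl _ _ (by simpa using h1)
      rw [Set.indicator_of_mem (by simpa [B] using h1)]
      simp only [h, if_pos h1, if_pos h2, h3]
      simp
    · rw [Set.indicator_of_notMem (by simpa [B] using h1)]
      by_cases h2 : ‖y‖ ≤ qK ^ (-(j - 1))
      · have h4 : ‖y‖ = qK ^ (-(j - 1)) := by
          rw [norm_eq_zpow_iff hK]
          refine ⟨h2, ?_⟩
          have : -(j - 1) - 1 = -j := by ring
          rwa [this]
        simp only [h, if_neg h1, if_pos h2]
        rw [h4, ← zpow_neg, neg_neg]
        simp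
      · simp only [h, if_neg h1, if_neg h2]
        simp
  have i1 : Integrable (fun y => B.indicator (fun y => ‖y‖⁻¹) y • g x) (haarPi K n) :=
    ((integrable_indicator_iff hB).2 hI1).smul_const _
  have i2 : ∀ m : ℤ, Integrable (fun y : Fin n → K =>
      (if ‖y‖ ≤ qK ^ m then (1 : ℝ) else 0) • g (x - y)) (haarPi K n) := fun m =>
    integrable_smul_sub (continuous_ballIndicator hK m) hg x
  have i3 : Integrable (fun y => h y • g (x - y)) (haarPi K n) :=
    integrable_smul_sub (hh.continuous hK) hg x
  have i4 : Integrable (fun y => (qK ^ (j - 1)) •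
      (((if ‖y‖ ≤ qK ^ (-(j - 1)) then (1 : ℝ) else 0) • g (x - y)) -
          ((if ‖y‖ ≤ qK ^ (-j) then (1 : ℝ) else 0) • g (x - y)))) (haarPi K n) :=
    ((i2 (-(j - 1))).sub (i2 (-j))).smul (qK ^ (j - 1))
  have i5 : Integrable (fun y => B.indicator (fun y => ‖y‖⁻¹) y • g x +
      (qK ^ (j - 1)) • (((if ‖y‖ ≤ qK ^ (-(j - 1)) then (1 : ℝ) else 0) • g (x - y)) -
        ((if ‖y‖ ≤ qK ^ (-j) then (1 : ℝ) else 0) • g (x - y)))) (haarPi K n) := i1.add i4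
  have z : ∫ y, h y • g (x - y) ∂(haarPi K n) = 0 := by
    rw [← integral_sub_left_eq_self _ _ x]
    simp only [sub_sub_cancel]
    rw [← integral_smul_ballAvg hK hh' hg, h0]
    simp
  refine ⟨(integrable_congr (.of_forall hdec)).2 (i5.add i3), ?_⟩
  rw [integral_congr_ae (.of_forall hdec), integral_add i5 i3, integral_add i1 i4, z,
    integral_smul, integral_sub (i2 _) (i2 _), integral_ballIndicator_smul_sub hK,
    integral_ballIndicator_smul_sub hK, h0, hl.ballAvg_eq hK, integral_smul_const,
    integral_indicator hB, hI2, sub_smul, mul_smul]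
  simp [sub_eq_add_neg, mul_assoc]

/-- Convolution with the kernel `A` is the fractional integration of order `n - 1`. -/
theorem conv_kernelA (hK : IsNormalizedAbs K) (hn : 2 ≤ n) {f : (Fin n → K) → ℂ}
    (hf : IsLizorkin f) :
    ConvExists kernelA f ∧
      conv kernelA f = multiplier (fun j => ((((qK ^ j) ^ ((n : ℝ) - 1))⁻¹ : ℝ) : ℂ)) f := by
  obtain ⟨J, hJ⟩ := hf.exists_hasBand hK
  set κ : ℝ := (1 - qK ^ (-(n : ℤ) + 1)) / (1 - qK⁻¹) with hκ
  have hq := one_lt_residueCard hK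
  have hq0 := residueCard_pos hK
  -- The normalizing factor of `A` is exactly what turns the constant of the single-frequency
  -- computation into `q^{-j(n-1)}`.
  have hcoef : ∀ j : ℤ, κ * (qK ^ (-j * n) * (qK ^ (-j))⁻¹ * (1 - (qK ^ n)⁻¹) *
      (1 - qK * (qK ^ n)⁻¹)⁻¹ - qK ^ (j - 1) * qK ^ (-(j * n))) =
      ((qK ^ j) ^ ((n : ℝ) - 1))⁻¹ := by
    intro j
    have hj := residueCard_zpow_pos hK j
    have hw : qK < qK ^ n := lt_self_pow₀ hq (by omega)
    have e1 : qK ^ (-(n : ℤ) + 1) = qK * (qK ^ n)⁻¹ := by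
      rw [zpow_add_one₀ hq0.ne', zpow_neg, zpow_natCast, mul_comm]
    have e2 : (qK ^ j) ^ ((n : ℝ) - 1) = (qK ^ j) ^ n / qK ^ j := by
      rw [Real.rpow_sub hj, Real.rpow_natCast, Real.rpow_one]
    have e3 : qK ^ (-(j * (n : ℤ))) = ((qK ^ j) ^ n)⁻¹ := by
      rw [zpow_neg, zpow_mul, zpow_natCast]
    rw [hκ, e1, e2, neg_mul, e3, zpow_neg, zpow_sub_one₀ hq0.ne']
    have h1 : qK - 1 ≠ 0 := by linarith
    have h2 : qK ^ n - qK ≠ 0 := by linarith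
    have h3 : 1 - qK⁻¹ ≠ 0 := by
      rw [sub_ne_zero]; exact (inv_lt_one_of_one_lt₀ hq).ne'
    have h4 : 1 - qK * (qK ^ n)⁻¹ ≠ 0 := by
      rw [sub_ne_zero, ← div_eq_mul_inv]; exact ((div_lt_one (by positivity)).2 hw).ne'
    have hw0 : (0 : ℝ) < qK ^ n := by positivity
    generalize qK ^ n = w at *
    generalize (qK ^ j) ^ n = v at *
    generalize qK ^ j = u at *
    field_simp
    ring
  have hker : ∀ (x y : Fin n → K), kernelA y * f (x - y) =
      ∑ j ∈ Finset.Ioc (-(J : ℤ)) J, (κ : ℂ) * (‖y‖⁻¹ • bandPass j f (x - y)) := by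
    intro x y
    have h1 : f (x - y) = ∑ j ∈ Finset.Ioc (-(J : ℤ)) J, bandPass j f (x - y) := by
      conv_lhs => rw [← multiplier_one hK hf, hJ.multiplier_eq]
      simp
    rw [h1, Finset.mul_sum, kernelA, ← hκ]
    refine Finset.sum_congr rfl fun j _ => ?_
    rw [Complex.real_smul]
    push_cast
    ring
  have hband : ∀ (j : ℤ) (x : Fin n → K), _ := fun j x =>
    norm_inv_smul_of_level hK hn j (hf.bandPass hK j).isTest (isLevel_bandPass hK j f)
      ((ballAvg_bandPass hK (j - 1) j hf.isTest).trans (if_neg (by omega))) x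
  constructor
  · intro x
    simp only [ConvolutionExistsAt, ContinuousLinearMap.mul_apply', hker]
    exact integrable_finsetSum _ fun j _ => (hband j x).1.const_mul _
  · ext x
    simp only [conv, convolution, ContinuousLinearMap.mul_apply', hker]
    rw [integral_finsetSum _ fun j _ => (hband j x).1.const_mul _, hJ.multiplier_eq]
    refine Finset.sum_congr rfl fun j _ => ?_
    rw [integral_const_mul, (hband j x).2, ← hcoef, Complex.real_smul]
    push_cast
    ring

end Kernels

end NAWave

namespace NAWave

set_option linter.unusedSectionVars false

/-! ### Construction of the waves and their representation by convolutions. -/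

section Existence

variable {K : Type*} [NontriviallyNormedField K] [IsUltrametricDist K]

local notation "qK" => (residueCard K : ℝ)

variable (K) in
/-- The time profile of a wave of frequency `qʲ`, as a function of `|t|`. -/
noncomputable def waveProfile (j : ℤ) (r : ℝ) : ℝ :=
  qK / (qK - 1) * (if r ≤ qK ^ (-j) then (1 : ℝ) else 0) -
    (qK - 1)⁻¹ * (if r ≤ qK ^ (-(j - 1)) then (1 : ℝ) else 0)

theorem waveProfile_zero (hK : IsNormalizedAbs K) (j : ℤ) : waveProfile K j 0 = 1 := by
  have h := one_lt_residueCard hK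
  have h1 : qK - 1 ≠ 0 := by linarith
  rw [waveProfile, if_pos (residueCard_zpow_pos hK _).le, if_pos (residueCard_zpow_pos hK _).le]
  field_simp

/-- For fixed `|t|` the profile, as a function of `j`, is a combination of two frequency cut-offs,
which is why a wave at time `t` consists of two averages of its value at time zero. -/
theorem waveProfile_zpow (hK : IsNormalizedAbs K) (j k : ℤ) :
    waveProfile K j (qK ^ k) = qK / (qK - 1) * (if j ≤ -k then (1 : ℝ) else 0) -
      (qK - 1)⁻¹ * (if j ≤ 1 - k then (1 : ℝ) else 0) := by
  have h := one_lt_residueCard hK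
  rw [waveProfile]
  simp only [zpow_le_zpow_iff_right₀ h]
  have h1 : k ≤ -j ↔ j ≤ -k := by omega
  have h2 : k ≤ -(j - 1) ↔ j ≤ 1 - k := by omega
  simp only [h1, h2]

variable [LocallyCompactSpace K] [MeasurableSpace K] [BorelSpace K] [ProperSpace K] {n : ℕ}
  {χ : AddChar K Circle}

theorem isLevel_waveProfile (hK : IsNormalizedAbs K) (j : ℤ) :
    IsLevel j fun x : Fin n → K => (waveProfile K j ‖x‖ : ℂ) := by
  have h : ∀ m, m ≤ j → IsLevel j fun x : Fin n → K => if ‖x‖ ≤ qK ^ (-m) then (1 : ℝ) else 0 :=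
    fun m hm => by simpa using isLevel_ballIndicator hK hm (0 : Fin n → K) (1 : ℝ) 0
  exact ((h j le_rfl).comp₂ (h (j - 1) (by omega))
    fun a b => qK / (qK - 1) * a - (qK - 1)⁻¹ * b).comp fun a : ℝ => (a : ℂ)

theorem waveProfile_eq_zero (hK : IsNormalizedAbs K) (j : ℤ) {r : ℝ} (hr : qK ^ (-(j - 1)) < r) :
    waveProfile K j r = 0 := by
  have : qK ^ (-j) ≤ qK ^ (-(j - 1)) :=
    zpow_le_zpow_right₀ (one_lt_residueCard hK).le (by omega)
  rw [waveProfile, if_neg (not_le.2 hr), if_neg (not_le.2 (this.trans_lt hr))]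
  ring

theorem integral_ballIndicator (hK : IsNormalizedAbs K) (m : ℤ) :
    ∫ y : Fin n → K, (if ‖y‖ ≤ qK ^ m then (1 : ℝ) else 0) ∂(haarPi K n) = qK ^ (m * n) := by
  have h := integral_ballIndicator_smul (-m) (fun _ => (1 : ℝ)) (0 : Fin n → K)
  simp only [sub_zero, neg_neg, smul_eq_mul, mul_one] at h
  rw [h, setIntegral_const, haarPi_real_closedBall_zpow hK, smul_eq_mul, mul_one]

/-- The weights `q` and `1` on balls of measure `q^{-j}` and `q^{1-j}` cancel in the integral. -/
theorem isLizorkin_waveProfile (hK : IsNormalizedAbs K) (j : ℤ) :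
    IsLizorkin fun x : Fin 1 → K => (waveProfile K j ‖x‖ : ℂ) := by
  refine ((isLevel_waveProfile hK j).isTest hK (r := qK ^ (-(j - 1))) fun x hx => by
    rw [waveProfile_eq_zero hK j hx, Complex.ofReal_zero]).isLizorkin ?_
  have hi : ∀ m : ℤ, Integrable (fun x : Fin 1 → K => if ‖x‖ ≤ qK ^ m then (1 : ℝ) else 0)
      (haarPi K 1) := fun m => by
    refine (continuous_ballIndicator hK m).integrable_of_hasCompactSupport
      (HasCompactSupport.intro (isCompact_closedBall 0 (qK ^ m)) fun x hx => ?_)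
    rw [if_neg (by simpa using hx)]
  rw [integral_complex_ofReal]
  simp only [waveProfile]
  rw [integral_sub ((hi _).const_mul _) ((hi _).const_mul _), integral_const_mul,
    integral_const_mul, integral_ballIndicator hK, integral_ballIndicator hK]
  have : qK ^ (-(j - 1) * ((1 : ℕ) : ℤ)) = qK * qK ^ (-j * ((1 : ℕ) : ℤ)) := by
    rw [← zpow_one_add₀ (residueCard_pos hK).ne']; congr 1; push_cast; ring
  rw [this, Complex.ofReal_eq_zero]
  ring

/-- The profile is constant on balls of radius `q^{-j}`, while its averages over balls of radius
`q^{1-j}` or more vanish. Hence it has the single frequency `qʲ`. -/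
theorem multiplier_waveProfile (hK : IsNormalizedAbs K) (a : ℤ → ℂ) (j : ℤ) :
    multiplier a (fun x : Fin 1 → K => (waveProfile K j ‖x‖ : ℂ)) =
      fun x => a j * waveProfile K j ‖x‖ := by
  have hw := isLizorkin_waveProfile hK j
  refine (hw.multiplier hK a).ext_bandPass hK (hw.const_mul (a j)) fun i x => ?_
  rw [bandPass_multiplier hK hw, bandPass_const_mul]
  have hlow : ∀ i : ℤ, i ≤ j - 1 →
      ballAvg i (fun x : Fin 1 → K => (waveProfile K j ‖x‖ : ℂ)) = 0 := fun i hi =>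
    ballAvg_eq_zero_of_support hK (fun x hx => by
      rw [waveProfile_eq_zero hK j hx, Complex.ofReal_zero]) hw.integral_eq_zero hi
  have hhigh : ∀ i : ℤ, j ≤ i → ballAvg i (fun x : Fin 1 → K => (waveProfile K j ‖x‖ : ℂ)) =
      fun x : Fin 1 → K => (waveProfile K j ‖x‖ : ℂ) := fun i hi =>
    ((isLevel_waveProfile hK j).mono hK hi).ballAvg_eq hK
  rcases lt_trichotomy i j with h | rfl | h
  · rw [bandPass, hlow i (by omega), hlow (i - 1) (by omega)]; simp
  · rfl
  · rw [bandPass, hhigh i (by omega), hhigh (i - 1) (by omega)]; simp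

/-- The symbol of the operator of fractional differentiation, on the sphere of radius `qʲ`. -/
noncomputable def symb (K : Type*) [NontriviallyNormedField K] [IsUltrametricDist K]
    (α : ℝ) (j : ℤ) : ℂ := (((residueCard K : ℝ) ^ j) ^ α : ℝ)

theorem symb_ne_zero (hK : IsNormalizedAbs K) (α : ℝ) (j : ℤ) : symb K α j ≠ 0 :=
  Complex.ofReal_ne_zero.2 (Real.rpow_pos_of_pos (residueCard_zpow_pos hK j) α).ne'

theorem symb_zero (j : ℤ) : symb K 0 j = 1 := by simp [symb]

theorem symb_injective (hK : IsNormalizedAbs K) {α : ℝ} (hα : 0 < α) :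
    Function.Injective (symb K α) := by
  intro i j h
  have h1 := Complex.ofReal_injective h
  have h2 := Real.rpow_left_injOn hα.ne' (residueCard_zpow_pos hK i).le
    (residueCard_zpow_pos hK j).le h1
  exact zpow_right_injective₀ (residueCard_pos hK) (one_lt_residueCard hK).ne' h2

theorem fracDerivLine_eq_multiplier (hK : IsNormalizedAbs K) (hχ : IsRankZero χ) (α : ℝ)
    {f : K → ℂ} (hf : IsLizorkinLine f) (t : K) :
    fracDerivLine χ α f t = multiplier (symb K α) (lineLift f) fun _ => t := by
  rw [fracDerivLine_eq, fracDeriv_eq_multiplier hK hχ α hf.lineLift]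
  rfl

/-- The solution of the wave equation with `(D_t^β F)(0, x) = φ(x)`. -/
noncomputable def waveSolution (β : ℝ) (φ : (Fin n → K) → ℂ) (t : K) : (Fin n → K) → ℂ :=
  multiplier (fun j => waveProfile K j ‖t‖ * (symb K β j)⁻¹) φ

theorem lineLift_waveSolution {J : ℕ} {φ : (Fin n → K) → ℂ} (hJ : HasBand J φ) (β : ℝ)
    (x : Fin n → K) : lineLift (fun t => waveSolution β φ t x) = fun y : Fin 1 → K =>
      ∑ j ∈ Finset.Ioc (-(J : ℤ)) J, ((symb K β j)⁻¹ * bandPass j φ x) * waveProfile K j ‖y‖ := by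
  ext y
  have h : ‖y 0‖ = ‖y‖ := by
    have : y = fun _ => y 0 := by ext i; rw [Subsingleton.elim i 0]
    conv_rhs => rw [this]
    exact (pi_norm_const _).symm
  rw [lineLift, waveSolution, hJ.multiplier_eq, h]
  refine Finset.sum_congr rfl fun j _ => ?_
  ring

theorem isLizorkinLine_waveSolution (hK : IsNormalizedAbs K) {φ : (Fin n → K) → ℂ}
    (hφ : IsLizorkin φ) (β : ℝ) (x : Fin n → K) :
    IsLizorkinLine fun t => waveSolution β φ t x := by
  obtain ⟨J, hJ⟩ := hφ.exists_hasBand hK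
  apply IsLizorkin.isLizorkinLine
  rw [lineLift_waveSolution hJ]
  exact IsLizorkin.sum_mul _ _ fun j _ => isLizorkin_waveProfile hK j

theorem fracDerivLine_waveSolution (hK : IsNormalizedAbs K) (hχ : IsRankZero χ) (α β : ℝ)
    {φ : (Fin n → K) → ℂ} (hφ : IsLizorkin φ) (t : K) (x : Fin n → K) :
    fracDerivLine χ α (fun s => waveSolution β φ s x) t =
      multiplier (fun j => symb K α j * (waveProfile K j ‖t‖ * (symb K β j)⁻¹)) φ x := by
  obtain ⟨J, hJ⟩ := hφ.exists_hasBand hK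
  rw [fracDerivLine_eq_multiplier hK hχ α (isLizorkinLine_waveSolution hK hφ β x),
    lineLift_waveSolution hJ, multiplier_sum_mul hK _ _ fun j _ => isLizorkin_waveProfile hK j,
    hJ.multiplier_eq]
  refine Finset.sum_congr rfl fun j _ => ?_
  rw [multiplier_waveProfile hK]
  simp only [pi_norm_const]
  ring

/-- In each term the time profile and the spatial part have the same frequency `qʲ`, so both
operators multiply it by `q^{jα}`, whatever `β` is. -/
theorem isWaveSolution_waveSolution (hK : IsNormalizedAbs K) (hχ : IsRankZero χ) (α β : ℝ)
    {φ : (Fin n → K) → ℂ} (hφ : IsLizorkin φ) : IsWaveSolution χ α (waveSolution β φ) where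
  lizorkin_time x := isLizorkinLine_waveSolution hK hφ β x
  radial_time x t t' h := by rw [waveSolution, waveSolution, h]
  lizorkin_space t := hφ.multiplier hK _
  equation t x := by
    rw [fracDerivLine_waveSolution hK hχ α β hφ, waveSolution,
      fracDeriv_eq_multiplier hK hχ α (hφ.multiplier hK _), multiplier_multiplier hK hφ]
    exact sub_self _

theorem fracDerivLine_waveSolution_zero (hK : IsNormalizedAbs K) (hχ : IsRankZero χ) (β : ℝ)
    {φ : (Fin n → K) → ℂ} (hφ : IsLizorkin φ) (x : Fin n → K) :
    fracDerivLine χ β (fun s => waveSolution β φ s x) 0 = φ x := by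
  rw [fracDerivLine_waveSolution hK hχ β β hφ]
  conv_rhs => rw [← multiplier_one hK hφ]
  congr 1
  ext j
  rw [norm_zero, waveProfile_zero hK, Complex.ofReal_one, one_mul,
    mul_inv_cancel₀ (symb_ne_zero hK β j)]

theorem waveSolution_zero (hK : IsNormalizedAbs K) (β : ℝ) (φ : (Fin n → K) → ℂ) :
    waveSolution β φ 0 = multiplier (fun j => (symb K β j)⁻¹) φ := by
  simp only [waveSolution, norm_zero, waveProfile_zero hK, Complex.ofReal_one, one_mul]

theorem waveSolution_eq_ballAvg (hK : IsNormalizedAbs K) (β : ℝ) {φ : (Fin n → K) → ℂ}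
    (hφ : IsLizorkin φ) {t : K} {k : ℤ} (ht : ‖t‖ = qK ^ k) (x : Fin n → K) :
    waveSolution β φ t x = (qK / (qK - 1) : ℝ) • ballAvg (-k) (waveSolution β φ 0) x -
      ((qK - 1)⁻¹ : ℝ) • ballAvg (1 - k) (waveSolution β φ 0) x := by
  have h0 : IsLizorkin (multiplier (fun j => (symb K β j)⁻¹) φ) := hφ.multiplier hK _
  obtain ⟨J, hJ⟩ := hφ.exists_hasBand hK
  rw [waveSolution_zero hK, ballAvg_eq_multiplier hK h0, ballAvg_eq_multiplier hK h0,
    multiplier_multiplier hK hφ, multiplier_multiplier hK hφ, waveSolution, hJ.multiplier_eq,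
    hJ.multiplier_eq, hJ.multiplier_eq, ht, Finset.smul_sum, Finset.smul_sum,
    ← Finset.sum_sub_distrib]
  refine Finset.sum_congr rfl fun j _ => ?_
  rw [waveProfile_zpow hK, Complex.real_smul, Complex.real_smul]
  split_ifs <;> push_cast <;> ring

theorem conv_kernelB_multiplier (hK : IsNormalizedAbs K) {φ : (Fin n → K) → ℂ}
    (hφ : IsLizorkin φ) {t : K} (ht : t ≠ 0) :
    conv (kernelB t) φ = multiplier (fun j => (waveProfile K j ‖t‖ : ℂ)) φ := by
  obtain ⟨k, hk⟩ := norm_eq_zpow hK ht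
  have h := waveSolution_eq_ballAvg hK 0 hφ hk
  simp only [waveSolution, symb_zero, inv_one, mul_one, norm_zero, waveProfile_zero hK,
    Complex.ofReal_one, multiplier_one hK hφ] at h
  ext x
  rw [conv_kernelB hK hk hφ.isTest, h]

theorem waveSolution_zero_order (hK : IsNormalizedAbs K) {φ : (Fin n → K) → ℂ}
    (hφ : IsLizorkin φ) {t : K} (ht : t ≠ 0) :
    waveSolution 0 φ t = conv (kernelB t) φ := by
  rw [conv_kernelB_multiplier hK hφ ht]
  simp only [waveSolution, symb_zero, inv_one, mul_one]

theorem waveSolution_modified_zero (hK : IsNormalizedAbs K) (hn : 2 ≤ n) {φ : (Fin n → K) → ℂ}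
    (hφ : IsLizorkin φ) : waveSolution ((n : ℝ) - 1) φ 0 = conv kernelA φ := by
  rw [waveSolution_zero hK, (conv_kernelA hK hn hφ).2]
  simp only [symb, Complex.ofReal_inv]

theorem waveSolution_modified (hK : IsNormalizedAbs K) (hn : 2 ≤ n) {φ : (Fin n → K) → ℂ}
    (hφ : IsLizorkin φ) {t : K} (ht : t ≠ 0) :
    ConvExists kernelA (conv (kernelB t) φ) ∧
      waveSolution ((n : ℝ) - 1) φ t = conv kernelA (conv (kernelB t) φ) := by
  rw [conv_kernelB_multiplier hK hφ ht]
  have h := conv_kernelA hK hn (hφ.multiplier hK fun j => (waveProfile K j ‖t‖ : ℂ))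
  refine ⟨h.1, ?_⟩
  rw [h.2, multiplier_multiplier hK hφ, waveSolution]
  congr 1
  ext j
  rw [mul_comm, symb, Complex.ofReal_inv]

end Existence

end NAWave

namespace NAWave

set_option linter.unusedSectionVars false

/-! ### Uniqueness through averages in time. -/

section Uniqueness

variable {K : Type*} [NontriviallyNormedField K] [IsUltrametricDist K]
  [LocallyCompactSpace K] [MeasurableSpace K] [BorelSpace K] [ProperSpace K] {n : ℕ}
  {χ : AddChar K Circle}

local notation "qK" => (residueCard K : ℝ)

/-- The value of a radial function on a sphere in terms of its averages over balls. -/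
theorem radial_eq_ballAvg (hK : IsNormalizedAbs K) {u : (Fin 1 → K) → ℂ} (hu : Continuous u)
    (hr : ∀ x y, ‖x‖ = ‖y‖ → u x = u y) {k : ℤ} {x : Fin 1 → K} (hx : ‖x‖ = qK ^ k) :
    ((qK : ℂ) - 1) * u x = qK * ballAvg (-k) u 0 - ballAvg (1 - k) u 0 := by
  have hq0 := residueCard_pos hK
  have hsub : Metric.closedBall (0 : Fin 1 → K) (qK ^ (k - 1)) ⊆ Metric.closedBall 0 (qK ^ k) :=
    Metric.closedBall_subset_closedBall
      (zpow_le_zpow_right₀ (one_lt_residueCard hK).le (by omega))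
  have hset : Metric.closedBall (0 : Fin 1 → K) (qK ^ k) \ Metric.closedBall 0 (qK ^ (k - 1)) =
      {y | ‖y‖ = qK ^ k} := by
    ext y; simp [norm_eq_zpow_iff hK]
  have h := setIntegral_sdiff (μ := haarPi K 1) (f := u)
    (Metric.isClosed_closedBall (x := (0 : Fin 1 → K)) (ε := qK ^ (k - 1))).measurableSet
    (integrableOn_closedBall hu 0 (qK ^ k)) hsub
  rw [hset, setIntegral_congr_fun (g := fun _ => u x) (measurableSet_sphere _)
    fun y hy => hr y x ((show ‖y‖ = _ from hy).trans hx.symm), setIntegral_const,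
    measureReal_sphere hK] at h
  rw [ballAvg, ballAvg, neg_neg, neg_sub]
  set I := ∫ y in Metric.closedBall (0 : Fin 1 → K) (qK ^ k), u y ∂(haarPi K 1)
  set I' := ∫ y in Metric.closedBall (0 : Fin 1 → K) (qK ^ (k - 1)), u y ∂(haarPi K 1)
  have hI : I' = I - (qK ^ k - qK ^ k * qK⁻¹ : ℝ) • u x := by
    rw [Nat.cast_one, mul_one, mul_one, zpow_sub_one₀ hq0.ne'] at h
    rw [h, sub_sub_cancel]
  rw [hI]
  have e1 : qK ^ ((1 - k) * ((1 : ℕ) : ℤ)) = qK * (qK ^ k)⁻¹ := by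
    rw [Nat.cast_one, mul_one, zpow_sub₀ hq0.ne', zpow_one, div_eq_mul_inv]
  have e2 : qK ^ (-k * ((1 : ℕ) : ℤ)) = (qK ^ k)⁻¹ := by simp
  rw [e1, e2]
  have hk : ((qK ^ k : ℝ) : ℂ) ≠ 0 :=
    Complex.ofReal_ne_zero.2 (residueCard_zpow_pos hK k).ne'
  have hqc : ((qK : ℝ) : ℂ) ≠ 0 := Complex.ofReal_ne_zero.2 hq0.ne'
  simp only [Complex.real_smul]
  generalize qK ^ k = w at *
  generalize qK = r at *
  push_cast
  field_simp
  ring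

/-- A sequence with increments of level `m` that starts at zero pointwise consists of functions
of level `m`. -/
theorem isLevel_of_increments (hK : IsNormalizedAbs K) {V : ℤ → (Fin n → K) → ℂ}
    (hinc : ∀ m, IsLevel m fun x => V m x - V (m - 1) x)
    (h0 : ∀ x, ∃ J : ℕ, ∀ m : ℤ, m ≤ -J → V m x = 0) (m : ℤ) : IsLevel m (V m) := by
  have hl : ∀ l : ℕ, IsLevel m fun x => V m x - V (m - l) x := by
    intro l
    induction l with
    | zero => intro x y _; simp
    | succ l ih =>
      have h1 := ih.comp₂ ((hinc (m - l)).mono hK (by omega)) (· + ·)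
      have e : m - ((l + 1 : ℕ) : ℤ) = m - l - 1 := by push_cast; ring
      simpa only [e, sub_add_sub_cancel] using h1
  intro x y hxy
  obtain ⟨J, hJ⟩ := h0 x
  obtain ⟨J', hJ'⟩ := h0 y
  -- The threshold depends on the point, so the descent goes to the index `-(J + J')`, below both
  -- thresholds.
  have h := hl (m + J + J').toNat x y hxy
  simp only at h
  by_cases hm : 0 ≤ m + J + J'
  · rwa [Int.toNat_of_nonneg hm, hJ (m - (m + J + J')) (by omega),
        hJ' (m - (m + J + J')) (by omega), sub_zero, sub_zero] at h
  · rw [hJ m (by omega), hJ' m (by omega)]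

/-- A martingale that vanishes eventually at every point is zero. -/
theorem martingale_eq_zero (hK : IsNormalizedAbs K) {V : ℤ → (Fin n → K) → ℂ}
    (hlev : ∀ m, IsLevel m (V m)) (hmart : ∀ m, ballAvg m (V (m + 1)) = V m)
    (h0 : ∀ x, ∃ J : ℕ, ∀ m : ℤ, J ≤ m → V m x = 0) (m : ℤ) (x : Fin n → K) : V m x = 0 := by
  by_contra hne
  -- A nonzero average has a nonzero value in its ball. Iteration yields nested balls shrinking to a
  -- point `z`, and the level property carries the nonzero values to `z`. Only vanishing at the
  -- single point `z` is then needed, so thresholds depending on the point suffice.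
  have hstep : ∀ (m : ℤ) (x : Fin n → K), V m x ≠ 0 →
      ∃ y, ‖y - x‖ ≤ qK ^ (-m) ∧ V (m + 1) y ≠ 0 := by
    intro m x hx
    by_contra hall
    push Not at hall
    apply hx
    rw [← hmart, ballAvg_congr (g := fun _ => 0) hall, ballAvg_const hK]
  choose! next hnext hnext0 using hstep
  let p : ℕ → Fin n → K := fun l => Nat.rec x (fun l y => next (m + l) y) l
  have hp0 : ∀ l : ℕ, V (m + l) (p l) ≠ 0 := by
    intro l
    induction l with
    | zero => simpa [p] using hne
    | succ l ih =>
      have := hnext0 (m + l) (p l) ih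
      rw [add_assoc] at this
      exact_mod_cast this
  have hp1 : ∀ l : ℕ, ‖p (l + 1) - p l‖ ≤ qK ^ (-(m + l)) := fun l => hnext (m + l) (p l) (hp0 l)
  have hq := one_lt_residueCard hK
  have hdist : ∀ l i : ℕ, ‖p (l + i) - p l‖ ≤ qK ^ (-(m + l)) := by
    intro l i
    induction i with
    | zero => simpa using (residueCard_zpow_pos hK _).le
    | succ i ih =>
      have h1 := (hp1 (l + i)).trans
        (zpow_le_zpow_right₀ hq.le (by push_cast; omega) : _ ≤ qK ^ (-(m + l)))
      have := norm_add_le_of_le h1 ih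
      rwa [sub_add_sub_cancel] at this
  have hcauchy : CauchySeq p := by
    rw [Metric.cauchySeq_iff']
    intro ε hε
    obtain ⟨J, hJ⟩ := tendsto_residueCard_zpow_atTop hK ε⁻¹
    refine ⟨(J - m).toNat, fun i hi => ?_⟩
    obtain ⟨d, rfl⟩ := Nat.exists_eq_add_of_le hi
    rw [dist_eq_norm]
    refine (hdist _ d).trans_lt ?_
    rw [zpow_neg]
    refine inv_lt_of_inv_lt₀ hε (hJ.trans_le (zpow_le_zpow_right₀ hq.le ?_))
    have := Int.self_le_toNat (J - m)
    omega
  obtain ⟨z, hz⟩ := cauchySeq_tendsto_of_complete hcauchy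
  have hzl : ∀ l : ℕ, ‖z - p l‖ ≤ qK ^ (-(m + l)) := by
    intro l
    have h1 : Filter.Tendsto (fun i => ‖p i - p l‖) Filter.atTop (nhds ‖z - p l‖) :=
      (hz.sub_const _).norm
    refine le_of_tendsto h1 ?_
    filter_upwards [Filter.eventually_ge_atTop l] with i hi
    obtain ⟨d, rfl⟩ := Nat.exists_eq_add_of_le hi
    exact hdist l d
  obtain ⟨J, hJ⟩ := h0 z
  have h1 := hlev (m + (J - m).toNat) z (p (J - m).toNat) (hzl _)
  rw [hJ _ (by have := Int.self_le_toNat (J - m); omega)] at h1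
  exact hp0 _ h1.symm

/-- The average of `F(·, x)` over the ball of radius `q⁻ᵐ` in time. -/
noncomputable def timeAvg (F : K → (Fin n → K) → ℂ) (m : ℤ) (x : Fin n → K) : ℂ :=
  ballAvg m (lineLift fun t => F t x) 0

/-- The average of `(D_t^β F)(·, x)` over the ball of radius `q⁻ᵐ` in time. -/
noncomputable def timeAvgDeriv (β : ℝ) (F : K → (Fin n → K) → ℂ) (m : ℤ) (x : Fin n → K) : ℂ :=
  ballAvg m (multiplier (symb K β) (lineLift fun t => F t x)) 0

section Solution

variable {α : ℝ} {F : K → (Fin n → K) → ℂ}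

/-- An increment of the time averages is the frequency part `m` in time, evaluated at `t = 0`, on
which the operator acts as a scalar. -/
theorem timeAvgDeriv_sub (hK : IsNormalizedAbs K) (hF : IsWaveSolution χ α F) (β : ℝ) (m : ℤ)
    (x : Fin n → K) : timeAvgDeriv β F m x - timeAvgDeriv β F (m - 1) x =
      symb K β m * (timeAvg F m x - timeAvg F (m - 1) x) :=
  bandPass_multiplier hK (hF.lizorkin_time x).lineLift (symb K β) m 0

theorem timeAvg_eventually_zero (hK : IsNormalizedAbs K) (hF : IsWaveSolution χ α F)
    (x : Fin n → K) : ∃ J : ℕ, ∀ m : ℤ, m ≤ -J → timeAvg F m x = 0 := by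
  obtain ⟨J, hJ⟩ := (hF.lizorkin_time x).lineLift.exists_hasBand hK
  exact ⟨J, fun m hm => congrFun (hJ.2 m hm) 0⟩

theorem timeAvgDeriv_eventually_zero (hK : IsNormalizedAbs K) (hF : IsWaveSolution χ α F) (β : ℝ)
    (x : Fin n → K) : ∃ J : ℕ, ∀ m : ℤ, m ≤ -J → timeAvgDeriv β F m x = 0 := by
  obtain ⟨J, hJ⟩ :=
    ((hF.lizorkin_time x).lineLift.multiplier hK (symb K β)).exists_hasBand hK
  exact ⟨J, fun m hm => congrFun (hJ.2 m hm) 0⟩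

theorem timeAvgDeriv_eventually_eq (hK : IsNormalizedAbs K) (hχ : IsRankZero χ)
    (hF : IsWaveSolution χ α F) (β : ℝ) (x : Fin n → K) :
    ∃ J : ℕ, ∀ m : ℤ, J ≤ m → timeAvgDeriv β F m x = fracDerivLine χ β (fun t => F t x) 0 := by
  obtain ⟨J, hJ⟩ :=
    ((hF.lizorkin_time x).lineLift.multiplier hK (symb K β)).exists_hasBand hK
  refine ⟨J, fun m hm => ?_⟩
  rw [timeAvgDeriv, hJ.1 m hm, fracDerivLine_eq_multiplier hK hχ β (hF.lizorkin_time x)]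
  rfl

theorem radial_of_norm_eq (hF : IsWaveSolution χ α F) {t t' : K} (h : ‖t‖ = ‖t'‖) : F t = F t' :=
  funext fun x => hF.radial_time x t t' h

theorem norm_apply_zero (x : Fin 1 → K) : ‖x 0‖ = ‖x‖ := by
  have : x = fun _ => x 0 := by ext i; rw [Subsingleton.elim i 0]
  conv_rhs => rw [this]
  exact (pi_norm_const _).symm

theorem value_eq_timeAvg (hK : IsNormalizedAbs K) (hF : IsWaveSolution χ α F) {t : K} {k : ℤ}
    (ht : ‖t‖ = qK ^ k) (x : Fin n → K) :
    ((qK : ℂ) - 1) * F t x = qK * timeAvg F (-k) x - timeAvg F (1 - k) x :=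
  radial_eq_ballAvg hK (u := lineLift fun t => F t x) (x := fun _ => t)
    (hF.lizorkin_time x).lineLift.isTest.continuous
    (fun y z h => hF.radial_time x _ _ (by rwa [norm_apply_zero, norm_apply_zero]))
    ((pi_norm_const t).trans ht)

/-- The equation identifies the time derivative with a spatial operator applied to `F t`, so it
inherits radiality in `t` from `F`. -/
theorem deriv_eq_timeAvgDeriv (hK : IsNormalizedAbs K) (hχ : IsRankZero χ)
    (hF : IsWaveSolution χ α F) {t : K} {k : ℤ} (ht : ‖t‖ = qK ^ k) (x : Fin n → K) :
    ((qK : ℂ) - 1) * multiplier (symb K α) (F t) x =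
      qK * timeAvgDeriv α F (-k) x - timeAvgDeriv α F (1 - k) x := by
  have hval : ∀ y : Fin 1 → K, multiplier (symb K α) (lineLift fun t => F t x) y =
      multiplier (symb K α) (F (y 0)) x := by
    intro y
    have h1 := fracDerivLine_eq_multiplier hK hχ α (hF.lizorkin_time x) (y 0)
    have h2 := congrFun (fracDeriv_eq_multiplier hK hχ α (hF.lizorkin_space (y 0))) x
    have h3 : y = fun _ => y 0 := by ext i; rw [Subsingleton.elim i 0]
    rw [← h3] at h1
    rw [← h1, sub_eq_zero.1 (hF.equation (y 0) x), h2]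
    rfl
  have h := radial_eq_ballAvg hK (u := multiplier (symb K α) (lineLift fun t => F t x))
    (x := fun _ => t) ((hF.lizorkin_time x).lineLift.multiplier hK _).isTest.continuous
    (fun y z h => by
      rw [hval, hval, radial_of_norm_eq hF (show ‖y 0‖ = ‖z 0‖ by
        rwa [norm_apply_zero, norm_apply_zero])])
    ((pi_norm_const t).trans ht)
  rw [hval] at h
  exact h

/-- Averaging over `t` need not preserve the Lizorkin space, as nothing is uniform in `t`. Instead,
the time averages are solved for algebraically from `F` and its spatial derivative at two times. -/
theorem isLizorkin_timeAvg (hK : IsNormalizedAbs K) (hχ : IsRankZero χ) (hα : 0 < α)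
    (hF : IsWaveSolution χ α F) (m : ℤ) :
    IsLizorkin (timeAvg F m) ∧ IsLizorkin (timeAvgDeriv α F m) := by
  obtain ⟨t, -, ht⟩ := exists_norm_eq_zpow hK (-m)
  obtain ⟨t', -, ht'⟩ := exists_norm_eq_zpow hK (1 - m)
  have hq : ((qK : ℂ) - 1) ≠ 0 := by
    rw [sub_ne_zero]; exact_mod_cast (one_lt_residueCard hK).ne'
  set a := symb K α m
  set b := symb K α (m + 1)
  have hab : b - a ≠ 0 := sub_ne_zero.2 fun h => by
    have := symb_injective hK hα h; omega
  -- The sphere relations at `|t| = q⁻ᵐ` involve indices `m, m + 1`, those at `|t'| = q^{1-m}`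
  -- indices `m - 1, m`. The increment relations eliminate the outer indices, leaving two equations
  -- for the two averages of index `m`. They are independent since `a ≠ b`, by `α > 0`.
  have key : ∀ x, (b - a) * timeAvg F m x = (b * F t x - a * F t' x) -
      (multiplier (symb K α) (F t) x - multiplier (symb K α) (F t') x) ∧
      timeAvgDeriv α F m x = a * (timeAvg F m x - F t' x) + multiplier (symb K α) (F t') x := by
    intro x
    have h1 := value_eq_timeAvg hK hF ht x
    have h2 := value_eq_timeAvg hK hF ht' x
    have h3 := deriv_eq_timeAvgDeriv hK hχ hF ht x
    have h4 := deriv_eq_timeAvgDeriv hK hχ hF ht' x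
    have h5 := timeAvgDeriv_sub hK hF α m x
    have h6 := timeAvgDeriv_sub hK hF α (m + 1) x
    have e1 : - -m = m := neg_neg m
    have e2 : 1 - -m = m + 1 := by ring
    have e3 : -(1 - m) = m - 1 := by ring
    have e4 : 1 - (1 - m) = m := by ring
    have e5 : m + 1 - 1 = m := by ring
    rw [e1, e2] at h1 h3
    rw [e3, e4] at h2 h4
    rw [e5] at h6
    have hqc : (qK : ℂ) ≠ 0 := by exact_mod_cast (residueCard_pos hK).ne'
    have h7 : timeAvgDeriv α F m x =
        a * (timeAvg F m x - F t' x) + multiplier (symb K α) (F t') x := by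
      apply mul_left_cancel₀ hq
      linear_combination (qK : ℂ) * h5 + a * h2 - h4
    have h8 : timeAvgDeriv α F m x =
        b * (timeAvg F m x - F t x) + multiplier (symb K α) (F t) x := by
      apply mul_left_cancel₀ hq
      linear_combination b * h1 - h3 + h6
    exact ⟨by linear_combination h7 - h8, h7⟩
  have hL : ∀ t, IsLizorkin (multiplier (symb K α) (F t)) := fun t =>
    (hF.lizorkin_space t).multiplier hK _
  have hS : IsLizorkin (timeAvg F m) := by
    have h := (((hF.lizorkin_space t).const_mul b).sub ((hF.lizorkin_space t').const_mul a)).sub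
      ((hL t).sub (hL t'))
    have h' := h.const_mul (b - a)⁻¹
    convert h' using 1
    ext x
    rw [← (key x).1, inv_mul_cancel_left₀ hab]
  refine ⟨hS, ?_⟩
  have h := ((hS.sub (hF.lizorkin_space t')).const_mul a).add (hL t')
  convert h using 1
  ext x
  exact (key x).2

/-- Let `W m` be the spatial frequency part `i` of `T_m - q^{iα} S_m`. The sphere relations give `W
(m + 1) = q W m`, and the increment relation at `m = i` gives `W i = W (i - 1)`; hence `W = 0`. The
increment relation at `m ≠ i` then reads `(q^{iα} - q^{mα})` times the increment equals zero. -/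
theorem bandPass_timeAvg_eq (hK : IsNormalizedAbs K) (hχ : IsRankZero χ) (hα : 0 < α)
    (hF : IsWaveSolution χ α F) {i m : ℤ} (him : i ≠ m) (x : Fin n → K) :
    bandPass i (timeAvg F m) x = bandPass i (timeAvg F (m - 1)) x := by
  have hS := fun m => (isLizorkin_timeAvg hK hχ hα hF m).1
  have hT := fun m => (isLizorkin_timeAvg hK hχ hα hF m).2
  set a := symb K α
  let W : ℤ → ℂ := fun m => bandPass i (timeAvgDeriv α F m) x - a i * bandPass i (timeAvg F m) x
  have hinc : ∀ m, bandPass i (timeAvgDeriv α F m) x - bandPass i (timeAvgDeriv α F (m - 1)) x =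
      a m * (bandPass i (timeAvg F m) x - bandPass i (timeAvg F (m - 1)) x) := by
    intro m
    rw [← bandPass_sub _ (hT m).isTest.continuous (hT (m - 1)).isTest.continuous,
      ← bandPass_sub _ (hS m).isTest.continuous (hS (m - 1)).isTest.continuous,
      ← bandPass_const_mul]
    congr 1
    ext y
    exact timeAvgDeriv_sub hK hF α m y
  have hW : ∀ m, W (m + 1) = qK * W m := by
    intro m
    obtain ⟨t, -, ht⟩ := exists_norm_eq_zpow hK (-m)
    have e1 : - -m = m := neg_neg m
    have e2 : 1 - -m = m + 1 := by ring
    have h1 : (fun y => ((qK : ℂ) - 1) * F t y) =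
        fun y => (qK : ℂ) * timeAvg F m y - timeAvg F (m + 1) y := by
      ext y
      have := value_eq_timeAvg hK hF ht y
      rwa [e1, e2] at this
    have h2 : (fun y => ((qK : ℂ) - 1) * multiplier a (F t) y) =
        fun y => (qK : ℂ) * timeAvgDeriv α F m y - timeAvgDeriv α F (m + 1) y := by
      ext y
      have := deriv_eq_timeAvgDeriv hK hχ hF ht y
      rwa [e1, e2] at this
    have h3 := congrFun (congrArg (bandPass i) h1) x
    have h4 := congrFun (congrArg (bandPass i) h2) x
    rw [bandPass_const_mul, bandPass_sub _ ((hS m).isTest.continuous.const_mul _)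
      (hS (m + 1)).isTest.continuous, bandPass_const_mul] at h3
    rw [bandPass_const_mul, bandPass_sub _ ((hT m).isTest.continuous.const_mul _)
      (hT (m + 1)).isTest.continuous, bandPass_const_mul,
      bandPass_multiplier hK (hF.lizorkin_space t)] at h4
    simp only [W]
    linear_combination h4 - a i * h3
  have hq : ((qK : ℂ) - 1) ≠ 0 := by
    rw [sub_ne_zero]; exact_mod_cast (one_lt_residueCard hK).ne'
  have hq0 : (qK : ℂ) ≠ 0 := by exact_mod_cast (residueCard_pos hK).ne'
  have hWi : W i = 0 := by
    have h1 := hinc i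
    have h2 := hW (i - 1)
    rw [sub_add_cancel] at h2
    have h3 : W i = W (i - 1) := by simp only [W]; linear_combination h1
    have h4 : ((qK : ℂ) - 1) * W (i - 1) = 0 := by linear_combination h3 - h2
    rw [h3]
    exact (mul_eq_zero.1 h4).resolve_left hq
  have hW0 : ∀ l : ℤ, W (i + l) = 0 := by
    intro l
    induction l using Int.induction_on with
    | zero => simpa using hWi
    | succ l ih => rw [← add_assoc, hW, ih, mul_zero]
    | pred l ih =>
      have := hW (i + (-l - 1))
      rw [show i + (-(l : ℤ) - 1) + 1 = i + -l by ring, ih] at this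
      exact (mul_eq_zero.1 this.symm).resolve_left hq0
  have h1 := hW0 (m - i)
  have h2 := hW0 (m - 1 - i)
  rw [add_sub_cancel] at h1 h2
  have h3 := hinc m
  simp only [W] at h1 h2
  have h4 : (a i - a m) * (bandPass i (timeAvg F m) x - bandPass i (timeAvg F (m - 1)) x) = 0 := by
    linear_combination h3 - h1 + h2
  have h5 : a i - a m ≠ 0 := sub_ne_zero.2 fun h => him (symb_injective hK hα h)
  exact sub_eq_zero.1 ((mul_eq_zero.1 h4).resolve_left h5)

/-- The increments of the time averages have a single frequency. -/
theorem timeAvg_increment (hK : IsNormalizedAbs K) (hχ : IsRankZero χ) (hα : 0 < α)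
    (hF : IsWaveSolution χ α F) (m : ℤ) :
    IsLevel m (fun x => timeAvg F m x - timeAvg F (m - 1) x) ∧
      ballAvg (m - 1) (fun x => timeAvg F m x - timeAvg F (m - 1) x) = 0 := by
  have hS := fun m => (isLizorkin_timeAvg hK hχ hα hF m).1
  have hc := (hS m).sub (hS (m - 1))
  set c := fun x => timeAvg F m x - timeAvg F (m - 1) x with hcdef
  have h : bandPass m c = c := by
    refine (hc.bandPass hK m).ext_bandPass hK hc fun i x => ?_
    rw [bandPass_bandPass hK i m hc.isTest]
    split_ifs with him
    · rw [him]
    · rw [hcdef, bandPass_sub _ (hS m).isTest.continuous (hS (m - 1)).isTest.continuous,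
        bandPass_timeAvg_eq hK hχ hα hF him, sub_self]
      rfl
  constructor
  · rw [← h]; exact isLevel_bandPass hK m c
  · rw [← h, ballAvg_bandPass hK _ _ hc.isTest, if_neg (by omega)]

/-- The difference of the two sides is a martingale in `m`, because the increments in time have the
single spatial frequency `qᵐ`. At each point both sides equal `φ x` for large `m`. -/
theorem timeAvgDeriv_eq_ballAvg (hK : IsNormalizedAbs K) (hχ : IsRankZero χ) (hα : 0 < α)
    (hF : IsWaveSolution χ α F) {β : ℝ} {φ : (Fin n → K) → ℂ} (hφ : IsLizorkin φ)
    (hi : ∀ x, fracDerivLine χ β (fun t => F t x) 0 = φ x) (m : ℤ) (x : Fin n → K) :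
    timeAvgDeriv β F m x = ballAvg m φ x := by
  have hinc := timeAvg_increment hK hχ hα hF
  have hfun : ∀ m, (fun x => timeAvgDeriv β F m x - timeAvgDeriv β F (m - 1) x) =
      fun x => symb K β m * (timeAvg F m x - timeAvg F (m - 1) x) := fun m =>
    funext fun x => timeAvgDeriv_sub hK hF β m x
  have hlev : ∀ m, IsLevel m (timeAvgDeriv β F m) :=
    isLevel_of_increments hK (fun m => by rw [hfun]; exact (hinc m).1.comp (symb K β m * ·))
      fun x => timeAvgDeriv_eventually_zero hK hF β x
  refine sub_eq_zero.1 (martingale_eq_zero hK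
    (V := fun m x => timeAvgDeriv β F m x - ballAvg m φ x)
    (fun m => (hlev m).comp₂ (isLevel_ballAvg m φ) (· - ·)) ?_ ?_ m x)
  · intro m
    have hb : ballAvg m (fun x => timeAvgDeriv β F (m + 1) x - timeAvgDeriv β F m x) = 0 := by
      have h1 := hfun (m + 1)
      have h2 := (hinc (m + 1)).2
      rw [add_sub_cancel_right] at h1 h2
      rw [h1]
      ext y
      have h3 := ballAvg_smul m (symb K β (m + 1))
        (fun x => timeAvg F (m + 1) x - timeAvg F m x) y
      simp only [smul_eq_mul] at h3
      rw [h3, h2]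
      simp
    ext y
    have h4 := congrFun hb y
    rw [ballAvg_sub _ ((hlev (m + 1)).continuous hK) ((hlev m).continuous hK),
      (hlev m).ballAvg_eq hK, Pi.zero_apply, sub_eq_zero] at h4
    rw [ballAvg_sub _ ((hlev (m + 1)).continuous hK)
      (hφ.ballAvg hK (m + 1)).isTest.continuous, h4, ballAvg_ballAvg hK _ _ hφ.isTest,
      min_eq_left (by omega)]
  · intro x
    obtain ⟨J, hJ⟩ := timeAvgDeriv_eventually_eq hK hχ hF β x
    obtain ⟨J', hJ'⟩ := hφ.exists_hasBand hK
    refine ⟨J + J', fun m hm => ?_⟩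
    push_cast at hm
    rw [hJ m (by omega), hi, hJ'.1 m (by omega), sub_self]

end Solution

/-- Solutions of the wave equation are determined by `(D_t^β F)(0, ·)`. -/
theorem IsWaveSolution.unique (hK : IsNormalizedAbs K) (hχ : IsRankZero χ) {α β : ℝ} (hα : 0 < α)
    {F G : K → (Fin n → K) → ℂ} (hF : IsWaveSolution χ α F) (hG : IsWaveSolution χ α G)
    {φ : (Fin n → K) → ℂ} (hφ : IsLizorkin φ)
    (hFi : ∀ x, fracDerivLine χ β (fun t => F t x) 0 = φ x)
    (hGi : ∀ x, fracDerivLine χ β (fun t => G t x) 0 = φ x) : F = G := by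
  have hc : ∀ m x, timeAvg F m x - timeAvg F (m - 1) x = timeAvg G m x - timeAvg G (m - 1) x := by
    intro m x
    apply mul_left_cancel₀ (symb_ne_zero hK β m)
    rw [← timeAvgDeriv_sub hK hF, ← timeAvgDeriv_sub hK hG,
      timeAvgDeriv_eq_ballAvg hK hχ hα hF hφ hFi, timeAvgDeriv_eq_ballAvg hK hχ hα hF hφ hFi,
      timeAvgDeriv_eq_ballAvg hK hχ hα hG hφ hGi, timeAvgDeriv_eq_ballAvg hK hχ hα hG hφ hGi]
  have hl : ∀ (m : ℤ) x (l : ℕ), timeAvg F m x - timeAvg F (m - l) x =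
      timeAvg G m x - timeAvg G (m - l) x := by
    intro m x l
    induction l with
    | zero => simp
    | succ l ih =>
      have e : m - ((l + 1 : ℕ) : ℤ) = m - l - 1 := by push_cast; ring
      rw [e]
      linear_combination ih + hc (m - l) x
  have hS : ∀ m x, timeAvg F m x = timeAvg G m x := by
    intro m x
    obtain ⟨J, hJ⟩ := timeAvg_eventually_zero hK hF x
    obtain ⟨J', hJ'⟩ := timeAvg_eventually_zero hK hG x
    by_cases hm : 0 ≤ m + J + J'
    · have := hl m x (m + J + J').toNat
      rwa [Int.toNat_of_nonneg hm, hJ (m - (m + J + J')) (by omega),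
        hJ' (m - (m + J + J')) (by omega), sub_zero, sub_zero] at this
    · rw [hJ m (by omega), hJ' m (by omega)]
  have hq : ((qK : ℂ) - 1) ≠ 0 := by
    rw [sub_ne_zero]; exact_mod_cast (one_lt_residueCard hK).ne'
  have hne : ∀ t : K, t ≠ 0 → ∀ x, F t x = G t x := by
    intro t ht x
    obtain ⟨k, hk⟩ := norm_eq_zpow hK ht
    apply mul_left_cancel₀ hq
    rw [value_eq_timeAvg hK hF hk, value_eq_timeAvg hK hG hk, hS, hS]
  ext t x
  -- Time zero lies on no sphere; the value there is that at a small nonzero time, by local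
  -- constancy in `t`.
  rcases eq_or_ne t 0 with rfl | ht
  · obtain ⟨J, hJ⟩ := (hF.lizorkin_time x).lineLift.isTest.exists_level hK
    obtain ⟨J', hJ'⟩ := (hG.lizorkin_time x).lineLift.isTest.exists_level hK
    obtain ⟨s, hs0, hs⟩ := exists_norm_eq_zpow hK (-(max J J' : ℤ))
    have hn : ‖(fun _ : Fin 1 => s) - 0‖ ≤ qK ^ (-(max J J' : ℤ)) := by
      rw [sub_zero, pi_norm_const, hs]
    have h1 := (hJ (max J J') (le_max_left _ _)).1 _ _ hn
    have h2 := (hJ' (max J J') (le_max_right _ _)).1 _ _ hn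
    exact h1.symm.trans ((hne s hs0 x).trans h2)
  · exact hne t ht x

end Uniqueness

end NAWave

namespace NAWave

set_option linter.unusedSectionVars false

/-! ### Real inequalities for Doob's and Hedberg's arguments. -/

section RealInequalities

/-- Young's inequality for `a` and `b^(p-1)` with exponents `p` and `p/(p-1)`. -/
theorem mul_rpow_sub_one_le {p a b : ℝ} (hp : 1 < p) (ha : 0 ≤ a) (hb : 0 ≤ b) :
    p * (a * b ^ (p - 1)) ≤ a ^ p + (p - 1) * b ^ p := by
  have hpq := Real.HolderConjugate.conjExponent hp
  have h := Real.young_inequality_of_nonneg ha (Real.rpow_nonneg hb (p - 1)) hpq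
  have hp0 : p ≠ 0 := by linarith
  have hp1 : p - 1 ≠ 0 := by linarith
  rw [← Real.rpow_mul hb, Real.conjExponent, mul_div_cancel₀ _ hp1] at h
  calc p * (a * b ^ (p - 1)) ≤ p * (a ^ p / p + b ^ p / (p / (p - 1))) :=
        mul_le_mul_of_nonneg_left h (by linarith)
    _ = _ := by field_simp

/-- The pointwise form of one induction step in Doob's inequality, with `b` the running maximum and
`c` the next average. -/
theorem max_rpow_le {p b c : ℝ} (hp : 1 < p) (hb : 0 ≤ b) (hc : 0 ≤ c) :
    max b c ^ p ≤ b ^ p + p / (p - 1) * (c * (max b c ^ (p - 1) - b ^ (p - 1))) := by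
  have hp1 : 0 < p - 1 := by linarith
  rcases le_total c b with h | h
  · simp [max_eq_left h]
  · rw [max_eq_right h]
    have h1 := mul_rpow_sub_one_le hp hc hb
    have h2 : c * c ^ (p - 1) = c ^ p := by
      rcases hc.eq_or_lt with rfl | hc'
      · rw [zero_mul, Real.zero_rpow (by linarith)]
      · rw [Real.rpow_sub_one hc'.ne']; field_simp
    rw [mul_sub, h2, ← sub_le_iff_le_add', div_mul_eq_mul_div, le_div_iff₀ hp1]
    linarith

/-- Young's inequality is applied to `2g` so that `M ^ p` gets the coefficient `1/2` and can be
absorbed. -/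
theorem mul_rpow_sub_one_le_half {p g M : ℝ} (hp : 1 < p) (hg : 0 ≤ g) (hM : 0 ≤ M) :
    p / (p - 1) * (g * M ^ (p - 1)) ≤ 2 ^ p / (2 * (p - 1)) * g ^ p + 1 / 2 * M ^ p := by
  have hp1 : 0 < p - 1 := by linarith
  have h := mul_rpow_sub_one_le hp (mul_nonneg zero_le_two hg) hM
  rw [Real.mul_rpow zero_le_two hg] at h
  have h2 : p / (p - 1) * (g * M ^ (p - 1)) =
      1 / (2 * (p - 1)) * (p * (2 * g * M ^ (p - 1))) := by field_simp
  rw [h2]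
  refine (mul_le_mul_of_nonneg_left h (by positivity)).trans (le_of_eq ?_)
  field_simp

theorem summable_rpow_neg_abs {Q ε : ℝ} (hQ : 1 < Q) (hε : 0 < ε) :
    Summable fun i : ℤ => Q ^ (-(ε * |(i : ℝ)|)) := by
  have h0 : 0 < Q := by linarith
  have hs : Summable fun l : ℕ => Q ^ (-(ε * |((l : ℤ) : ℝ)|)) := by
    have h1 : ∀ l : ℕ, Q ^ (-(ε * |((l : ℤ) : ℝ)|)) = (Q ^ (-ε)) ^ l := by
      intro l
      rw [← Real.rpow_natCast, ← Real.rpow_mul h0.le, Int.cast_natCast,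
        abs_of_nonneg (Nat.cast_nonneg l), neg_mul]
    simp_rw [h1]
    refine summable_geometric_of_lt_one (Real.rpow_nonneg h0.le _) ?_
    exact Real.rpow_lt_one_of_one_lt_of_neg hQ (by linarith)
  refine Summable.of_nat_of_neg hs ?_
  simpa using hs

/-- Summation of the smaller one of two geometric progressions with opposite growth. -/
theorem exists_sum_rpow_min_le {Q β δ : ℝ} (hQ : 1 < Q) (hβ : 0 < β) (hδ : β < δ) :
    ∃ C : ℝ, 0 ≤ C ∧ ∀ (s : Finset ℤ) (M N : ℝ), 0 ≤ M → 0 ≤ N →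
      ∑ j ∈ s, Q ^ (-(β * j)) * min M (Q ^ (δ * j) * N) ≤ C * (M ^ (1 - β / δ) * N ^ (β / δ)) := by
  have h0 : 0 < Q := by linarith
  set ε := min β (δ - β) with hεdef
  have hε : 0 < ε := lt_min hβ (by linarith)
  have hs := summable_rpow_neg_abs hQ hε
  have hδ0 : 0 < δ := by linarith
  refine ⟨Q ^ β * ∑' i : ℤ, Q ^ (-(ε * |(i : ℝ)|)),
    mul_nonneg (Real.rpow_nonneg h0.le _) (tsum_nonneg fun i => Real.rpow_nonneg h0.le _), ?_⟩
  intro s M N hM hN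
  have hexp : 0 < 1 - β / δ := by rw [sub_pos, div_lt_one hδ0]; exact hδ
  rcases hM.eq_or_lt with rfl | hM
  · rw [Finset.sum_eq_zero]
    · rw [Real.zero_rpow hexp.ne']; simp
    · intro j _; rw [min_eq_left (by positivity), mul_zero]
  rcases hN.eq_or_lt with rfl | hN
  · rw [Finset.sum_eq_zero]
    · rw [Real.zero_rpow (by positivity)]; simp
    · intro j _; rw [mul_zero, min_eq_right hM.le, mul_zero]
  -- The two bounds cross at `j = L`, where `Q^(δL) N = M`. Terms decay geometrically on both sides
  -- at rate at least `ε`, and the factor `Q ^ β` pays for replacing `L` by its integer part.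
  set L := Real.logb Q (M / N) / δ with hL
  have hMN : M = N * Q ^ (δ * L) := by
    rw [hL, mul_div_cancel₀ _ hδ0.ne', Real.rpow_logb h0 hQ.ne' (by positivity)]
    field_simp
  have hpow : M ^ (1 - β / δ) * N ^ (β / δ) = N * Q ^ ((δ - β) * L) := by
    rw [hMN, Real.mul_rpow hN.le (by positivity), mul_right_comm, ← Real.rpow_add hN,
      ← Real.rpow_mul h0.le, sub_add_cancel, Real.rpow_one]
    congr 2
    field_simp
  rw [hpow]
  have hterm : ∀ j : ℤ, Q ^ (-(β * j)) * min M (Q ^ (δ * j) * N) ≤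
      Q ^ β * Q ^ (-(ε * |((j - ⌊L⌋ : ℤ) : ℝ)|)) * (N * Q ^ ((δ - β) * L)) := by
    intro j
    have hfl := Int.floor_le L
    have hfl' := Int.lt_floor_add_one L
    have hrhs : Q ^ β * Q ^ (-(ε * |((j - ⌊L⌋ : ℤ) : ℝ)|)) * (N * Q ^ ((δ - β) * L)) =
        N * Q ^ (β - ε * |((j - ⌊L⌋ : ℤ) : ℝ)| + (δ - β) * L) := by
      rw [Real.rpow_add h0, sub_eq_add_neg β, Real.rpow_add h0]; ring
    rw [hrhs]
    rcases le_or_gt ⌊L⌋ j with hj | hj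
    · have hj' : (⌊L⌋ : ℝ) ≤ j := by exact_mod_cast hj
      calc Q ^ (-(β * j)) * min M (Q ^ (δ * j) * N) ≤ Q ^ (-(β * j)) * (N * Q ^ (δ * L)) :=
            mul_le_mul_of_nonneg_left ((min_le_left _ _).trans hMN.le) (by positivity)
        _ = N * Q ^ (-(β * j) + δ * L) := by rw [Real.rpow_add h0]; ring
        _ ≤ _ := by
            refine mul_le_mul_of_nonneg_left (Real.rpow_le_rpow_of_exponent_le hQ.le ?_) hN.le
            rw [Int.cast_sub, abs_of_nonneg (by linarith)]
            have h1 : ε * ((j : ℝ) - ⌊L⌋) ≤ β * ((j : ℝ) - ⌊L⌋) :=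
              mul_le_mul_of_nonneg_right (min_le_left _ _) (by linarith)
            have h2 : β * L ≤ β * (⌊L⌋ + 1) := mul_le_mul_of_nonneg_left hfl'.le hβ.le
            linarith
    · have hj' : (j : ℝ) ≤ ⌊L⌋ := by exact_mod_cast hj.le
      calc Q ^ (-(β * j)) * min M (Q ^ (δ * j) * N) ≤ Q ^ (-(β * j)) * (Q ^ (δ * j) * N) :=
            mul_le_mul_of_nonneg_left (min_le_right _ _) (by positivity)
        _ = N * Q ^ (-(β * j) + δ * j) := by rw [Real.rpow_add h0]; ring
        _ ≤ _ := by
            refine mul_le_mul_of_nonneg_left (Real.rpow_le_rpow_of_exponent_le hQ.le ?_) hN.le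
            rw [Int.cast_sub, abs_of_nonpos (by linarith)]
            have h1 : ε * (⌊L⌋ - (j : ℝ)) ≤ (δ - β) * (⌊L⌋ - (j : ℝ)) :=
              mul_le_mul_of_nonneg_right (min_le_right _ _) (by linarith)
            have h2 : (δ - β) * ⌊L⌋ ≤ (δ - β) * L :=
              mul_le_mul_of_nonneg_left hfl (by linarith)
            linarith
  refine (Finset.sum_le_sum fun j _ => hterm j).trans ?_
  rw [← Finset.sum_mul, ← Finset.mul_sum]
  refine mul_le_mul_of_nonneg_right (mul_le_mul_of_nonneg_left ?_ (by positivity)) (by positivity)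
  have hshift : Summable fun j : ℤ => Q ^ (-(ε * |((j - ⌊L⌋ : ℤ) : ℝ)|)) :=
    (Equiv.subRight ⌊L⌋).summable_iff.2 hs
  have ht := (Equiv.subRight ⌊L⌋).tsum_eq fun i : ℤ => Q ^ (-(ε * |(i : ℝ)|))
  simp only [Equiv.subRight_apply] at ht
  rw [← ht]
  exact hshift.sum_le_tsum s fun j _ => Real.rpow_nonneg h0.le _

end RealInequalities

/-! ### Bounds of averages in `L_p` and the maximal inequality. -/

section Estimates

variable {K : Type*} [NontriviallyNormedField K] [IsUltrametricDist K]
  [LocallyCompactSpace K] [MeasurableSpace K] [BorelSpace K] [ProperSpace K] {n : ℕ}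

local notation "qK" => (residueCard K : ℝ)

theorem IsTest.rpow_norm {W : Type*} [NormedAddCommGroup W] {f : (Fin n → K) → W} (hf : IsTest f)
    {p : ℝ} (hp : 0 < p) : IsTest fun x => ‖f x‖ ^ p :=
  hf.comp (fun w => ‖w‖ ^ p) (by simp [hp.ne'])

theorem IsTest.rpow {f : (Fin n → K) → ℝ} (hf : IsTest f) {p : ℝ} (hp : 0 < p) :
    IsTest fun x => f x ^ p :=
  hf.comp (fun w => w ^ p) (Real.zero_rpow hp.ne')

theorem ballAvg_nonneg (hK : IsNormalizedAbs K) (m : ℤ) {g : (Fin n → K) → ℝ} (hg : ∀ x, 0 ≤ g x)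
    (x : Fin n → K) : 0 ≤ ballAvg m g x :=
  mul_nonneg (residueCard_zpow_pos hK _).le (integral_nonneg fun y => hg y)

theorem norm_ballAvg_le (hK : IsNormalizedAbs K) (m : ℤ) (f : (Fin n → K) → ℂ) (x : Fin n → K) :
    ‖ballAvg m f x‖ ≤ ballAvg m (fun y => ‖f y‖) x := by
  rw [ballAvg, norm_smul, Real.norm_of_nonneg (residueCard_zpow_pos hK _).le]
  exact mul_le_mul_of_nonneg_left (norm_integral_le_integral_norm _) (residueCard_zpow_pos hK _).le

/-- Jensen's inequality. -/
theorem ballAvg_rpow_le (hK : IsNormalizedAbs K) (m : ℤ) {g : (Fin n → K) → ℝ}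
    (hg : ∀ x, 0 ≤ g x) (hgt : IsTest g) {p : ℝ} (hp : 1 ≤ p) (x : Fin n → K) :
    ballAvg m g x ^ p ≤ ballAvg m (fun y => g y ^ p) x := by
  have havg : ∀ h : (Fin n → K) → ℝ, ballAvg m h x =
      ⨍ y in Metric.closedBall x (qK ^ (-m)), h y ∂(haarPi K n) := by
    intro h
    have e : (qK ^ (-m * n))⁻¹ = qK ^ (m * n) := by rw [neg_mul, zpow_neg, inv_inv]
    rw [setAverage_eq, haarPi_real_closedBall_zpow hK, e, ballAvg]
  have hvol : haarPi K n (Metric.closedBall x (qK ^ (-m))) =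
    ENNReal.ofReal (qK ^ (-m * n)) := haarPi_closedBall_zpow hK x (-m)
  rw [havg, havg]
  refine (convexOn_rpow hp).map_set_average_le
    (Real.continuous_rpow_const (by linarith)).continuousOn isClosed_Ici ?_ ?_
    (.of_forall fun y => hg y) (integrableOn_closedBall hgt.continuous _ _)
    (integrableOn_closedBall (hgt.rpow (by linarith)).continuous _ _)
  · rw [hvol, ne_eq, ENNReal.ofReal_eq_zero, not_le]; exact residueCard_zpow_pos hK _
  · rw [hvol]; exact ENNReal.ofReal_ne_top

theorem normL_eq {f : (Fin n → K) → ℂ} (hf : IsTest f) {p : ℝ} (hp : 1 < p) :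
    normL p f = ENNReal.ofReal ((∫ x, ‖f x‖ ^ p ∂(haarPi K n)) ^ p⁻¹) := by
  have h : MemLp f (ENNReal.ofReal p) (haarPi K n) :=
    hf.continuous.memLp_of_hasCompactSupport hf.hasCompactSupport
  rw [normL, h.eLpNorm_eq_integral_rpow_norm (by simp; linarith) ENNReal.ofReal_ne_top,
    ENNReal.toReal_ofReal (by linarith)]

theorem norm_rpow_ballAvg_le (hK : IsNormalizedAbs K) (m : ℤ) {f : (Fin n → K) → ℂ}
    (hf : IsTest f) {p : ℝ} (hp : 1 ≤ p) (x : Fin n → K) :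
    ‖ballAvg m f x‖ ^ p ≤ ballAvg m (fun y => ‖f y‖ ^ p) x :=
  (Real.rpow_le_rpow (norm_nonneg _) (norm_ballAvg_le hK m f x) (by linarith)).trans
    (ballAvg_rpow_le hK m (fun _ => norm_nonneg _) (hf.comp _ norm_zero) hp x)

/-- Averaging is a contraction of `L_p`. -/
theorem normL_ballAvg_le (hK : IsNormalizedAbs K) (m : ℤ) {f : (Fin n → K) → ℂ} (hf : IsTest f)
    {p : ℝ} (hp : 1 < p) : normL p (ballAvg m f) ≤ normL p f := by
  rw [normL_eq hf hp, normL_eq (hf.ballAvg hK m) hp]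
  have ht := hf.rpow_norm (p := p) (by linarith)
  refine ENNReal.ofReal_le_ofReal (Real.rpow_le_rpow (integral_nonneg fun x => by positivity) ?_
    (by positivity))
  rw [← integral_ballAvg hK m ht]
  exact integral_mono ((hf.ballAvg hK m).rpow_norm (by linarith)).integrable
    (ht.ballAvg hK m).integrable fun x => norm_rpow_ballAvg_le hK m hf hp.le x

/-- Waves are bounded in `L_p` by their value at time zero. -/
theorem normL_waveSolution_le (hK : IsNormalizedAbs K) (β : ℝ) {φ : (Fin n → K) → ℂ}
    (hφ : IsLizorkin φ) {p : ℝ} (hp : 1 < p) (t : K) :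
    normL p (waveSolution β φ t) ≤
      ((qK / (qK - 1) + (qK - 1)⁻¹).toNNReal : ℝ≥0) * normL p (waveSolution β φ 0) := by
  have hq := one_lt_residueCard hK
  have hq1 : 0 < qK - 1 := by linarith
  have h0 : IsTest (waveSolution β φ 0) := (hφ.multiplier hK _).isTest
  rcases eq_or_ne t 0 with rfl | ht
  · refine le_mul_of_one_le_left (zero_le) ?_
    rw [ENNReal.one_le_coe_iff, Real.one_le_toNNReal]
    have : 1 ≤ qK / (qK - 1) := by rw [le_div_iff₀ hq1]; linarith
    have : 0 ≤ (qK - 1)⁻¹ := by positivity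
    linarith
  · obtain ⟨k, hk⟩ := norm_eq_zpow hK ht
    have hfun : waveSolution β φ t =
        (qK / (qK - 1) : ℝ) • ballAvg (-k) (waveSolution β φ 0) -
          ((qK - 1)⁻¹ : ℝ) • ballAvg (1 - k) (waveSolution β φ 0) :=
      funext fun x => waveSolution_eq_ballAvg hK β hφ hk x
    have hm : ∀ (c : ℝ) (m : ℤ), AEStronglyMeasurable (c • ballAvg m (waveSolution β φ 0))
        (haarPi K n) := fun c m =>
      ((h0.ballAvg hK m).continuous.const_smul c).aestronglyMeasurable
    have hb : ∀ (c : ℝ) (m : ℤ), 0 ≤ c → normL p (c • ballAvg m (waveSolution β φ 0)) ≤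
        ENNReal.ofReal c * normL p (waveSolution β φ 0) := by
      intro c m hc
      rw [normL, eLpNorm_const_smul, Real.enorm_of_nonneg hc]
      exact mul_le_mul_right (normL_ballAvg_le hK m h0 hp) _
    have hp1 : 1 ≤ ENNReal.ofReal p := by
      rw [← ENNReal.ofReal_one]; exact ENNReal.ofReal_le_ofReal hp.le
    calc normL p (waveSolution β φ t) ≤
        normL p ((qK / (qK - 1) : ℝ) • ballAvg (-k) (waveSolution β φ 0)) +
          normL p (((qK - 1)⁻¹ : ℝ) • ballAvg (1 - k) (waveSolution β φ 0)) := by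
          rw [hfun]; exact eLpNorm_sub_le (hm _ _) (hm _ _) hp1
      _ ≤ ENNReal.ofReal (qK / (qK - 1)) * normL p (waveSolution β φ 0) +
          ENNReal.ofReal (qK - 1)⁻¹ * normL p (waveSolution β φ 0) :=
          add_le_add (hb _ _ (by positivity)) (hb _ _ (by positivity))
      _ = _ := by
          rw [← add_mul, ← ENNReal.ofReal_add (by positivity) (by positivity)]
          rfl

/-- The maximal function over the balls of radii `q⁻ᵃ, …, q⁻ᵃ⁻ᵏ`. -/
noncomputable def maximalAvg (a : ℤ) (g : (Fin n → K) → ℝ) : ℕ → (Fin n → K) → ℝ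
  | 0 => ballAvg a g
  | k + 1 => fun x => max (maximalAvg a g k x) (ballAvg (a + (k + 1)) g x)

theorem isLevel_maximalAvg (hK : IsNormalizedAbs K) (a : ℤ) (g : (Fin n → K) → ℝ) (k : ℕ) :
    IsLevel (a + k) (maximalAvg a g k) := by
  induction k with
  | zero => simpa [maximalAvg] using isLevel_ballAvg a g
  | succ k ih =>
    push_cast
    exact (ih.mono hK (by omega)).comp₂ (isLevel_ballAvg (a + (k + 1)) g) max

theorem isTest_maximalAvg (hK : IsNormalizedAbs K) (a : ℤ) {g : (Fin n → K) → ℝ} (hg : IsTest g)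
    (k : ℕ) : IsTest (maximalAvg a g k) := by
  induction k with
  | zero => exact hg.ballAvg hK a
  | succ k ih => exact ih.comp₂ (hg.ballAvg hK (a + (k + 1))) max (max_self 0)

theorem ballAvg_le_maximalAvg (a : ℤ) (g : (Fin n → K) → ℝ) (k i : ℕ) (hi : i ≤ k)
    (x : Fin n → K) : ballAvg (a + i) g x ≤ maximalAvg a g k x := by
  induction k with
  | zero =>
    obtain rfl : i = 0 := by omega
    simp [maximalAvg]
  | succ k ih =>
    rcases Nat.lt_or_ge i (k + 1) with h | h
    · exact (ih (by omega)).trans (le_max_left _ _)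
    · obtain rfl : i = k + 1 := by omega
      push_cast
      exact le_max_right _ _

theorem maximalAvg_nonneg (hK : IsNormalizedAbs K) (a : ℤ) {g : (Fin n → K) → ℝ}
    (hg : ∀ x, 0 ≤ g x) (k : ℕ) (x : Fin n → K) : 0 ≤ maximalAvg a g k x := by
  have := ballAvg_le_maximalAvg a g k 0 (by omega) x
  exact (ballAvg_nonneg hK _ hg x).trans this

/-- Induction on the number of radii. The increment of `M^(p-1)` is constant on the newest balls, so
the newest average, integrated against it, may be replaced by `g`; the increments then telescope. -/
theorem integral_maximalAvg_rpow_le (hK : IsNormalizedAbs K) (a : ℤ) {g : (Fin n → K) → ℝ}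
    (hg : IsTest g) (hg0 : ∀ x, 0 ≤ g x) {p : ℝ} (hp : 1 < p) (k : ℕ) :
    ∫ x, maximalAvg a g k x ^ p ∂(haarPi K n) ≤
      p / (p - 1) * ∫ x, g x * maximalAvg a g k x ^ (p - 1) ∂(haarPi K n) := by
  have hp1 : 0 < p - 1 := by linarith
  have hMt := isTest_maximalAvg hK a hg
  have hM0 := maximalAvg_nonneg hK a hg0
  have hgM : ∀ k, IsTest fun x => g x * maximalAvg a g k x ^ (p - 1) := fun k =>
    hg.comp₂ (hMt k) (fun a b => a * b ^ (p - 1)) (zero_mul _)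
  induction k with
  | zero =>
    have h1 : ∫ x, maximalAvg a g 0 x ^ p ∂(haarPi K n) =
        ∫ x, g x * maximalAvg a g 0 x ^ (p - 1) ∂(haarPi K n) := by
      have h2 := integral_smul_ballAvg hK ((isLevel_ballAvg a g).comp (· ^ (p - 1))) hg
      calc _ = ∫ x, ballAvg a g x ^ (p - 1) • ballAvg a g x ∂(haarPi K n) := by
            congr 1
            ext x
            have h3 := ballAvg_nonneg hK a hg0 x
            rw [maximalAvg, smul_eq_mul]
            rcases h3.eq_or_lt with h4 | h4
            · rw [← h4, mul_zero, Real.zero_rpow (by linarith)]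
            · rw [Real.rpow_sub_one h4.ne']; field_simp
        _ = _ := h2
        _ = _ := by simp only [maximalAvg, smul_eq_mul, mul_comm]
    rw [h1]
    refine le_mul_of_one_le_left (integral_nonneg fun x =>
      mul_nonneg (hg0 x) (Real.rpow_nonneg (hM0 0 x) _)) ?_
    rw [le_div_iff₀ hp1]; linarith
  | succ k ih =>
    set f := ballAvg (a + (k + 1)) g with hf
    let h : (Fin n → K) → ℝ := fun x =>
      maximalAvg a g (k + 1) x ^ (p - 1) - maximalAvg a g k x ^ (p - 1)
    have hh : IsLevel (a + (k + 1)) h := by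
      have h1 := (isLevel_maximalAvg hK a g (k + 1)).comp (· ^ (p - 1))
      have h2 := ((isLevel_maximalAvg hK a g k).mono hK (m' := a + (k + 1)) (by omega)).comp
        (· ^ (p - 1))
      push_cast at h1
      exact h1.comp₂ h2 (· - ·)
    have hht : IsTest h := ((hMt (k + 1)).rpow hp1).comp₂ ((hMt k).rpow hp1) (· - ·) (sub_zero 0)
    have hft : IsTest f := hg.ballAvg hK _
    have hpt : ∀ x, maximalAvg a g (k + 1) x ^ p ≤
        maximalAvg a g k x ^ p + p / (p - 1) * (f x * h x) := fun x =>
      max_rpow_le hp (hM0 k x) (ballAvg_nonneg hK _ hg0 x)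
    have hfh : IsTest fun x => f x * h x := hft.comp₂ hht (· * ·) (zero_mul _)
    have hadj : ∫ x, f x * h x ∂(haarPi K n) = ∫ x, g x * h x ∂(haarPi K n) := by
      have := integral_smul_ballAvg hK hh hg
      simpa only [smul_eq_mul, mul_comm] using this
    have hsplit : ∫ x, g x * h x ∂(haarPi K n) =
        ∫ x, g x * maximalAvg a g (k + 1) x ^ (p - 1) ∂(haarPi K n) -
          ∫ x, g x * maximalAvg a g k x ^ (p - 1) ∂(haarPi K n) := by
      rw [← integral_sub (hgM (k + 1)).integrable (hgM k).integrable]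
      simp only [h, mul_sub]
    calc ∫ x, maximalAvg a g (k + 1) x ^ p ∂(haarPi K n)
        ≤ ∫ x, (maximalAvg a g k x ^ p + p / (p - 1) * (f x * h x)) ∂(haarPi K n) :=
          integral_mono ((hMt (k + 1)).rpow (by linarith)).integrable
            (((hMt k).rpow (by linarith)).integrable.add (hfh.integrable.const_mul _)) hpt
      _ = ∫ x, maximalAvg a g k x ^ p ∂(haarPi K n) +
          p / (p - 1) * ∫ x, g x * h x ∂(haarPi K n) := by
          rw [integral_add ((hMt k).rpow (by linarith)).integrable (hfh.integrable.const_mul _),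
            integral_const_mul, hadj]
      _ ≤ _ := by
          rw [hsplit, mul_sub]; linarith

/-- Doob's maximal inequality in `L_p`. -/
theorem integral_maximalAvg_rpow_le_integral (hK : IsNormalizedAbs K) (a : ℤ)
    {g : (Fin n → K) → ℝ} (hg : IsTest g) (hg0 : ∀ x, 0 ≤ g x) {p : ℝ} (hp : 1 < p) (k : ℕ) :
    ∫ x, maximalAvg a g k x ^ p ∂(haarPi K n) ≤
      2 ^ p / (p - 1) * ∫ x, g x ^ p ∂(haarPi K n) := by
  have hp1 : 0 < p - 1 := by linarith
  have hM := isTest_maximalAvg hK a hg k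
  have hM0 := maximalAvg_nonneg hK a hg0 k
  have h1 := integral_maximalAvg_rpow_le hK a hg hg0 hp k
  have hi1 := (hg.rpow (p := p) (by linarith)).integrable
  have hi2 := (hM.rpow (p := p) (by linarith)).integrable
  -- Young's inequality produces half of the integral of `M ^ p`, which is finite and moves to the
  -- left side.
  have h2 : p / (p - 1) * ∫ x, g x * maximalAvg a g k x ^ (p - 1) ∂(haarPi K n) ≤
      2 ^ p / (2 * (p - 1)) * ∫ x, g x ^ p ∂(haarPi K n) +
        1 / 2 * ∫ x, maximalAvg a g k x ^ p ∂(haarPi K n) := by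
    rw [← integral_const_mul, ← integral_const_mul, ← integral_const_mul,
      ← integral_add (hi1.const_mul _) (hi2.const_mul _)]
    refine integral_mono ?_ ((hi1.const_mul _).add (hi2.const_mul _)) fun x =>
      mul_rpow_sub_one_le_half hp (hg0 x) (hM0 x)
    exact (hg.comp₂ hM (fun a b => a * b ^ (p - 1)) (zero_mul _)).integrable.const_mul _
  have h3 : 2 ^ p / (p - 1) * ∫ x, g x ^ p ∂(haarPi K n) =
      2 * (2 ^ p / (2 * (p - 1)) * ∫ x, g x ^ p ∂(haarPi K n)) := by field_simp
  rw [h3]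
  linarith

end Estimates

end NAWave

namespace NAWave

set_option linter.unusedSectionVars false

/-! ### The Hardy–Littlewood–Sobolev inequality and identification of solutions. -/

section Potential

variable {K : Type*} [NontriviallyNormedField K] [IsUltrametricDist K]
  [LocallyCompactSpace K] [MeasurableSpace K] [BorelSpace K] [ProperSpace K] {n : ℕ}

local notation "qK" => (residueCard K : ℝ)

/-- Jensen's inequality, with the integral over the ball enlarged to the whole space. -/
theorem norm_ballAvg_le_rpow_mul (hK : IsNormalizedAbs K) (m : ℤ) {f : (Fin n → K) → ℂ}
    (hf : IsTest f) {p : ℝ} (hp : 1 ≤ p) (x : Fin n → K) :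
    ‖ballAvg m f x‖ ≤ qK ^ ((n : ℝ) / p * m) * (∫ y, ‖f y‖ ^ p ∂(haarPi K n)) ^ p⁻¹ := by
  have hp0 : 0 < p := by linarith
  have hq := residueCard_pos hK
  have hI : 0 ≤ ∫ y, ‖f y‖ ^ p ∂(haarPi K n) := integral_nonneg fun y => by positivity
  have h1 : ‖ballAvg m f x‖ ^ p ≤ qK ^ (m * n) * ∫ y, ‖f y‖ ^ p ∂(haarPi K n) := by
    refine (norm_rpow_ballAvg_le hK m hf hp x).trans ?_
    rw [ballAvg, smul_eq_mul]
    exact mul_le_mul_of_nonneg_left (setIntegral_le_integral (hf.rpow_norm hp0).integrable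
      (.of_forall fun y => by positivity)) (residueCard_zpow_pos hK _).le
  calc ‖ballAvg m f x‖ = (‖ballAvg m f x‖ ^ p) ^ p⁻¹ :=
        (Real.rpow_rpow_inv (norm_nonneg _) hp0.ne').symm
    _ ≤ (qK ^ (m * n) * ∫ y, ‖f y‖ ^ p ∂(haarPi K n)) ^ p⁻¹ :=
        Real.rpow_le_rpow (by positivity) h1 (by positivity)
    _ = _ := by
        rw [Real.mul_rpow (residueCard_zpow_pos hK _).le hI, ← Real.rpow_intCast,
          ← Real.rpow_mul hq.le]
        congr 2
        push_cast
        field_simp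

/-- Hedberg's pointwise estimate of the potential of order `β`. -/
theorem exists_norm_waveSolution_le (hK : IsNormalizedAbs K) {β p : ℝ} (hβ : 0 < β) (hp : 1 < p)
    (hβp : β < n / p) : ∃ C : ℝ, 0 ≤ C ∧ ∀ φ : (Fin n → K) → ℂ, IsLizorkin φ →
      ∃ (a : ℤ) (k : ℕ), ∀ x, ‖waveSolution β φ (0 : K) x‖ ≤
        C * (maximalAvg a (fun y => ‖φ y‖) k x ^ (1 - β / (n / p)) *
          ((∫ y, ‖φ y‖ ^ p ∂(haarPi K n)) ^ p⁻¹) ^ (β / (n / p))) := by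
  have hq := one_lt_residueCard hK
  have hq0 := residueCard_pos hK
  obtain ⟨C, hC, hsum⟩ := exists_sum_rpow_min_le hq hβ hβp
  refine ⟨2 * C, by positivity, fun φ hφ => ?_⟩
  obtain ⟨J, hJ⟩ := hφ.exists_hasBand hK
  -- The frequency parts `-J < j ≤ J` use the averages of indices `-J` to `J`.
  refine ⟨-J, 2 * J, fun x => ?_⟩
  set g : (Fin n → K) → ℝ := fun y => ‖φ y‖ with hg
  set M := maximalAvg (-J) g (2 * J) x with hM
  set N := (∫ y, ‖φ y‖ ^ p ∂(haarPi K n)) ^ p⁻¹ with hN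
  have hN0 : 0 ≤ N := Real.rpow_nonneg (integral_nonneg fun y => by positivity) _
  have hM0 : 0 ≤ M := maximalAvg_nonneg hK _ (fun y => norm_nonneg _) _ _
  have hδ : 0 < (n : ℝ) / p := hβ.trans hβp
  have havg : ∀ i j : ℤ, -J ≤ i → i ≤ j → j ≤ J →
      ‖ballAvg i φ x‖ ≤ min M (qK ^ ((n : ℝ) / p * j) * N) := by
    intro i j hi hij hj
    refine le_min ((norm_ballAvg_le hK i φ x).trans ?_)
      ((norm_ballAvg_le_rpow_mul hK i hφ.isTest hp.le x).trans ?_)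
    · have h := ballAvg_le_maximalAvg (-J : ℤ) g (2 * J) (i + J).toNat (by omega) x
      rwa [Int.toNat_of_nonneg (by omega), show (-J : ℤ) + (i + J) = i by ring] at h
    · refine mul_le_mul_of_nonneg_right (Real.rpow_le_rpow_of_exponent_le hq.le ?_) hN0
      exact mul_le_mul_of_nonneg_left (by exact_mod_cast hij) hδ.le
  rw [waveSolution_zero hK, hJ.multiplier_eq]
  calc ‖∑ j ∈ Finset.Ioc (-(J : ℤ)) J, (symb K β j)⁻¹ * bandPass j φ x‖
      ≤ ∑ j ∈ Finset.Ioc (-(J : ℤ)) J,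
          2 * (qK ^ (-(β * j)) * min M (qK ^ ((n : ℝ) / p * j) * N)) := by
        refine norm_sum_le_of_le _ fun j hj => ?_
        rw [Finset.mem_Ioc] at hj
        have h1 : ‖(symb K β j)⁻¹‖ = qK ^ (-(β * j)) := by
          rw [symb, norm_inv, Complex.norm_real, Real.norm_of_nonneg (by positivity),
            Real.rpow_neg hq0.le, ← Real.rpow_intCast, ← Real.rpow_mul hq0.le, mul_comm]
        have h2 : ‖bandPass j φ x‖ ≤ 2 * min M (qK ^ ((n : ℝ) / p * j) * N) := by
          rw [two_mul]
          exact (norm_sub_le _ _).trans (add_le_add (havg j j (by omega) le_rfl hj.2)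
            (havg (j - 1) j (by omega) (by omega) hj.2))
        rw [norm_mul, h1, mul_left_comm]
        exact mul_le_mul_of_nonneg_left h2 (by positivity)
    _ ≤ 2 * C * (M ^ (1 - β / (n / p)) * N ^ (β / (n / p))) := by
        rw [← Finset.mul_sum, mul_assoc]
        exact mul_le_mul_of_nonneg_left (hsum _ M N hM0 hN0) zero_le_two

/-- The Hardy–Littlewood–Sobolev inequality. -/
theorem exists_normL_waveSolution_le (hK : IsNormalizedAbs K) {β p : ℝ} (hβ : 0 < β) (hp : 1 < p)
    (hβp : β < n / p) : ∃ C : ℝ≥0, ∀ φ : (Fin n → K) → ℂ, IsLizorkin φ →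
      normL (p / (1 - β / (n / p))) (waveSolution β φ (0 : K)) ≤ C * normL p φ := by
  obtain ⟨C, hC, hbd⟩ := exists_norm_waveSolution_le (K := K) hK hβ hp hβp
  set θ := β / (n / p) with hθ
  have hδ : 0 < (n : ℝ) / p := hβ.trans hβp
  have hθ0 : 0 < θ := div_pos hβ hδ
  have hθ1 : 0 < 1 - θ := by rw [sub_pos, hθ, div_lt_one hδ]; exact hβp
  have hp0 : 0 < p := by linarith
  set r := p / (1 - θ) with hr
  have hr0 : 0 < r := by positivity
  have hr1 : 1 < r := by rw [hr, lt_div_iff₀ hθ1]; linarith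
  have hp1 : 0 < p - 1 := by linarith
  refine ⟨(C * (2 ^ p / (p - 1)) ^ r⁻¹).toNNReal, fun φ hφ => ?_⟩
  obtain ⟨a, k, hb⟩ := hbd φ hφ
  have hφt := hφ.isTest
  have hgt : IsTest fun y => ‖φ y‖ := hφt.comp _ norm_zero
  set I := ∫ y, ‖φ y‖ ^ p ∂(haarPi K n) with hI
  have hI0 : 0 ≤ I := integral_nonneg fun y => by positivity
  set M := maximalAvg a (fun y => ‖φ y‖) k with hM
  have hM0 : ∀ x, 0 ≤ M x := maximalAvg_nonneg hK _ (fun y => norm_nonneg _) _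
  have hMt : IsTest M := isTest_maximalAvg hK a hgt k
  have hwt : IsTest (waveSolution β φ (0 : K)) := by
    rw [waveSolution_zero hK]
    exact (hφ.multiplier hK _).isTest
  have hdoob : ∫ x, M x ^ p ∂(haarPi K n) ≤ 2 ^ p / (p - 1) * I :=
    integral_maximalAvg_rpow_le_integral hK a hgt (fun y => norm_nonneg _) hp k
  have hpt : ∀ x, ‖waveSolution β φ (0 : K) x‖ ^ r ≤ (C ^ r * I ^ (p⁻¹ * θ * r)) * M x ^ p := by
    intro x
    refine (Real.rpow_le_rpow (norm_nonneg _) (hb x) hr0.le).trans (le_of_eq ?_)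
    -- The target exponent `r` is chosen so that the maximal function appears to the power `p`, as
    -- in Doob's inequality.
    have e : (1 - θ) * r = p := by rw [hr]; field_simp
    rw [Real.mul_rpow hC (mul_nonneg (Real.rpow_nonneg (hM0 x) _) (by positivity)),
      Real.mul_rpow (Real.rpow_nonneg (hM0 x) _) (by positivity), ← Real.rpow_mul (hM0 x), e,
      ← Real.rpow_mul hI0, ← Real.rpow_mul hI0]
    ring
  have hint : ∫ x, ‖waveSolution β φ (0 : K) x‖ ^ r ∂(haarPi K n) ≤
      (C ^ r * I ^ (p⁻¹ * θ * r)) * (2 ^ p / (p - 1) * I) := by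
    refine (integral_mono (hwt.rpow_norm hr0).integrable
      ((hMt.rpow hp0).integrable.const_mul _) hpt).trans ?_
    rw [integral_const_mul]
    exact mul_le_mul_of_nonneg_left hdoob (by positivity)
  have hexp : p⁻¹ * θ * r + 1 = p⁻¹ * r := by rw [hr]; field_simp; ring
  have hroot : (∫ x, ‖waveSolution β φ (0 : K) x‖ ^ r ∂(haarPi K n)) ^ r⁻¹ ≤
      C * (2 ^ p / (p - 1)) ^ r⁻¹ * I ^ p⁻¹ := by
    refine (Real.rpow_le_rpow (integral_nonneg fun y => by positivity) hint
      (by positivity)).trans (le_of_eq ?_)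
    have e : C ^ r * I ^ (p⁻¹ * θ * r) * (2 ^ p / (p - 1) * I) =
        C ^ r * (2 ^ p / (p - 1)) * I ^ (p⁻¹ * r) := by
      rw [← hexp, Real.rpow_add_one' hI0 (by positivity)]; ring
    rw [e, Real.mul_rpow (by positivity) (by positivity), Real.mul_rpow (by positivity)
      (by positivity), Real.rpow_rpow_inv hC hr0.ne', ← Real.rpow_mul hI0,
      mul_inv_cancel_right₀ hr0.ne']
  rw [normL_eq hwt hr1, normL_eq hφt hp]
  refine (ENNReal.ofReal_le_ofReal hroot).trans (le_of_eq ?_)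
  rw [ENNReal.ofReal_mul (by positivity)]
  rfl

/-- Makes the condition `F 0 = φ` the case `β = 0` of the initial condition, so that one uniqueness
theorem serves both problems. -/
theorem IsWaveSolution.fracDerivLine_zero_order (hK : IsNormalizedAbs K) {χ : AddChar K Circle}
    (hχ : IsRankZero χ) {α : ℝ} {F : K → (Fin n → K) → ℂ} (hF : IsWaveSolution χ α F) (t : K)
    (x : Fin n → K) : fracDerivLine χ 0 (fun s => F s x) t = F t x := by
  have h := hF.lizorkin_time x
  have hs : symb K 0 = fun _ => 1 := funext symb_zero
  rw [fracDerivLine_eq_multiplier hK hχ 0 h, hs, multiplier_one hK h.lineLift]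
  rfl

theorem IsCauchySolution.eq_waveSolution (hK : IsNormalizedAbs K) {χ : AddChar K Circle}
    (hχ : IsRankZero χ) {α : ℝ} (hα : 0 < α) {φ : (Fin n → K) → ℂ} (hφ : IsLizorkin φ)
    {F : K → (Fin n → K) → ℂ} (hF : IsCauchySolution χ α φ F) : F = waveSolution 0 φ :=
  IsWaveSolution.unique (β := 0) hK hχ hα hF.toIsWaveSolution
    (isWaveSolution_waveSolution hK hχ α 0 hφ) hφ
    (fun x => by rw [hF.toIsWaveSolution.fracDerivLine_zero_order hK hχ, hF.initial])
    (fracDerivLine_waveSolution_zero hK hχ 0 hφ)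

theorem IsModifiedCauchySolution.eq_waveSolution (hK : IsNormalizedAbs K) {χ : AddChar K Circle}
    (hχ : IsRankZero χ) {α : ℝ} (hα : 0 < α) {φ : (Fin n → K) → ℂ} (hφ : IsLizorkin φ)
    {F : K → (Fin n → K) → ℂ} (hF : IsModifiedCauchySolution χ α φ F) :
    F = waveSolution ((n : ℝ) - 1) φ :=
  IsWaveSolution.unique hK hχ hα hF.toIsWaveSolution
    (isWaveSolution_waveSolution hK hχ α _ hφ) hφ hF.initial
    (fracDerivLine_waveSolution_zero hK hχ _ hφ)

theorem waveSolution_zero_order_zero (hK : IsNormalizedAbs K) {φ : (Fin n → K) → ℂ}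
    (hφ : IsLizorkin φ) : waveSolution 0 φ (0 : K) = φ := by
  rw [waveSolution_zero hK]
  simp only [symb_zero, inv_one]
  exact multiplier_one hK hφ

end Potential

end NAWave

open NAWave

/-! ### Assembly of both Cauchy problems. -/

theorem mainTheorem6 {K : Type*} [NontriviallyNormedField K] [IsUltrametricDist K]
    [LocallyCompactSpace K] [MeasurableSpace K] [BorelSpace K]
    (hK : IsNormalizedAbs K) (χ : AddChar K Circle) (hχ : IsRankZero χ) :
    -- the modified Cauchy problem, `n ≥ 2`
    (∀ n : ℕ, 2 ≤ n →
      -- existence, uniqueness and representation of the solution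
      (∀ (α : ℝ) (φ : (Fin n → K) → ℂ), 0 < α → IsLizorkin φ →
        ∃ F : K → (Fin n → K) → ℂ,
          IsModifiedCauchySolution χ α φ F ∧
          (∀ G, IsModifiedCauchySolution χ α φ G → G = F) ∧
          (∀ t : K, t ≠ 0 →
            ConvExists (kernelB t) φ ∧ ConvExists kernelA (conv (kernelB t) φ) ∧
            F t = conv kernelA (conv (kernelB t) φ)) ∧
          (ConvExists kernelA φ ∧ F 0 = conv kernelA φ)) ∧
      -- the bound by the potential `A * φ`
      (∃ C : ℝ≥0, ∀ (α : ℝ) (φ : (Fin n → K) → ℂ) (F : K → (Fin n → K) → ℂ) (κ : ℝ),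
        0 < α → IsLizorkin φ → IsModifiedCauchySolution χ α φ F → 1 < κ →
        ∀ t : K, normL κ (F t) ≤ C * normL κ (conv kernelA φ)) ∧
      -- the `L_κ → L_λ` bound
      (∀ κ : ℝ, 1 < κ → κ < (n : ℝ) / ((n : ℝ) - 1) →
        ∃ C' : ℝ≥0, ∀ (α : ℝ) (φ : (Fin n → K) → ℂ) (F : K → (Fin n → K) → ℂ),
          0 < α → IsLizorkin φ → IsModifiedCauchySolution χ α φ F →
          ∀ t : K,
            normL ((n : ℝ) * κ / ((n : ℝ) - κ * ((n : ℝ) - 1))) (F t) ≤ C' * normL κ φ)) ∧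
    -- the Cauchy problem, `n ≥ 1`
    (∀ n : ℕ, 1 ≤ n →
      (∀ (α : ℝ) (φ : (Fin n → K) → ℂ), 0 < α → IsLizorkin φ →
        ∃ F : K → (Fin n → K) → ℂ,
          IsCauchySolution χ α φ F ∧
          (∀ G, IsCauchySolution χ α φ G → G = F) ∧
          (∀ t : K, t ≠ 0 → ConvExists (kernelB t) φ ∧ F t = conv (kernelB t) φ)) ∧
      (∃ C : ℝ≥0, ∀ (α : ℝ) (φ : (Fin n → K) → ℂ) (F : K → (Fin n → K) → ℂ) (κ : ℝ),
        0 < α → IsLizorkin φ → IsCauchySolution χ α φ F → 1 < κ →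
        ∀ t : K, normL κ (F t) ≤ C * normL κ φ)) := by
  have : ProperSpace K := ProperSpace.of_locallyCompactSpace K
  refine ⟨fun n hn => ⟨fun α φ hα hφ => ?_, ?_, fun κ hκ hκn => ?_⟩,
    fun n _ => ⟨fun α φ hα hφ => ?_, ?_⟩⟩
  · refine ⟨waveSolution ((n : ℝ) - 1) φ, ⟨isWaveSolution_waveSolution hK hχ α _ hφ,
      fracDerivLine_waveSolution_zero hK hχ _ hφ⟩, fun G hG => hG.eq_waveSolution hK hχ hα hφ,
      fun t ht => ⟨convExists_kernelB hK ht hφ.isTest, waveSolution_modified hK hn hφ ht⟩,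
      (conv_kernelA hK hn hφ).1, waveSolution_modified_zero hK hn hφ⟩
  -- The sum of the absolute values of the two coefficients with which averages of `F 0` enter `F
  -- t`.
  · refine ⟨((residueCard K : ℝ) / (residueCard K - 1) + ((residueCard K : ℝ) - 1)⁻¹).toNNReal,
      fun α φ F κ hα hφ hF hκ t => ?_⟩
    rw [hF.eq_waveSolution hK hχ hα hφ, ← waveSolution_modified_zero hK hn hφ]
    exact normL_waveSolution_le hK _ hφ hκ t
  · have hn2 : (2 : ℝ) ≤ n := by exact_mod_cast hn
    have hβ : 0 < (n : ℝ) - 1 := by linarith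
    have hκ0 : 0 < κ := by linarith
    have hβκ : (n : ℝ) - 1 < n / κ := by
      rw [lt_div_iff₀ hβ] at hκn
      rw [lt_div_iff₀ hκ0]
      linarith
    have hd : 0 < (n : ℝ) - κ * ((n : ℝ) - 1) := by
      rw [lt_div_iff₀ hβ] at hκn
      linarith
    -- For order `n - 1` the Sobolev exponent is exactly `λ`.
    have hexp : κ / (1 - ((n : ℝ) - 1) / (n / κ)) = n * κ / (n - κ * ((n : ℝ) - 1)) := by
      have e : 1 - ((n : ℝ) - 1) / (n / κ) = (n - κ * ((n : ℝ) - 1)) / n := by field_simp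
      rw [e, div_div_eq_mul_div, mul_comm κ]
    have hlam : 1 < n * κ / (n - κ * ((n : ℝ) - 1)) := by
      rw [lt_div_iff₀ hd]
      nlinarith
    obtain ⟨C, hC⟩ := exists_normL_waveSolution_le (K := K) hK hβ hκ hβκ
    -- The bound of `F t` by `F 0` in `L_λ`, composed with the Sobolev inequality at time zero.
    refine ⟨((residueCard K : ℝ) / (residueCard K - 1) + ((residueCard K : ℝ) - 1)⁻¹).toNNReal * C,
      fun α φ F hα hφ hF t => ?_⟩
    rw [hF.eq_waveSolution hK hχ hα hφ]
    refine (normL_waveSolution_le hK _ hφ hlam t).trans ?_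
    rw [← hexp]
    refine (mul_le_mul_right (hC φ hφ) _).trans (le_of_eq ?_)
    rw [← mul_assoc, ← ENNReal.coe_mul]
  · refine ⟨waveSolution 0 φ, ⟨isWaveSolution_waveSolution hK hχ α 0 hφ, fun x => ?_⟩,
      fun G hG => hG.eq_waveSolution hK hχ hα hφ,
      fun t ht => ⟨convExists_kernelB hK ht hφ.isTest, waveSolution_zero_order hK hφ ht⟩⟩
    rw [waveSolution_zero_order_zero hK hφ]
  · refine ⟨((residueCard K : ℝ) / (residueCard K - 1) + ((residueCard K : ℝ) - 1)⁻¹).toNNReal,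
      fun α φ F κ hα hφ hF hκ t => ?_⟩
    rw [hF.eq_waveSolution hK hχ hα hφ]
    refine (normL_waveSolution_le hK 0 hφ hκ t).trans ?_
    rw [waveSolution_zero_order_zero hK hφ]
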